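/- Let $V$ be a complex Hilbert space (the one-particle space; finite- or infinite-dimensional), let $N\ge 0$, and let $V^{\otimes N}$ be the Hilbert space tensor power, on which $S_N$ acts by permuting the factors and a unitary operator $U$ of $V$ acts by $U^{\otimes N}$. An ideal gas of $N$ identical particles is described by a closed subspace $D\subseteq V^{\otimes N}$ that does not depend on the choice of a one-particle basis, i.e. $U^{\otimes N}D\subseteq D$ for every unitary $U$ of $V$. For a partition $\lambda$ of $N$ let $c_\lambda\in\mathbb C[S_N]$ be its Young symmetrizer, $S^\lambda=\mathbb C[S_N]c_\lambda$ the corresponding representation of $S_N$ (the $S^\lambda$ are irreducible and pairwise inequivalent), $f_\lambda=\dim S^\lambda$, $\chi^\lambda$ its character, $V^\lambda=c_\lambda V^{\otimes N}$, and let $$s_\lambda(x_1,x_2,\dots)=\sum_{\mu\vdash N}\frac{g_\mu}{N!}\,\chi^\lambda_\mu\prod_{m}\Big(\sum_i x_i^m\Big)^{a_{\mu,m}}$$ be the Schur function, where $a_{\mu,m}$ is the multiplicity of $m$ in $\mu$ and $g_\mu=N!/\prod_j j^{a_{\mu,j}}a_{\mu,j}!$. Then there are nonnegative integers $C_\lambda$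 ($\lambda\vdash N$), depending only on $D$, such that the following hold. (1) For every one-particle Hamiltonian with an orthonormal eigenbasis $(\phi_i)$ of $V$ and eigenvalues $\varepsilon_i\in\mathbb R$, and every $\beta\in\mathbb R$ with $\sum_i e^{-\beta\varepsilon_i}<\infty$, the operator $e^{-\beta H_N}$ of $N$ non-interacting particles (diagonal in the product basis, with eigenvalue $e^{-\beta(\varepsilon_{i_1}+\dots+\varepsilon_{i_N})}$ on $\phi_{i_1}\otimes\cdots\otimes\phi_{i_N}$) maps $D$ to itself, and its trace on $D$ (computed in any orthonormal basis of $D$), the canonical partition function, is $$Z(\beta,N)=\operatorname{tr}\big(e^{-\beta H_N}|_D\big)=\sum_{\lambda\vdash N}C_\lambda\,s_\lambda\big(e^{-\beta\varepsilon_1},e^{-\beta\varepsilon_2},\dots\big).$$ (2) $D$ is the orthogonal direct sum $\bigoplus_{\lambda\vdash N}\bigoplus_{k=1}^{C_\lambda}W_{\lambda,k}$ of nonzero closed subspaces, where each $W_{\lambda,k}$ is stable and irreducible under the operators $U^{\otimes N}$ and is isomorphic to $V^\lambda$ by an isomorphism of Hilbert spaces that commutes with all $U^{\otimes N}$; so $D\cong\bigoplus_\lambda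 (V^\lambda)^{\oplus C_\lambda}$. It carries the irreducible representation of $S_N$ labelled by $\lambda$: for every nonzero $x\in W_{\lambda,k}$ the span of $\{\sigma x:\sigma\in S_N\}$ is isomorphic to $S^\lambda$ as a representation of $S_N$. If moreover $D$ is stable under $S_N$, then each $C_\lambda$ is $0$ or $f_\lambda$, and $D$ is the sum, over the $\lambda$ with $C_\lambda\neq 0$, of the full $S_N$-isotypic components of type $\lambda$ of $V^{\otimes N}$. -/

import Mathlib

open scoped InnerProductSpace

noncomputable section

namespace IdealGas

/-! ### The Hilbert space of `N` particles -/

section HilbertTensorPower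

variable (V : Type*) [NormedAddCommGroup V] [InnerProductSpace ℂ V] (N : ℕ)

/-- The algebraic tensor power `V ⊗ ⋯ ⊗ V` (`N` factors), as a type of its own, so that it can carry
the Hilbert space inner product. -/
def AlgTensorPower : Type _ := PiTensorProduct ℂ (fun _ : Fin N => V)

instance : AddCommGroup (AlgTensorPower V N) :=
  inferInstanceAs (AddCommGroup (PiTensorProduct ℂ (fun _ : Fin N => V)))

instance : Module ℂ (AlgTensorPower V N) :=
  inferInstanceAs (Module ℂ (PiTensorProduct ℂ (fun _ : Fin N => V)))

variable {V N}

/-- The elementary tensor `v₁ ⊗ ⋯ ⊗ v_N`. -/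
def algTensor (v : Fin N → V) : AlgTensorPower V N := PiTensorProduct.tprod ℂ v

/-- The linear functional `v₁ ⊗ ⋯ ⊗ v_N ↦ ∏ k, ⟪w k, v k⟫`. -/
def innerFunctional (w : Fin N → V) : AlgTensorPower V N →ₗ[ℂ] ℂ :=
  PiTensorProduct.lift
    ((MultilinearMap.mkPiAlgebra ℂ (Fin N) ℂ).compLinearMap fun k => innerₛₗ ℂ (w k))

lemma innerFunctional_algTensor (w v : Fin N → V) :
    innerFunctional w (algTensor v) = ∏ k, ⟪w k, v k⟫_ℂ := by
  unfold innerFunctional algTensor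
  erw [PiTensorProduct.lift.tprod]
  simp

lemma alg_induction {p : AlgTensorPower V N → Prop} (z : AlgTensorPower V N)
    (h1 : ∀ (r : ℂ) (f : Fin N → V), p (r • algTensor f))
    (h2 : ∀ x y, p x → p y → p (x + y)) : p z :=
  PiTensorProduct.induction_on z h1 h2

lemma alg_ext {F : Type*} [AddCommGroup F] [Module ℂ F] {f g : AlgTensorPower V N →ₗ[ℂ] F}
    (h : ∀ v, f (algTensor v) = g (algTensor v)) : f = g := by
  ext z
  induction z using alg_induction with
  | h1 r v => simp [h]
  | h2 x y hx hy => simp [hx, hy]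

/-- The inner product of the algebraic tensor power, determined by
`⟪w₁ ⊗ ⋯ ⊗ w_N, v₁ ⊗ ⋯ ⊗ v_N⟫ = ∏ k, ⟪w k, v k⟫`; conjugate-linear in the first variable. -/
def algInner : AlgTensorPower V N →+ (AlgTensorPower V N →ₗ[ℂ] ℂ) :=
  PiTensorProduct.liftAddHom
    (fun p : ℂ × (Fin N → V) => (starRingEnd ℂ p.1) • innerFunctional p.2)
    (by
      intro r f i hi
      apply alg_ext
      intro v
      have : ∏ k, ⟪f k, v k⟫_ℂ = 0 := Finset.prod_eq_zero (Finset.mem_univ i) (by simp [hi])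
      simp [innerFunctional_algTensor, this])
    (by intro f; simp)
    (by
      intro _ r f i m₁ m₂
      apply alg_ext
      intro v
      have key : ∀ m, ∏ k, ⟪Function.update f i m k, v k⟫_ℂ
          = ⟪m, v i⟫_ℂ * ∏ k ∈ Finset.univ.erase i, ⟪f k, v k⟫_ℂ := by
        intro m
        rw [← Finset.mul_prod_erase _ _ (Finset.mem_univ i)]
        congr 1
        · simp
        · refine Finset.prod_congr rfl fun k hk => ?_
          rw [Function.update_of_ne (Finset.ne_of_mem_erase hk)]
      simp only [LinearMap.add_apply, LinearMap.smul_apply, innerFunctional_algTensor, key,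
        inner_add_left, smul_eq_mul]
      ring)
    (by intro r r' f; simp [add_smul])
    (by
      intro _ r f i r'
      apply alg_ext
      intro v
      have key : ∀ m, ∏ k, ⟪Function.update f i m k, v k⟫_ℂ
          = ⟪m, v i⟫_ℂ * ∏ k ∈ Finset.univ.erase i, ⟪f k, v k⟫_ℂ := by
        intro m
        rw [← Finset.mul_prod_erase _ _ (Finset.mem_univ i)]
        congr 1
        · simp
        · refine Finset.prod_congr rfl fun k hk => ?_
          rw [Function.update_of_ne (Finset.ne_of_mem_erase hk)]
      simp only [LinearMap.smul_apply, innerFunctional_algTensor, key,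
        inner_smul_left, smul_eq_mul, map_mul]
      rw [← Finset.mul_prod_erase Finset.univ (fun k => ⟪f k, v k⟫_ℂ) (Finset.mem_univ i)]
      ring)

lemma algInner_smul_algTensor (r : ℂ) (w : Fin N → V) :
    algInner (r • algTensor w) = (starRingEnd ℂ r) • innerFunctional w := by
  have : (r • algTensor w : AlgTensorPower V N) = PiTensorProduct.tprodCoeff ℂ r w :=
    (PiTensorProduct.tprodCoeff_eq_smul_tprod r w).symm
  rw [this]
  unfold algInner PiTensorProduct.liftAddHom
  erw [AddCon.lift_coe]
  simp

lemma algInner_smul (r : ℂ) (x : AlgTensorPower V N) :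
    algInner (r • x) = (starRingEnd ℂ r) • algInner x := by
  induction x using alg_induction with
  | h1 s v => rw [smul_smul, algInner_smul_algTensor, algInner_smul_algTensor, map_mul, mul_smul]
  | h2 x y hx hy => simp [smul_add, hx, hy]

lemma algInner_algTensor (w v : Fin N → V) :
    algInner (algTensor w) (algTensor v) = ∏ k, ⟪w k, v k⟫_ℂ := by
  have := algInner_smul_algTensor (1 : ℂ) w
  rw [one_smul] at this
  rw [this]
  simp [innerFunctional_algTensor]

lemma algInner_conj_symm (x y : AlgTensorPower V N) :
    starRingEnd ℂ (algInner y x) = algInner x y := by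
  induction x using alg_induction with
  | h1 r v =>
    induction y using alg_induction with
    | h1 s w =>
      simp only [algInner_smul, map_smul, LinearMap.smul_apply, algInner_algTensor, smul_eq_mul,
        map_mul, map_prod, inner_conj_symm, Complex.conj_conj]
      ring
    | h2 x y hx hy => simp only [map_add, LinearMap.add_apply, hx, hy]
  | h2 x y hx hy => simp [hx, hy]

open scoped ComplexOrder in
lemma gram_prod_posSemidef {n : Type*} [Finite n] (a : n → Fin N → V) (s : Finset (Fin N)) :
    (Matrix.of fun i j => ∏ k ∈ s, ⟪a i k, a j k⟫_ℂ).PosSemidef := by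
  classical
  induction s using Finset.induction_on with
  | empty =>
    have h := Matrix.posSemidef_gram (𝕜 := ℂ) (fun _ : n => (1 : ℂ))
    convert! h using 1
    ext i j
    simp [Matrix.gram]
  | insert k s hk ih =>
    have h := (Matrix.posSemidef_gram (𝕜 := ℂ) (fun i : n => a i k)).hadamard ih
    convert! h using 1
    ext i j
    simp [Matrix.gram, Finset.prod_insert hk]

open scoped ComplexOrder in
lemma algInner_re_nonneg (x : AlgTensorPower V N) : 0 ≤ RCLike.re (algInner x x) := by
  obtain ⟨c, hc⟩ : ∃ c : (Fin N → V) →₀ ℂ, (c.sum fun i r => r • algTensor i) = x := by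
    induction x using alg_induction with
    | h1 r v => exact ⟨Finsupp.single v r, by simp⟩
    | h2 x y hx hy =>
      obtain ⟨c, rfl⟩ := hx
      obtain ⟨d, rfl⟩ := hy
      exact ⟨c + d, Finsupp.sum_add_index' (by simp) (by simp [add_smul])⟩
  have hc' : x = ∑ i : c.support, c i • algTensor (i : Fin N → V) := by
    rw [← hc, Finsupp.sum, ← Finset.sum_coe_sort]
  have hp := (gram_prod_posSemidef (fun i : c.support => (i : Fin N → V))
    Finset.univ).dotProduct_mulVec_nonneg fun i => c i
  have hE : algInner x x = star (fun i : c.support => c i) ⬝ᵥ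
      (Matrix.of fun i j : c.support => ∏ k, ⟪(i : Fin N → V) k, (j : Fin N → V) k⟫_ℂ).mulVec
        fun i => c i := by
    rw [hc']
    simp only [map_sum, LinearMap.sum_apply, algInner_smul, map_smul,
      LinearMap.smul_apply, algInner_algTensor, smul_eq_mul, dotProduct, Matrix.mulVec,
      Matrix.of_apply, Pi.star_apply, Finset.mul_sum, starRingEnd_apply]
    rw [Finset.sum_comm]
    refine Finset.sum_congr rfl fun i _ => Finset.sum_congr rfl fun j _ => ?_
    ring
  rw [hE]
  exact (Complex.le_def.1 hp).1

instance algCore : PreInnerProductSpace.Core ℂ (AlgTensorPower V N) where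
  inner x y := algInner x y
  conj_inner_symm := algInner_conj_symm
  re_inner_nonneg := algInner_re_nonneg
  add_left x y z := by simp
  smul_left x y r := by simp [algInner_smul]

instance : SeminormedAddCommGroup (AlgTensorPower V N) :=
  InnerProductSpace.Core.toSeminormedAddCommGroup (𝕜 := ℂ)

instance : InnerProductSpace ℂ (AlgTensorPower V N) := .ofCore _

lemma alg_inner_def (x y : AlgTensorPower V N) : ⟪x, y⟫_ℂ = algInner x y := rfl

/-- A linear map that preserves the inner product of elementary tensors is an isometry. -/
lemma alg_inner_map {f : AlgTensorPower V N →ₗ[ℂ] AlgTensorPower V N}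
    (hf : ∀ v w : Fin N → V, ⟪f (algTensor v), f (algTensor w)⟫_ℂ = ∏ k, ⟪v k, w k⟫_ℂ)
    (x y : AlgTensorPower V N) : ⟪f x, f y⟫_ℂ = ⟪x, y⟫_ℂ := by
  induction x using alg_induction with
  | h1 r v =>
    induction y using alg_induction with
    | h1 s w =>
      simp only [map_smul, inner_smul_left, inner_smul_right, hf, alg_inner_def (algTensor v),
        algInner_algTensor]
    | h2 x y hx hy => simp only [map_add, inner_add_right, hx, hy]
  | h2 x y hx hy => simp only [map_add, inner_add_left, hx, hy]

variable (N) in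
/-- `U ⊗ ⋯ ⊗ U` on the algebraic tensor power, for a unitary `U` of `V`. -/
def algUnitary (U : V ≃ₗᵢ[ℂ] V) : AlgTensorPower V N →ₗᵢ[ℂ] AlgTensorPower V N :=
  LinearMap.isometryOfInner
    (PiTensorProduct.map fun _ : Fin N => (U.toLinearEquiv : V →ₗ[ℂ] V))
    (alg_inner_map fun v w => by
      unfold algTensor
      erw [PiTensorProduct.map_tprod, PiTensorProduct.map_tprod]
      exact (algInner_algTensor _ _).trans (by simp))

/-- The permutation `σ` of the tensor factors,
`v₁ ⊗ ⋯ ⊗ v_N ↦ v_{σ⁻¹ 1} ⊗ ⋯ ⊗ v_{σ⁻¹ N}`, on the algebraic tensor power. -/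
def algPerm (σ : Equiv.Perm (Fin N)) : AlgTensorPower V N →ₗᵢ[ℂ] AlgTensorPower V N :=
  LinearMap.isometryOfInner
    (PiTensorProduct.reindex ℂ (fun _ : Fin N => V) σ).toLinearMap
    (alg_inner_map fun v w => by
      unfold algTensor
      erw [PiTensorProduct.reindex_tprod, PiTensorProduct.reindex_tprod]
      refine (algInner_algTensor _ _).trans ?_
      exact Equiv.prod_comp σ.symm fun k => ⟪v k, w k⟫_ℂ)

lemma algUnitary_algTensor (U : V ≃ₗᵢ[ℂ] V) (v : Fin N → V) :
    algUnitary N U (algTensor v) = algTensor fun k => U (v k) :=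
  PiTensorProduct.map_tprod _ _

lemma algPerm_algTensor (σ : Equiv.Perm (Fin N)) (v : Fin N → V) :
    algPerm σ (algTensor v) = algTensor fun k => v (σ.symm k) :=
  PiTensorProduct.reindex_tprod _ _

variable (V N) in
/-- The `N`-particle Hilbert space: the Hilbert space tensor power `V^{⊗N}`, that is, the
completion of the algebraic tensor power. -/
abbrev NParticleSpace : Type _ := UniformSpace.Completion (AlgTensorPower V N)

/-- The product state `v₁ ⊗ ⋯ ⊗ v_N`. -/
def productState (v : Fin N → V) : NParticleSpace V N := (algTensor v : NParticleSpace V N)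

variable (N) in
/-- The operator `U ⊗ ⋯ ⊗ U` on the `N`-particle space, for a unitary `U` of `V`. -/
def unitaryPower (U : V ≃ₗᵢ[ℂ] V) : NParticleSpace V N →L[ℂ] NParticleSpace V N :=
  (algUnitary N U).toContinuousLinearMap.completion

/-- The operator on the `N`-particle space that permutes the particles by `σ`. -/
def permOperator (σ : Equiv.Perm (Fin N)) : NParticleSpace V N →L[ℂ] NParticleSpace V N :=
  (algPerm σ).toContinuousLinearMap.completion

lemma inner_productState (v w : Fin N → V) :
    ⟪productState v, productState w⟫_ℂ = ∏ k, ⟪v k, w k⟫_ℂ := by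
  unfold productState
  rw [UniformSpace.Completion.inner_coe, alg_inner_def, algInner_algTensor]

lemma unitaryPower_productState (U : V ≃ₗᵢ[ℂ] V) (v : Fin N → V) :
    unitaryPower N U (productState v) = productState fun k => U (v k) := by
  unfold unitaryPower productState
  erw [ContinuousLinearMap.completion_apply_coe]
  exact congrArg _ (algUnitary_algTensor U v)

lemma permOperator_productState (σ : Equiv.Perm (Fin N)) (v : Fin N → V) :
    permOperator σ (productState v) = productState fun k => v (σ.symm k) := by
  unfold permOperator productState
  erw [ContinuousLinearMap.completion_apply_coe]
  exact congrArg _ (algPerm_algTensor σ v)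

/-- Bounded operators that agree on product states are equal. -/
lemma clm_ext {f g : NParticleSpace V N →L[ℂ] NParticleSpace V N}
    (h : ∀ v, f (productState v) = g (productState v)) : f = g := by
  ext z
  induction z using UniformSpace.Completion.induction_on with
  | hp => exact isClosed_eq f.continuous g.continuous
  | ih a =>
    induction a using alg_induction with
    | h1 r v => simpa [UniformSpace.Completion.coe_smul, productState] using congrArg (r • ·) (h v)
    | h2 x y hx hy => simp [UniformSpace.Completion.coe_add, hx, hy]

variable (V N) in
/-- The representation of `S_N` on the `N`-particle space that permutes the particles. -/
def permRep : Representation ℂ (Equiv.Perm (Fin N)) (NParticleSpace V N) where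
  toFun σ := (permOperator σ).toLinearMap
  map_one' := by
    have : permOperator (1 : Equiv.Perm (Fin N)) = ContinuousLinearMap.id ℂ (NParticleSpace V N) :=
      clm_ext fun v => by rw [permOperator_productState]; rfl
    rw [this]; rfl
  map_mul' σ τ := by
    have : permOperator (σ * τ)
        = (permOperator σ).comp (permOperator τ : NParticleSpace V N →L[ℂ] NParticleSpace V N) :=
      clm_ext fun v => by
        simp [permOperator_productState, Equiv.Perm.mul_def]
    rw [this]; rfl

end HilbertTensorPower

/-! ### Irreducible representations of `S_N` and Schur functions -/

section Specht

variable {N : ℕ}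

/-- The parts `λ₁ ≥ λ₂ ≥ ⋯` of a partition of `N`, in decreasing order. -/
def rows (l : N.Partition) : List ℕ := l.parts.sort (· ≥ ·)

/-- The boxes of the Young diagram of a partition: row `i` consists of `λ_i` boxes. -/
abbrev Box (l : N.Partition) : Type := (i : Fin (rows l).length) × Fin ((rows l)[i])

lemma sum_rows (l : N.Partition) : ∑ i : Fin (rows l).length, (rows l)[i] = N := by
  have h1 : (rows l).sum = N := by
    have : ((rows l : List ℕ) : Multiset ℕ) = l.parts := Multiset.sort_eq _ _
    rw [← Multiset.sum_coe, this, l.parts_sum]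
  exact (Fin.sum_univ_getElem (rows l)).trans h1

/-- The numbering of the boxes by `Fin N`, row after row. -/
def tableau (l : N.Partition) : Fin N ≃ Box l :=
  (finSigmaFinEquiv.trans (finCongr (sum_rows l))).symm

/-- The permutations that keep every number in its row. -/
def rowGroup (l : N.Partition) : Subgroup (Equiv.Perm (Fin N)) where
  carrier := {σ | ∀ k, (tableau l (σ k)).1 = (tableau l k).1}
  one_mem' k := rfl
  mul_mem' {σ τ} hσ hτ k := (hσ (τ k)).trans (hτ k)
  inv_mem' {σ} hσ k := by
    have := hσ (σ.symm k)
    rw [Equiv.apply_symm_apply] at this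
    exact this.symm

/-- The permutations that keep every number in its column. -/
def colGroup (l : N.Partition) : Subgroup (Equiv.Perm (Fin N)) where
  carrier := {σ | ∀ k, ((tableau l (σ k)).2 : ℕ) = (tableau l k).2}
  one_mem' k := rfl
  mul_mem' {σ τ} hσ hτ k := (hσ (τ k)).trans (hτ k)
  inv_mem' {σ} hσ k := by
    have := hσ (σ.symm k)
    rw [Equiv.apply_symm_apply] at this
    exact this.symm

open Classical in
/-- The Young symmetrizer `c = (∑_{p in rows} p) (∑_{q in columns} sgn(q) q)` in `ℂ[S_N]`. -/
def youngSymmetrizer (l : N.Partition) : MonoidAlgebra ℂ (Equiv.Perm (Fin N)) :=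
  (∑ p : rowGroup l, MonoidAlgebra.of ℂ _ (p : Equiv.Perm (Fin N))) *
    ∑ q : colGroup l, ((Equiv.Perm.sign (q : Equiv.Perm (Fin N)) : ℤ) : ℂ) •
      MonoidAlgebra.of ℂ _ (q : Equiv.Perm (Fin N))

/-- The Specht module of a partition: the left ideal `ℂ[S_N] c` of its Young symmetrizer. -/
def spechtModule (l : N.Partition) : Submodule ℂ (MonoidAlgebra ℂ (Equiv.Perm (Fin N))) :=
  LinearMap.range (LinearMap.mulRight ℂ (youngSymmetrizer l))

/-- The left regular representation of `S_N` on `ℂ[S_N]`. -/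
def regularRep (N : ℕ) :
    Representation ℂ (Equiv.Perm (Fin N)) (MonoidAlgebra ℂ (Equiv.Perm (Fin N))) :=
  (Algebra.lmul ℂ (MonoidAlgebra ℂ (Equiv.Perm (Fin N)))).toMonoidHom.comp
    (MonoidAlgebra.of ℂ (Equiv.Perm (Fin N)))

/-- The representation of `S_N` corresponding to a partition of `N`: left multiplication on the
Specht module. -/
def spechtRep (l : N.Partition) : Representation ℂ (Equiv.Perm (Fin N)) (spechtModule l) :=
  (regularRep N).subrepresentation (spechtModule l) (by
    rintro σ _ ⟨x, rfl⟩
    exact ⟨MonoidAlgebra.of ℂ _ σ * x, by simp [regularRep, mul_assoc]⟩)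

/-- Every partition of `N` is the list of cycle lengths (fixed points included) of a permutation. -/
lemma exists_perm_of_cycleType (m : N.Partition) :
    ∃ σ : Equiv.Perm (Fin N), σ.partition.parts = m.parts := by
  classical
  have hsplit : m.parts.filter (2 ≤ ·) + m.parts.filter (¬ 2 ≤ ·) = m.parts :=
    Multiset.filter_add_not _ _
  have hone : m.parts.filter (¬ 2 ≤ ·)
      = Multiset.replicate (Multiset.card (m.parts.filter (¬ 2 ≤ ·))) 1 := by
    rw [Multiset.eq_replicate]
    refine ⟨rfl, fun b hb => ?_⟩
    have h := Multiset.mem_filter.1 hb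
    have := m.parts_pos h.1
    omega
  have hsum : (m.parts.filter (2 ≤ ·)).sum + Multiset.card (m.parts.filter (¬ 2 ≤ ·)) = N := by
    conv_rhs => rw [← m.parts_sum, ← hsplit, Multiset.sum_add, hone]
    simp
  obtain ⟨σ, hσ⟩ := (Equiv.Perm.exists_with_cycleType_iff (α := Fin N)
    (m := m.parts.filter (2 ≤ ·))).2
    ⟨by rw [Fintype.card_fin]; omega, fun a ha => (Multiset.mem_filter.1 ha).2⟩
  refine ⟨σ, ?_⟩
  have hs : σ.support.card = (m.parts.filter (2 ≤ ·)).sum := by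
    rw [← Equiv.Perm.sum_cycleType, hσ]
  rw [Equiv.Perm.parts_partition, hσ, Fintype.card_fin, hs]
  conv_rhs => rw [← hsplit, hone]
  congr 2
  omega

/-- The value `χ^λ_μ` of the character of the representation of `S_N` corresponding to `λ` on the
class of permutations with cycle lengths `μ`. -/
def spechtCharacter (l m : N.Partition) : ℂ :=
  LinearMap.trace ℂ (spechtModule l) (spechtRep l (exists_perm_of_cycleType m).choose)

/-- The power sum `p_m(x₁, x₂, …) = ∑ x_i ^ m`. -/
def powerSum {ι : Type*} (x : ι → ℂ) (m : ℕ) : ℂ := ∑' i, x i ^ m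

/-- The number `g_μ = N! / ∏_j j ^ a_j * a_j !` of permutations with cycle lengths `μ`, where `a_j`
is the multiplicity of `j` in `μ`. -/
def classSize (m : N.Partition) : ℂ :=
  (N.factorial : ℂ) /
    ∏ j ∈ Finset.Icc 1 N, ((j : ℂ) ^ m.parts.count j * ((m.parts.count j).factorial : ℂ))

/-- The Schur function of a partition, in any family of variables, finite or infinite:
`s_λ(x) = ∑_μ (g_μ / N!) χ^λ_μ ∏_m p_m(x) ^ (multiplicity of m in μ)`. -/
def schurFunction {ι : Type*} (l : N.Partition) (x : ι → ℂ) : ℂ :=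
  ∑ m : N.Partition, classSize m / (N.factorial : ℂ) * spechtCharacter l m *
    ∏ k ∈ Finset.Icc 1 N, powerSum x k ^ m.parts.count k

end Specht

/-! ### Subspaces of the `N`-particle space -/

section Subspaces

variable {V : Type*} [NormedAddCommGroup V] [InnerProductSpace ℂ V] {N : ℕ}

/-- The subspace is stable under `U ⊗ ⋯ ⊗ U` for every unitary `U` of the one-particle space, that
is, it does not depend on the choice of a one-particle basis. -/
def UnitaryStable (D : Submodule ℂ (NParticleSpace V N)) : Prop :=
  ∀ U : V ≃ₗᵢ[ℂ] V, ∀ x ∈ D, unitaryPower N U x ∈ D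

/-- The subspace is stable under permutations of the particles. -/
def PermutationStable (D : Submodule ℂ (NParticleSpace V N)) : Prop :=
  ∀ σ : Equiv.Perm (Fin N), ∀ x ∈ D, permRep V N σ x ∈ D

/-- `W` is a nonzero closed subspace, stable under all `U ⊗ ⋯ ⊗ U`, with no proper nonzero closed
subspace that is stable too. -/
def UnitaryIrreducible (W : Submodule ℂ (NParticleSpace V N)) : Prop :=
  IsClosed (W : Set (NParticleSpace V N)) ∧ UnitaryStable W ∧ W ≠ ⊥ ∧
    ∀ W' ≤ W, IsClosed (W' : Set (NParticleSpace V N)) → UnitaryStable W' → W' = ⊥ ∨ W' = W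

/-- `W` and `W'` are isomorphic as Hilbert spaces, by an isomorphism that commutes with all
`U ⊗ ⋯ ⊗ U`. -/
def UnitaryEquivalent (W W' : Submodule ℂ (NParticleSpace V N)) : Prop :=
  ∃ T : W ≃ₗᵢ[ℂ] W', ∀ (U : V ≃ₗᵢ[ℂ] V) (x y : W),
    (y : NParticleSpace V N) = unitaryPower N U x →
      (T y : NParticleSpace V N) = unitaryPower N U (T x)

/-- Permuting the particles in the state `x` yields the irreducible representation of `S_N`
corresponding to `λ`: the span of all `σ x` is isomorphic to the Specht module of `λ`. -/
def CarriesSpecht (l : N.Partition) (x : NParticleSpace V N) : Prop :=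
  ∃ T : Representation.IntertwiningMap (spechtRep l) (permRep V N),
    Function.Injective T.toLinearMap ∧
      LinearMap.range T.toLinearMap = Submodule.span ℂ (Set.range fun σ => permRep V N σ x)

variable (V) in
/-- The subspace of symmetry type `λ`, cut out of the `N`-particle space by the Young symmetrizer
of `λ`. -/
def symmetrySubspace (l : N.Partition) : Submodule ℂ (NParticleSpace V N) :=
  LinearMap.range ((permRep V N).asAlgebraHom (youngSymmetrizer l))

variable (V) in
/-- The sum of all subspaces of the `N`-particle space that are isomorphic, as representations of
`S_N`, to the Specht module of `λ`. -/
def isotypicSubspace (l : N.Partition) : Submodule ℂ (NParticleSpace V N) :=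
  ⨆ T : Representation.IntertwiningMap (spechtRep l) (permRep V N), LinearMap.range T.toLinearMap

end Subspaces

/-! ### The ideal gas -/

section Gas

variable {V : Type*} [NormedAddCommGroup V] [InnerProductSpace ℂ V] {ι : Type*}

/-- The operator `e^{-β H_N}` of `N` particles without interaction. The one-particle Hamiltonian has
the orthonormal eigenbasis `φ` with eigenvalues `ε`, so that `H_N` has the orthonormal eigenbasis of
product states `φ_{i_1} ⊗ ⋯ ⊗ φ_{i_N}`, with eigenvalues `ε_{i_1} + ⋯ + ε_{i_N}`. The sum of
multiples of the projections onto these states converges in norm if `∑ e^{-β ε_i} < ∞`. -/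
def gibbsOperator (N : ℕ) (φ : HilbertBasis ι ℂ V) (ε : ι → ℝ) (β : ℝ) :
    NParticleSpace V N →L[ℂ] NParticleSpace V N :=
  ∑' i : Fin N → ι, (Real.exp (-β * ∑ k, ε (i k)) : ℂ) •
    InnerProductSpace.rankOne ℂ (productState fun k => φ (i k)) (productState fun k => φ (i k))

end Gas

end IdealGas

end

/-!
The proof is Schur-Weyl duality for the Hilbert space tensor power, in a form that works in any
dimension: everything is read off from the group algebra `ℂ[S_N]`, which is finite-dimensional even
if `V` is not.

**Young symmetrizers.** Von Neumann's lemma, a count of the boxes in the first rows of two diagrams,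
gives `c_λ x c_λ ∈ ℂ c_λ` and `c_λ x c_μ = 0` for `λ ≠ μ`. Hence a multiple `e_λ` of `c_λ` is an
idempotent, and the Specht modules `ℂ[S_N] e_λ` are irreducible and inequivalent. Their characters
are independent and as numerous as the classes, so that a representation killed by all `e_λ` is zero
(`eq_zero_of_forall_youngIdempotent`). As subspaces have to be split orthogonally, `e_λ` is traded
for a self-adjoint idempotent `f_λ` with the same right ideal (`youngProjection`).

**The bicommutant.** A bounded operator `T` that commutes with all `U ⊗ ⋯ ⊗ U` is the action of an
element of `ℂ[S_N]` (`exists_permAlg_eq`). Comparing coefficients in the phase of a unitary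
`1 + s |u⟩⟨u|` shows that `T` commutes with the derivations extending `|a⟩⟨b|`, and by induction with the
symmetrized products `∑_σ |σ a⟩⟨σ b|` of rank one operators. Applied to a vector `v`, these are
combinations of permutations applied to the product state `a`, and the identity is a combination of
the elements `∑_σ ⟨σ b, v⟩ σ` of `ℂ[S_N]` modulo the kernel of the action.

**The decomposition.** The projection onto `D` is therefore the action of some `p ∈ ℂ[S_N]`. Since
`f_λ ℂ[S_N] f_λ = ℂ f_λ`, the map `(a, b) ↦ a* b` is an inner product with values in `ℂ f_λ` on the
operators `p x f_λ`, and an orthonormal basis `z_{λ,1}, …, z_{λ,C_λ}` consists of partial isometries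
of `V^λ = f_λ V^{⊗N}` onto mutually orthogonal subspaces `W_{λ,k}` of `D`, with
`p = ∑ z_{λ,k} z_{λ,k}*` by completeness. Minimality of `f_λ` makes these subspaces irreducible.

**The partition function.** The trace of `e^{-β H_N} σ` is the number `p_μ(e^{-β ε})` for the cycle
lengths `μ` of `σ`, as the words fixed by `σ` are the functions on its orbits. This makes
`a ↦ tr (e^{-β H_N} a)` a trace on `ℂ[S_N]`, which takes the same value on `z z*` and on `z* z = f_λ`, and
its value on `f_λ`, equal to that on `e_λ`, is the Schur function `s_λ`.
-/

noncomputable section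

namespace IdealGas

/-! ### Fillings of Young diagrams -/

section Diagrams

variable {N : ℕ}

/-- The row, counted from `0`, of a number in the standard tableau of a partition. -/
def rowIdx (l : N.Partition) (x : Fin N) : ℕ := (tableau l x).1

/-- The column, counted from `0`, of a number in the standard tableau of a partition. -/
def colIdx (l : N.Partition) (x : Fin N) : ℕ := (tableau l x).2

lemma box_ext {l : N.Partition} {p q : Box l} (h1 : (p.1 : ℕ) = q.1) (h2 : (p.2 : ℕ) = q.2) :
    p = q := by
  obtain ⟨i, j⟩ := p
  obtain ⟨i', j'⟩ := q
  obtain rfl : i = i' := Fin.ext h1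
  obtain rfl : j = j' := Fin.ext h2
  rfl

lemma eq_of_rowIdx_of_colIdx {l : N.Partition} {x y : Fin N} (h1 : rowIdx l x = rowIdx l y)
    (h2 : colIdx l x = colIdx l y) : x = y :=
  (tableau l).injective (box_ext h1 h2)

/-- The columns of a Young diagram have no gaps, since the row lengths decrease. -/
lemma exists_row_above (l : N.Partition) (x : Fin N) {i : ℕ} (hi : i ≤ rowIdx l x) :
    ∃ y, rowIdx l y = i ∧ colIdx l y = colIdx l x := by
  have hlen : rowIdx l x < (rows l).length := (tableau l x).1.2
  have hanti : (rows l)[rowIdx l x] ≤ (rows l)[i]'(hi.trans_lt hlen) := by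
    have hs : (rows l).Pairwise (· ≥ ·) := Multiset.pairwise_sort _ _
    rcases hi.eq_or_lt with h | h
    · subst h; exact le_rfl
    · exact List.pairwise_iff_getElem.1 hs _ _ _ _ h
  have hcol : colIdx l x < (rows l)[rowIdx l x] := (tableau l x).2.2
  refine ⟨(tableau l).symm ⟨⟨i, hi.trans_lt hlen⟩, ⟨colIdx l x, hcol.trans_le hanti⟩⟩, ?_, ?_⟩
  · simp [rowIdx]
  · have h := congrArg (fun b : Box l => (b.2 : ℕ)) ((tableau l).apply_symm_apply
      ⟨⟨i, hi.trans_lt hlen⟩, ⟨colIdx l x, hcol.trans_le hanti⟩⟩)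
    exact h

lemma card_rowIdx (l : N.Partition) (i : ℕ) :
    (Finset.univ.filter fun x => rowIdx l x = i).card = (rows l)[i]?.getD 0 := by
  classical
  by_cases hi : i < (rows l).length
  · have h : (Finset.univ.filter fun x => rowIdx l x = i)
        = (Finset.univ : Finset (Fin (rows l)[i])).map
          ⟨fun j => (tableau l).symm ⟨⟨i, hi⟩, j⟩, fun j j' h => by simpa using h⟩ := by
      ext x
      simp only [Finset.mem_filter, Finset.mem_univ, true_and, Finset.mem_map]
      constructor
      · rintro rfl
        exact ⟨(tableau l x).2, (tableau l).symm_apply_apply x⟩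
      · rintro ⟨j, rfl⟩
        simp [rowIdx]
    rw [h, Finset.card_map, Finset.card_univ, Fintype.card_fin]
    simp [hi]
  · rw [Finset.card_eq_zero.2]
    · simp [hi]
    · ext x
      have : rowIdx l x < (rows l).length := (tableau l x).1.2
      simp
      omega

/-- A partition is determined by its row lengths, hence by the numbers of boxes in its first `k`
rows. -/
lemma partition_eq_of_card_rowIdx_lt {l m : N.Partition}
    (h : ∀ k, (Finset.univ.filter fun x => rowIdx l x < k).card
      = (Finset.univ.filter fun x => rowIdx m x < k).card) : l = m := by
  classical
  have hsucc : ∀ (l : N.Partition) (k : ℕ), (Finset.univ.filter fun x => rowIdx l x < k + 1).card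
      = (Finset.univ.filter fun x => rowIdx l x < k).card + (rows l)[k]?.getD 0 := by
    intro l k
    rw [← card_rowIdx, ← Finset.card_union_of_disjoint]
    · congr 1
      ext x
      simp
      omega
    · rw [Finset.disjoint_filter]
      intro x _ h1 h2
      omega
  have hget : ∀ k : ℕ, (rows l)[k]?.getD 0 = (rows m)[k]?.getD 0 := by
    intro k
    have h1 := hsucc l k
    have h2 := hsucc m k
    have h3 := h k
    have h4 := h (k + 1)
    omega
  have hpos : ∀ (l : N.Partition) (k : ℕ) (hk : k < (rows l).length), 0 < (rows l)[k] := by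
    intro l k hk
    have hmem : (rows l)[k] ∈ rows l := List.getElem_mem hk
    exact l.parts_pos ((Multiset.mem_sort _).1 hmem)
  have hrows : rows l = rows m := by
    refine List.ext_getElem? fun k => ?_
    have hk := hget k
    by_cases h1 : k < (rows l).length <;> by_cases h2 : k < (rows m).length
    · simpa [h1, h2] using hk
    · have := hpos l k h1
      simp [h1, h2] at hk
      omega
    · have := hpos m k h2
      simp [h1, h2] at hk
      omega
    · simp [h1, h2]
  have h1 : ((rows l : List ℕ) : Multiset ℕ) = l.parts := Multiset.sort_eq _ _
  have h2 : ((rows m : List ℕ) : Multiset ℕ) = m.parts := Multiset.sort_eq _ _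
  exact Nat.Partition.ext (by rw [← h1, ← h2, hrows])

variable {α : Type*} [Fintype α] {r c r' c' : α → ℕ}

/-- In each column, a filling without repeated positions has at most as many entries in the first
`k` rows as a filling with the same column lengths whose columns have no gaps. -/
lemma card_cell_le (hdown : ∀ x, ∀ i ≤ r x, ∃ y, r y = i ∧ c y = c x)
    (hinj : ∀ x y, r' x = r' y → c' x = c' y → x = y)
    (hcol : ∀ j, (Finset.univ.filter fun x => c' x = j).card
      = (Finset.univ.filter fun x => c x = j).card) (k j : ℕ) :
    (Finset.univ.filter fun x => r' x < k ∧ c' x = j).card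
      ≤ (Finset.univ.filter fun x => r x < k ∧ c x = j).card := by
  classical
  by_cases h : ∃ x, c x = j ∧ k ≤ r x
  · obtain ⟨x, rfl, hx⟩ := h
    calc (Finset.univ.filter fun y => r' y < k ∧ c' y = c x).card
        ≤ (Finset.range k).card := by
          refine Finset.card_le_card_of_injOn r' ?_ ?_
          · intro y hy
            simp at hy ⊢
            exact hy.1
          · intro y hy z hz hyz
            simp at hy hz
            exact hinj y z hyz (hy.2.trans hz.2.symm)
      _ ≤ ((Finset.univ.filter fun y => r y < k ∧ c y = c x).image r).card := by
          refine Finset.card_le_card fun i hi => ?_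
          obtain ⟨y, hy, hy'⟩ := hdown x i ((Finset.mem_range.1 hi).le.trans hx)
          exact Finset.mem_image.2 ⟨y, by simpa [hy, hy'] using hi, hy⟩
      _ ≤ _ := Finset.card_image_le
  · push Not at h
    calc (Finset.univ.filter fun x => r' x < k ∧ c' x = j).card
        ≤ (Finset.univ.filter fun x => c' x = j).card :=
          Finset.card_le_card fun x => by simp
      _ = (Finset.univ.filter fun x => c x = j).card := hcol j
      _ ≤ _ := Finset.card_le_card fun x => by
          simp only [Finset.mem_filter, Finset.mem_univ, true_and]
          exact fun hx => ⟨h x hx, hx⟩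

lemma card_row_lt_eq_sum (r c : α → ℕ) (s : Finset ℕ) (hs : ∀ x, c x ∈ s) (k : ℕ) :
    (Finset.univ.filter fun x => r x < k).card
      = ∑ j ∈ s, (Finset.univ.filter fun x => r x < k ∧ c x = j).card := by
  classical
  rw [Finset.card_eq_sum_card_fiberwise (f := c) (t := s) (fun x _ => hs x)]
  refine Finset.sum_congr rfl fun j _ => ?_
  rw [Finset.filter_filter]

/-- Summing over the columns: the filling whose columns have no gaps has at least as many entries in
the first `k` rows. -/
lemma card_row_lt_le (hdown : ∀ x, ∀ i ≤ r x, ∃ y, r y = i ∧ c y = c x)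
    (hinj : ∀ x y, r' x = r' y → c' x = c' y → x = y)
    (hcol : ∀ j, (Finset.univ.filter fun x => c' x = j).card
      = (Finset.univ.filter fun x => c x = j).card) (k : ℕ) :
    (Finset.univ.filter fun x => r' x < k).card ≤ (Finset.univ.filter fun x => r x < k).card := by
  classical
  let s := Finset.univ.image c ∪ Finset.univ.image c'
  rw [card_row_lt_eq_sum r c s (by simp [s]), card_row_lt_eq_sum r' c' s (by simp [s])]
  exact Finset.sum_le_sum fun j _ => card_cell_le hdown hinj hcol k j

/-- If the two fillings also have the same numbers of entries in the first rows, then they occupy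
the same cells. -/
lemma exists_same_cell (hdown : ∀ x, ∀ i ≤ r x, ∃ y, r y = i ∧ c y = c x)
    (hinj : ∀ x y, r' x = r' y → c' x = c' y → x = y)
    (hcol : ∀ j, (Finset.univ.filter fun x => c' x = j).card
      = (Finset.univ.filter fun x => c x = j).card)
    (hrow : ∀ k, (Finset.univ.filter fun x => r' x < k).card
      = (Finset.univ.filter fun x => r x < k).card) (x : α) :
    ∃ y, r y = r' x ∧ c y = c' x := by
  classical
  let s := Finset.univ.image c ∪ Finset.univ.image c'
  have hcell : ∀ k, (Finset.univ.filter fun z => r' z < k ∧ c' z = c' x).card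
      = (Finset.univ.filter fun z => r z < k ∧ c z = c' x).card := by
    intro k
    have h := hrow k
    rw [card_row_lt_eq_sum r c s (by simp [s]), card_row_lt_eq_sum r' c' s (by simp [s])] at h
    exact (Finset.sum_eq_sum_iff_of_le fun j _ => card_cell_le hdown hinj hcol k j).1 h _
      (by simp [s])
  by_contra! hno
  have h1 : (Finset.univ.filter fun z => r z < r' x + 1 ∧ c z = c' x)
      = Finset.univ.filter fun z => r z < r' x ∧ c z = c' x := by
    ext z
    simp only [Finset.mem_filter, Finset.mem_univ, true_and]
    constructor
    · rintro ⟨h1, h2⟩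
      exact ⟨lt_of_le_of_ne (Nat.lt_succ_iff.1 h1) fun h => hno z h h2, h2⟩
    · rintro ⟨h1, h2⟩
      exact ⟨h1.trans (Nat.lt_succ_self _), h2⟩
  have h2 : (Finset.univ.filter fun z => r' z < r' x ∧ c' z = c' x)
      ⊂ Finset.univ.filter fun z => r' z < r' x + 1 ∧ c' z = c' x := by
    rw [Finset.ssubset_iff_of_subset]
    · exact ⟨x, by simp, by simp⟩
    · intro z
      simp only [Finset.mem_filter, Finset.mem_univ, true_and]
      exact fun h => ⟨h.1.trans (Nat.lt_succ_self _), h.2⟩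
  have h3 := Finset.card_lt_card h2
  rw [hcell, hcell, h1] at h3
  exact h3.false

end Diagrams

/-! ### Products of row and column sums -/

section YoungSymmetrizers

variable {N : ℕ}

lemma mem_rowGroup {l : N.Partition} {σ : Equiv.Perm (Fin N)} :
    σ ∈ rowGroup l ↔ ∀ x, rowIdx l (σ x) = rowIdx l x :=
  forall_congr' fun _ => Fin.ext_iff

lemma mem_colGroup {l : N.Partition} {σ : Equiv.Perm (Fin N)} :
    σ ∈ colGroup l ↔ ∀ x, colIdx l (σ x) = colIdx l x :=
  Iff.rfl

/-- No two numbers lie in the same row of the tableau of `l` and in the same column of the tableau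
of `m` relabelled by `g`. -/
def Transversal (l m : N.Partition) (g : Equiv.Perm (Fin N)) : Prop :=
  ∀ x y, rowIdx l x = rowIdx l y → colIdx m (g⁻¹ x) = colIdx m (g⁻¹ y) → x = y

lemma card_colIdx_comp (m : N.Partition) (g : Equiv.Perm (Fin N)) (j : ℕ) :
    (Finset.univ.filter fun x => colIdx m (g x) = j).card
      = (Finset.univ.filter fun x => colIdx m x = j).card :=
  Finset.card_equiv g (by simp)

/-- A transversal exists only if `m` dominates `l`. -/
lemma Transversal.card_le {l m : N.Partition} {g : Equiv.Perm (Fin N)} (h : Transversal l m g)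
    (k : ℕ) : (Finset.univ.filter fun x => rowIdx l x < k).card
      ≤ (Finset.univ.filter fun x => rowIdx m x < k).card :=
  card_row_lt_le (fun x _ hi => exists_row_above m x hi) h (card_colIdx_comp m g⁻¹) k

lemma Transversal.eq {l m : N.Partition} {g g' : Equiv.Perm (Fin N)} (h : Transversal l m g)
    (h' : Transversal m l g') : l = m :=
  partition_eq_of_card_rowIdx_lt fun k => (h.card_le k).antisymm (h'.card_le k)

/-- Von Neumann's lemma: a row permutation moves every number to the cell given by its row in the
tableau and its column in the relabelled tableau. -/
lemma Transversal.factor {l : N.Partition} {g : Equiv.Perm (Fin N)} (h : Transversal l l g) :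
    ∃ p ∈ rowGroup l, ∃ q ∈ colGroup l, g = p * q := by
  choose t ht1 ht2 using exists_same_cell (fun x _ hi => exists_row_above l x hi) h
    (card_colIdx_comp l g⁻¹) (fun _ => rfl)
  have hinj : Function.Injective t := fun x y hxy =>
    h x y (by rw [← ht1 x, ← ht1 y, hxy]) (by rw [← ht2 x, ← ht2 y, hxy])
  let τ : Equiv.Perm (Fin N) := Equiv.ofBijective t (Finite.injective_iff_bijective.1 hinj)
  have hτ : τ ∈ rowGroup l := mem_rowGroup.2 ht1
  refine ⟨τ⁻¹, inv_mem hτ, τ * g, mem_colGroup.2 fun x => ?_, by simp⟩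
  have := ht2 (g x)
  rwa [show g⁻¹ (g x) = x from g.symm_apply_apply x] at this

open Classical in
/-- The sum of the row group in `ℂ[S_N]`. -/
def rowSum (l : N.Partition) : MonoidAlgebra ℂ (Equiv.Perm (Fin N)) :=
  ∑ p : rowGroup l, MonoidAlgebra.of ℂ _ (p : Equiv.Perm (Fin N))

open Classical in
/-- The signed sum of the column group in `ℂ[S_N]`. -/
def colSum (l : N.Partition) : MonoidAlgebra ℂ (Equiv.Perm (Fin N)) :=
  ∑ q : colGroup l, ((Equiv.Perm.sign (q : Equiv.Perm (Fin N)) : ℤ) : ℂ) •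
      MonoidAlgebra.of ℂ _ (q : Equiv.Perm (Fin N))

lemma youngSymmetrizer_eq (l : N.Partition) : youngSymmetrizer l = rowSum l * colSum l := rfl

lemma rowSum_mul_of {l : N.Partition} {p : Equiv.Perm (Fin N)} (hp : p ∈ rowGroup l) :
    rowSum l * MonoidAlgebra.of ℂ _ p = rowSum l := by
  classical
  unfold rowSum
  rw [Finset.sum_mul]
  refine Fintype.sum_equiv (Equiv.mulRight (⟨p, hp⟩ : rowGroup l)) _ _ fun x => ?_
  simp

lemma of_mul_rowSum {l : N.Partition} {p : Equiv.Perm (Fin N)} (hp : p ∈ rowGroup l) :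
    MonoidAlgebra.of ℂ _ p * rowSum l = rowSum l := by
  classical
  unfold rowSum
  rw [Finset.mul_sum]
  refine Fintype.sum_equiv (Equiv.mulLeft (⟨p, hp⟩ : rowGroup l)) _ _ fun x => ?_
  simp

lemma of_mul_colSum {l : N.Partition} {q : Equiv.Perm (Fin N)} (hq : q ∈ colGroup l) :
    MonoidAlgebra.of ℂ _ q * colSum l = ((Equiv.Perm.sign q : ℤ) : ℂ) • colSum l := by
  classical
  unfold colSum
  rw [Finset.mul_sum, Finset.smul_sum]
  refine Fintype.sum_equiv (Equiv.mulLeft (⟨q, hq⟩ : colGroup l)) _ _ fun x => ?_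
  have h : (((Equiv.Perm.sign q : ℤˣ) : ℤ) : ℂ) * ((Equiv.Perm.sign q : ℤ) : ℂ) = 1 := by
    rw [← Int.cast_mul, Int.units_coe_mul_self]; simp
  rw [mul_smul_comm, ← map_mul, smul_smul]
  simp only [Equiv.coe_mulLeft, Subgroup.coe_mul, Equiv.Perm.sign_mul, Units.val_mul, Int.cast_mul]
  rw [← mul_assoc, h, one_mul]

/-- If two numbers lie in a common row and a common relabelled column, then their transposition is
absorbed on the left with sign `+` and on the right with sign `-`. -/
lemma rowSum_mul_of_mul_colSum_eq_zero {l m : N.Partition} {g : Equiv.Perm (Fin N)}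
    (h : ¬ Transversal l m g) : rowSum l * MonoidAlgebra.of ℂ _ g * colSum m = 0 := by
  classical
  unfold Transversal at h
  push Not at h
  obtain ⟨x, y, hrow, hcol, hne⟩ := h
  have hp : Equiv.swap x y ∈ rowGroup l := mem_rowGroup.2 fun z => by
    rcases eq_or_ne z x with rfl | hx
    · rw [Equiv.swap_apply_left, hrow]
    rcases eq_or_ne z y with rfl | hy
    · rw [Equiv.swap_apply_right, hrow]
    rw [Equiv.swap_apply_of_ne_of_ne hx hy]
  have hq : Equiv.swap (g⁻¹ x) (g⁻¹ y) ∈ colGroup m := mem_colGroup.2 fun z => by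
    rcases eq_or_ne z (g⁻¹ x) with rfl | hx
    · rw [Equiv.swap_apply_left, hcol]
    rcases eq_or_ne z (g⁻¹ y) with rfl | hy
    · rw [Equiv.swap_apply_right, hcol]
    rw [Equiv.swap_apply_of_ne_of_ne hx hy]
  have hconj : Equiv.swap x y * g = g * Equiv.swap (g⁻¹ x) (g⁻¹ y) := by
    rw [Equiv.mul_swap_eq_swap_mul]
    simp
  have key : rowSum l * MonoidAlgebra.of ℂ _ g * colSum m
      = - (rowSum l * MonoidAlgebra.of ℂ _ g * colSum m) := by
    conv_lhs => rw [← rowSum_mul_of hp, mul_assoc (rowSum l), ← map_mul, hconj, map_mul,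
      mul_assoc, mul_assoc, of_mul_colSum hq, Equiv.Perm.sign_swap (by simpa using hne)]
    simp [mul_assoc]
  have h2 : (2 : ℂ) • (rowSum l * MonoidAlgebra.of ℂ _ g * colSum m) = 0 := by
    rw [two_smul]
    exact add_eq_zero_iff_eq_neg.2 key
  exact (smul_eq_zero.1 h2).resolve_left two_ne_zero

lemma rowSum_mul_mul_colSum_of_forall {l m : N.Partition}
    {S : Submodule ℂ (MonoidAlgebra ℂ (Equiv.Perm (Fin N)))}
    (h : ∀ g, rowSum l * MonoidAlgebra.of ℂ _ g * colSum m ∈ S)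
    (x : MonoidAlgebra ℂ (Equiv.Perm (Fin N))) : rowSum l * x * colSum m ∈ S := by
  induction x using MonoidAlgebra.induction_on with
  | of g => exact h g
  | add x y hx hy => rw [mul_add, add_mul]; exact S.add_mem hx hy
  | smul r x hx => rw [mul_smul_comm, smul_mul_assoc]; exact S.smul_mem r hx

/-- With the row sum `a` and the column sum `b`, every `a x b` is a multiple of the Young
symmetrizer `a b`. -/
lemma exists_rowSum_mul_mul_colSum (l : N.Partition)
    (x : MonoidAlgebra ℂ (Equiv.Perm (Fin N))) :
    ∃ s : ℂ, rowSum l * x * colSum l = s • (rowSum l * colSum l) := by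
  have h := rowSum_mul_mul_colSum_of_forall (l := l) (m := l)
    (S := Submodule.span ℂ {rowSum l * colSum l}) (fun g => ?_) x
  · obtain ⟨s, hs⟩ := Submodule.mem_span_singleton.1 h
    exact ⟨s, hs.symm⟩
  · by_cases hg : Transversal l l g
    · obtain ⟨p, hp, q, hq, rfl⟩ := hg.factor
      rw [map_mul, ← mul_assoc, rowSum_mul_of hp, mul_assoc, of_mul_colSum hq, mul_smul_comm]
      exact Submodule.smul_mem _ _ (Submodule.mem_span_singleton_self _)
    · rw [rowSum_mul_of_mul_colSum_eq_zero hg]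
      exact Submodule.zero_mem _

lemma rowSum_mul_mul_colSum_eq_zero {l m : N.Partition} (h : ∀ g, ¬ Transversal l m g)
    (x : MonoidAlgebra ℂ (Equiv.Perm (Fin N))) : rowSum l * x * colSum m = 0 := by
  have := rowSum_mul_mul_colSum_of_forall (l := l) (m := m) (S := ⊥)
    (fun g => by simpa using rowSum_mul_of_mul_colSum_eq_zero (h g)) x
  simpa using this

/-- The conjugate-linear involution of `ℂ[S_N]` with `σ ↦ σ⁻¹`. -/
def groupStar : MonoidAlgebra ℂ (Equiv.Perm (Fin N)) →+ MonoidAlgebra ℂ (Equiv.Perm (Fin N)) where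
  toFun x := ∑ σ, starRingEnd ℂ (x.coeff σ) • MonoidAlgebra.of ℂ _ σ⁻¹
  map_zero' := by simp
  map_add' x y := by
    rw [← Finset.sum_add_distrib]
    refine Finset.sum_congr rfl fun σ _ => ?_
    rw [MonoidAlgebra.coeff_add, Finsupp.add_apply, map_add, add_smul]

lemma groupStar_of (g : Equiv.Perm (Fin N)) :
    groupStar (MonoidAlgebra.of ℂ _ g) = MonoidAlgebra.of ℂ _ g⁻¹ := by
  classical
  change ∑ σ, _ = _
  rw [Finset.sum_eq_single g]
  · simp
  · intro σ _ hσ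
    simp [hσ.symm]
  · simp

lemma groupStar_smul (r : ℂ) (x : MonoidAlgebra ℂ (Equiv.Perm (Fin N))) :
    groupStar (r • x) = starRingEnd ℂ r • groupStar x := by
  change ∑ σ, _ = _ • ∑ σ, _
  rw [Finset.smul_sum]
  refine Finset.sum_congr rfl fun σ _ => ?_
  rw [MonoidAlgebra.coeff_smul_apply, smul_eq_mul, map_mul, mul_smul]

lemma groupStar_mul (x y : MonoidAlgebra ℂ (Equiv.Perm (Fin N))) :
    groupStar (x * y) = groupStar y * groupStar x := by
  induction x using MonoidAlgebra.induction_on with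
  | of g =>
    induction y using MonoidAlgebra.induction_on with
    | of h => simp only [← map_mul, groupStar_of, mul_inv_rev]
    | add y z hy hz => rw [mul_add, map_add, map_add, hy, hz, add_mul]
    | smul r y hy => rw [mul_smul_comm, groupStar_smul, hy, groupStar_smul, smul_mul_assoc]
  | add x z hx hz => rw [add_mul, map_add, map_add, hx, hz, mul_add]
  | smul r x hx => rw [smul_mul_assoc, groupStar_smul, hx, groupStar_smul, mul_smul_comm]

lemma groupStar_groupStar (x : MonoidAlgebra ℂ (Equiv.Perm (Fin N))) :
    groupStar (groupStar x) = x := by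
  induction x using MonoidAlgebra.induction_on with
  | of g => simp only [groupStar_of, inv_inv]
  | add x y hx hy => rw [map_add, map_add, hx, hy]
  | smul r x hx => rw [groupStar_smul, groupStar_smul, hx, Complex.conj_conj]

lemma groupStar_rowSum (l : N.Partition) : groupStar (rowSum l) = rowSum l := by
  classical
  unfold rowSum
  rw [map_sum]
  refine Fintype.sum_equiv (Equiv.inv _) _ _ fun p => ?_
  rw [groupStar_of]
  rfl

lemma groupStar_colSum (l : N.Partition) : groupStar (colSum l) = colSum l := by
  classical
  unfold colSum
  rw [map_sum]
  refine Fintype.sum_equiv (Equiv.inv _) _ _ fun p => ?_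
  rw [groupStar_smul, groupStar_of]
  simp

/-- The row group and the column group have trivial intersection. -/
lemma coeff_youngSymmetrizer_one (l : N.Partition) : (youngSymmetrizer l).coeff 1 = 1 := by
  classical
  rw [youngSymmetrizer_eq, rowSum, colSum, Finset.sum_mul_sum, MonoidAlgebra.coeff_sum,
    Finset.sum_apply', Finset.sum_eq_single 1]
  · rw [MonoidAlgebra.coeff_sum, Finset.sum_apply', Finset.sum_eq_single 1]
    · simp
    · intro q _ hq
      have : (q : Equiv.Perm (Fin N)) ≠ 1 := by simpa using hq
      simp [this]
    · simp
  · intro p _ hp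
    rw [MonoidAlgebra.coeff_sum, Finset.sum_apply']
    refine Finset.sum_eq_zero fun q _ => ?_
    rw [mul_smul_comm, ← map_mul, MonoidAlgebra.coeff_smul_apply, MonoidAlgebra.of_apply,
      MonoidAlgebra.coeff_single, Finsupp.single_apply, if_neg, smul_zero]
    intro hpq
    refine hp (Subtype.ext (Equiv.ext fun x => ?_))
    have hpinv : (p : Equiv.Perm (Fin N)) = (q : Equiv.Perm (Fin N))⁻¹ :=
      mul_eq_one_iff_eq_inv.1 hpq
    refine eq_of_rowIdx_of_colIdx (l := l) (mem_rowGroup.1 p.2 x) ?_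
    rw [hpinv]
    exact mem_colGroup.1 (inv_mem q.2) x
  · simp

lemma trace_eq_sum_coeff
    (T : MonoidAlgebra ℂ (Equiv.Perm (Fin N)) →ₗ[ℂ] MonoidAlgebra ℂ (Equiv.Perm (Fin N))) :
    LinearMap.trace ℂ _ T = ∑ g, (T (MonoidAlgebra.of ℂ _ g)).coeff g := by
  classical
  rw [LinearMap.trace_eq_matrix_trace ℂ (MonoidAlgebra.basis (Equiv.Perm (Fin N)) ℂ), Matrix.trace]
  refine Finset.sum_congr rfl fun g _ => ?_
  rw [Matrix.diag_apply, LinearMap.toMatrix_apply]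
  simp [MonoidAlgebra.basis]

lemma trace_mulRight (x : MonoidAlgebra ℂ (Equiv.Perm (Fin N))) :
    LinearMap.trace ℂ _ (LinearMap.mulRight ℂ x) = (N.factorial : ℂ) * x.coeff 1 := by
  classical
  rw [trace_eq_sum_coeff]
  simp [MonoidAlgebra.coeff_single_mul_apply, Fintype.card_perm]

/-- If `c² = 0`, then right multiplication by `c` would be nilpotent, but its trace is `N!`. -/
lemma exists_youngSymmetrizer_sq (l : N.Partition) :
    ∃ n : ℂ, n ≠ 0 ∧ youngSymmetrizer l * youngSymmetrizer l = n • youngSymmetrizer l := by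
  obtain ⟨n, hn⟩ := exists_rowSum_mul_mul_colSum l (colSum l * rowSum l)
  have hsq : youngSymmetrizer l * youngSymmetrizer l = n • youngSymmetrizer l := by
    simpa only [youngSymmetrizer_eq, mul_assoc] using hn
  refine ⟨n, ?_, hsq⟩
  rintro rfl
  have hnil : IsNilpotent (LinearMap.mulRight ℂ (youngSymmetrizer l)) := by
    refine ⟨2, LinearMap.ext fun x => ?_⟩
    rw [zero_smul] at hsq
    simp [pow_two, mul_assoc, hsq]
  have h := (LinearMap.isNilpotent_trace_of_isNilpotent hnil).eq_zero
  rw [trace_mulRight, coeff_youngSymmetrizer_one, mul_one] at h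
  exact N.factorial_ne_zero (Nat.cast_eq_zero.1 h)

end YoungSymmetrizers

/-! ### Young idempotents and Specht modules -/

section SpechtModules

variable {N : ℕ}

local notation "𝓐" N => MonoidAlgebra ℂ (Equiv.Perm (Fin N))

lemma youngSymmetrizer_ne_zero (l : N.Partition) : youngSymmetrizer l ≠ 0 := by
  intro h
  have := coeff_youngSymmetrizer_one l
  simp [h] at this

lemma exists_youngSymmetrizer_mul_mul (l : N.Partition) (x : 𝓐 N) :
    ∃ s : ℂ, youngSymmetrizer l * x * youngSymmetrizer l = s • youngSymmetrizer l := by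
  obtain ⟨s, hs⟩ := exists_rowSum_mul_mul_colSum l (colSum l * x * rowSum l)
  exact ⟨s, by simpa only [youngSymmetrizer_eq, mul_assoc] using hs⟩

lemma youngSymmetrizer_mul_mul_eq_zero {l m : N.Partition} (h : l ≠ m) (x : 𝓐 N) :
    youngSymmetrizer l * x * youngSymmetrizer m = 0 := by
  have hor : (∀ g, ¬ Transversal l m g) ∨ ∀ g, ¬ Transversal m l g := by
    by_contra! hcon
    obtain ⟨⟨g, hg⟩, g', hg'⟩ := hcon
    exact h (hg.eq hg')
  simp only [youngSymmetrizer_eq]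
  rcases hor with h1 | h1
  · calc rowSum l * colSum l * x * (rowSum m * colSum m)
        = rowSum l * (colSum l * x * rowSum m) * colSum m := by simp only [mul_assoc]
      _ = 0 := rowSum_mul_mul_colSum_eq_zero h1 _
  · have h2 : colSum l * x * rowSum m = 0 := by
      have h3 := rowSum_mul_mul_colSum_eq_zero h1 (groupStar x)
      have h4 := congrArg groupStar h3
      rwa [groupStar_mul, groupStar_mul, groupStar_groupStar, groupStar_rowSum, groupStar_colSum,
        map_zero, ← mul_assoc] at h4
    calc rowSum l * colSum l * x * (rowSum m * colSum m)
        = rowSum l * (colSum l * x * rowSum m) * colSum m := by simp only [mul_assoc]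
      _ = 0 := by rw [h2, mul_zero, zero_mul]

/-- The scalar `n` with `c² = n c` for the Young symmetrizer `c`. -/
def youngScalar (l : N.Partition) : ℂ := (exists_youngSymmetrizer_sq l).choose

lemma youngScalar_ne_zero (l : N.Partition) : youngScalar l ≠ 0 :=
  (exists_youngSymmetrizer_sq l).choose_spec.1

lemma youngSymmetrizer_mul_self (l : N.Partition) :
    youngSymmetrizer l * youngSymmetrizer l = youngScalar l • youngSymmetrizer l :=
  (exists_youngSymmetrizer_sq l).choose_spec.2

/-- The idempotent multiple of the Young symmetrizer. -/
def youngIdempotent (l : N.Partition) : 𝓐 N := (youngScalar l)⁻¹ • youngSymmetrizer l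

lemma youngSymmetrizer_eq_smul (l : N.Partition) :
    youngSymmetrizer l = youngScalar l • youngIdempotent l := by
  rw [youngIdempotent, smul_inv_smul₀ (youngScalar_ne_zero l)]

lemma youngIdempotent_mul_self (l : N.Partition) :
    youngIdempotent l * youngIdempotent l = youngIdempotent l := by
  simp only [youngIdempotent, smul_mul_smul_comm, youngSymmetrizer_mul_self, smul_smul]
  congr 1
  field_simp [youngScalar_ne_zero l]

lemma youngIdempotent_ne_zero (l : N.Partition) : youngIdempotent l ≠ 0 :=
  smul_ne_zero (inv_ne_zero (youngScalar_ne_zero l)) (youngSymmetrizer_ne_zero l)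

lemma exists_youngIdempotent_mul_mul (l : N.Partition) (x : 𝓐 N) :
    ∃ s : ℂ, youngIdempotent l * x * youngIdempotent l = s • youngIdempotent l := by
  obtain ⟨s, hs⟩ := exists_youngSymmetrizer_mul_mul l x
  refine ⟨(youngScalar l)⁻¹ * s, ?_⟩
  simp only [youngIdempotent, smul_mul_assoc, mul_smul_comm, hs, smul_smul]
  congr 1
  ring

lemma youngIdempotent_mul_mul_eq_zero {l m : N.Partition} (h : l ≠ m) (x : 𝓐 N) :
    youngIdempotent l * x * youngIdempotent m = 0 := by
  simp only [youngIdempotent, smul_mul_assoc, mul_smul_comm,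
    youngSymmetrizer_mul_mul_eq_zero h, smul_zero]

lemma rowSum_mul_rowSum (l : N.Partition) :
    rowSum l * rowSum l = (Nat.card (rowGroup l) : ℂ) • rowSum l := by
  classical
  have h (x : 𝓐 N) (hx : ∀ p : rowGroup l, MonoidAlgebra.of ℂ _ (p : Equiv.Perm (Fin N)) * x = x) :
      rowSum l * x = (Nat.card (rowGroup l) : ℂ) • x := by
    rw [rowSum, Finset.sum_mul, Finset.sum_congr rfl fun p _ => hx p, Finset.sum_const,
      Finset.card_univ, Nat.card_eq_fintype_card, Nat.cast_smul_eq_nsmul]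
  exact h _ fun p => of_mul_rowSum p.2

/-- The self-adjoint idempotent `a b a / (n |P|)` of `ℂ[S_N]`, where `a` is the sum of the row group
`P` and `b` is the signed sum of the column group. It generates the same right ideal as the Young
symmetrizer `a b`. -/
def youngProjection (l : N.Partition) : 𝓐 N :=
  (Nat.card (rowGroup l) : ℂ)⁻¹ • (youngIdempotent l * rowSum l)

lemma card_rowGroup_ne_zero (l : N.Partition) : (Nat.card (rowGroup l) : ℂ) ≠ 0 :=
  Nat.cast_ne_zero.2 Nat.card_pos.ne'

lemma youngIdempotent_mul_youngProjection (l : N.Partition) :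
    youngIdempotent l * youngProjection l = youngProjection l := by
  rw [youngProjection, mul_smul_comm, ← mul_assoc, youngIdempotent_mul_self]

lemma youngProjection_mul_youngIdempotent (l : N.Partition) :
    youngProjection l * youngIdempotent l = youngIdempotent l := by
  have h : rowSum l * youngIdempotent l = (Nat.card (rowGroup l) : ℂ) • youngIdempotent l := by
    rw [youngIdempotent, mul_smul_comm, youngSymmetrizer_eq, ← mul_assoc, rowSum_mul_rowSum,
      smul_mul_assoc, smul_comm]
  rw [youngProjection, smul_mul_assoc, mul_assoc, h, mul_smul_comm, youngIdempotent_mul_self,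
    inv_smul_smul₀ (card_rowGroup_ne_zero l)]

lemma youngProjection_mul_self (l : N.Partition) :
    youngProjection l * youngProjection l = youngProjection l := by
  calc youngProjection l * youngProjection l
      = youngProjection l * youngIdempotent l * youngProjection l := by
        rw [mul_assoc, youngIdempotent_mul_youngProjection]
    _ = youngProjection l := by
        rw [youngProjection_mul_youngIdempotent, youngIdempotent_mul_youngProjection]

lemma exists_youngProjection_mul_mul (l : N.Partition) (x : 𝓐 N) :
    ∃ s : ℂ, youngProjection l * x * youngProjection l = s • youngProjection l := by
  obtain ⟨s, hs⟩ := exists_youngIdempotent_mul_mul l (youngProjection l * x)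
  refine ⟨s, ?_⟩
  have h := congrArg (· * youngProjection l) hs
  simp only [← mul_assoc, youngIdempotent_mul_youngProjection, smul_mul_assoc] at h
  rwa [mul_assoc _ (youngIdempotent l), youngIdempotent_mul_youngProjection] at h

lemma youngProjection_mul_mul_eq_zero {l m : N.Partition} (h : l ≠ m) (x : 𝓐 N) :
    youngProjection l * x * youngProjection m = 0 := by
  have h := congrArg (· * youngProjection m)
    (youngIdempotent_mul_mul_eq_zero h (youngProjection l * x))
  simp only [← mul_assoc, youngIdempotent_mul_youngProjection, zero_mul] at h
  rwa [mul_assoc _ (youngIdempotent m), youngIdempotent_mul_youngProjection] at h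

lemma youngProjection_ne_zero (l : N.Partition) : youngProjection l ≠ 0 := by
  intro h
  have := youngProjection_mul_youngIdempotent l
  rw [h, zero_mul] at this
  exact youngIdempotent_ne_zero l this.symm

lemma groupStar_youngProjection (l : N.Partition) :
    groupStar (youngProjection l) = youngProjection l := by
  -- `star f` is a multiple of `f`, and both are idempotent, so that the factor is `1`.
  obtain ⟨s, hs⟩ : ∃ s : ℂ, groupStar (youngProjection l) = s • youngProjection l := by
    refine ⟨starRingEnd ℂ (youngScalar l)⁻¹ * youngScalar l, ?_⟩
    simp only [youngProjection, youngIdempotent, youngSymmetrizer_eq, groupStar_smul,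
      groupStar_mul, groupStar_rowSum, groupStar_colSum, smul_mul_assoc, smul_smul, mul_assoc]
    congr 1
    simp only [map_inv₀, map_natCast, map_mul]
    have := youngScalar_ne_zero l
    field_simp
  have hne := youngProjection_ne_zero l
  have h1 : (s * s) • youngProjection l = s • youngProjection l := by
    conv_rhs => rw [← hs, ← youngProjection_mul_self l, groupStar_mul, hs]
    rw [smul_mul_smul_comm, youngProjection_mul_self]
  have h2 : s ≠ 0 := by
    rintro rfl
    rw [zero_smul] at hs
    have := groupStar_groupStar (youngProjection l)
    rw [hs, map_zero] at this
    exact hne this.symm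
  have h3 : s * s = s := smul_left_injective ℂ hne h1
  have h4 : s = 1 := mul_left_cancel₀ h2 (by rw [h3, mul_one])
  rw [hs, h4, one_smul]

lemma mem_spechtModule {l : N.Partition} {x : 𝓐 N} :
    x ∈ spechtModule l ↔ x * youngIdempotent l = x := by
  constructor
  · rintro ⟨y, rfl⟩
    rw [LinearMap.mulRight_apply, youngSymmetrizer_eq_smul, mul_smul_comm, smul_mul_assoc,
      mul_assoc, youngIdempotent_mul_self]
  · intro h
    refine ⟨(youngScalar l)⁻¹ • x, ?_⟩
    rw [LinearMap.mulRight_apply, smul_mul_assoc, ← mul_smul_comm]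
    exact h

lemma mul_mem_spechtModule {l : N.Partition} (x : 𝓐 N) {y : 𝓐 N} (hy : y ∈ spechtModule l) :
    x * y ∈ spechtModule l :=
  mem_spechtModule.2 (by rw [mul_assoc, mem_spechtModule.1 hy])

lemma mul_youngIdempotent_mem (l : N.Partition) (x : 𝓐 N) :
    x * youngIdempotent l ∈ spechtModule l :=
  mem_spechtModule.2 (by rw [mul_assoc, youngIdempotent_mul_self])

lemma youngIdempotent_mem (l : N.Partition) : youngIdempotent l ∈ spechtModule l :=
  mem_spechtModule.2 (youngIdempotent_mul_self l)

lemma spechtRep_asAlgebraHom (l : N.Partition) (x : 𝓐 N) (y : spechtModule l) :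
    ((spechtRep l).asAlgebraHom x y : 𝓐 N) = x * y := by
  induction x using MonoidAlgebra.induction_on with
  | of g => rw [Representation.asAlgebraHom_of]; rfl
  | add x z hx hz => rw [map_add, LinearMap.add_apply, Submodule.coe_add, hx, hz, add_mul]
  | smul r x hx => rw [map_smul, LinearMap.smul_apply, Submodule.coe_smul, hx, smul_mul_assoc]

/-- Intertwining maps commute with the group algebra. -/
lemma intertwining_asAlgebraHom {G M M' : Type*} [Group G] [AddCommGroup M] [Module ℂ M]
    [AddCommGroup M'] [Module ℂ M'] {ρ : Representation ℂ G M} {ρ' : Representation ℂ G M'}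
    (T : Representation.IntertwiningMap ρ ρ') (x : MonoidAlgebra ℂ G) (v : M) :
    T (ρ.asAlgebraHom x v) = ρ'.asAlgebraHom x (T v) := by
  induction x using MonoidAlgebra.induction_on with
  | of g => rw [Representation.asAlgebraHom_of, Representation.asAlgebraHom_of]
            exact Representation.IntertwiningMap.isIntertwining ρ ρ' T g v
  | add x z hx hz => simp only [map_add, LinearMap.add_apply, hx, hz]
  | smul r x hx => simp only [map_smul, LinearMap.smul_apply, hx]

/-- A left ideal inside `ℂ[S_N] e` is zero or contains `e`: it is generated by an idempotent `d`,
and `d = d e d e = s d e = s d` for the scalar `s` with `e d e = s e`. -/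
lemma ideal_le_spechtModule {l : N.Partition} (I : Ideal (𝓐 N))
    (hI : ∀ x ∈ I, x ∈ spechtModule l) : I = ⊥ ∨ youngIdempotent l ∈ I := by
  obtain ⟨d, hd, rfl⟩ := IsSemisimpleRing.ideal_eq_span_idempotent I
  have hdI : d ∈ Ideal.span {d} := Ideal.subset_span rfl
  have hde : d * youngIdempotent l = d := mem_spechtModule.1 (hI d hdI)
  obtain ⟨s, hs⟩ := exists_youngIdempotent_mul_mul l d
  rw [mul_assoc, hde] at hs
  have hsd : d = s • d := by
    calc d = d * youngIdempotent l * d := by rw [hde]; exact hd.symm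
      _ = s • d := by rw [mul_assoc, hs, mul_smul_comm, hde]
  by_cases hs0 : s = 0
  · left
    rw [hs0, zero_smul] at hsd
    rw [hsd, Ideal.span_singleton_eq_bot]
  · right
    have : youngIdempotent l = s⁻¹ • (youngIdempotent l * d) := by rw [hs, inv_smul_smul₀ hs0]
    rw [this]
    exact Submodule.smul_of_tower_mem _ _ (Ideal.mul_mem_left _ _ hdI)

theorem isIrreducible_spechtRep (l : N.Partition) : (spechtRep l).IsIrreducible := by
  have hbot : ∀ W : Subrepresentation (spechtRep l), W = ⊥ ∨ W = ⊤ := by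
    intro W
    let I : Ideal (𝓐 N) :=
      { carrier := {x | ∃ h : x ∈ spechtModule l, (⟨x, h⟩ : spechtModule l) ∈ W.toSubmodule}
        add_mem' := by
          rintro x y ⟨hx, hx'⟩ ⟨hy, hy'⟩
          exact ⟨add_mem hx hy, W.toSubmodule.add_mem hx' hy'⟩
        zero_mem' := ⟨zero_mem _, W.toSubmodule.zero_mem⟩
        smul_mem' := by
          rintro x y ⟨hy, hy'⟩
          refine ⟨mul_mem_spechtModule x hy, ?_⟩
          have h := (spechtRep l).asAlgebraHom_mem_of_forall_mem W.toSubmodule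
            (fun g v hv => W.apply_mem_toSubmodule g hv) _ hy' x
          convert h
          exact (spechtRep_asAlgebraHom l x ⟨y, hy⟩).symm }
    rcases ideal_le_spechtModule I (fun x hx => hx.1) with h | ⟨h, h'⟩
    · left
      refine Subrepresentation.toSubmodule_injective ?_
      refine (Submodule.eq_bot_iff _).2 fun x hx => ?_
      have : (x : 𝓐 N) ∈ I := ⟨x.2, hx⟩
      rw [h] at this
      exact Subtype.ext ((Submodule.mem_bot _).1 this)
    · right
      refine Subrepresentation.toSubmodule_injective ?_
      refine Submodule.eq_top_iff'.2 fun x => ?_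
      have h1 := (spechtRep l).asAlgebraHom_mem_of_forall_mem W.toSubmodule
        (fun g v hv => W.apply_mem_toSubmodule g hv) _ h' x
      convert h1
      refine Subtype.ext ?_
      rw [spechtRep_asAlgebraHom]
      exact (mem_spechtModule.1 x.2).symm
  exact
    { exists_pair_ne := ⟨⊥, ⊤, fun h => by
        have h1 : (⟨youngIdempotent l, youngIdempotent_mem l⟩ : spechtModule l)
            ∈ (⊥ : Subrepresentation (spechtRep l)).toSubmodule := by
          rw [h]; exact Submodule.mem_top
        exact youngIdempotent_ne_zero l (congrArg Subtype.val ((Submodule.mem_bot ℂ).1 h1))⟩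
      eq_bot_or_eq_top := hbot }

theorem isEmpty_equiv_spechtRep {l m : N.Partition} (h : l ≠ m) :
    IsEmpty (Representation.Equiv (spechtRep l) (spechtRep m)) := by
  refine ⟨fun φ => ?_⟩
  let e : spechtModule l := ⟨youngIdempotent l, youngIdempotent_mem l⟩
  have h1 : (spechtRep l).asAlgebraHom (youngIdempotent l) e = e :=
    Subtype.ext (by rw [spechtRep_asAlgebraHom]; exact youngIdempotent_mul_self l)
  have h2 := intertwining_asAlgebraHom φ.toIntertwiningMap (youngIdempotent l) e
  rw [h1] at h2
  have h3 : φ.toIntertwiningMap e = 0 := by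
    rw [h2]
    refine Subtype.ext ?_
    rw [spechtRep_asAlgebraHom, ← mem_spechtModule.1 (φ.toIntertwiningMap e).2, ← mul_assoc,
      youngIdempotent_mul_mul_eq_zero h]
    rfl
  have h4 : e = 0 := φ.toLinearEquiv.map_eq_zero_iff.1 h3
  exact youngIdempotent_ne_zero l (congrArg Subtype.val h4)

end SpechtModules

/-! ### Characters and completeness of the Specht modules -/

section Characters

variable {N : ℕ}

local notation "𝓐" N => MonoidAlgebra ℂ (Equiv.Perm (Fin N))

/-- The cycle lengths of a permutation of `Fin N`, fixed points included, as a partition of `N`. -/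
def cyclePartition (σ : Equiv.Perm (Fin N)) : N.Partition where
  parts := σ.partition.parts
  parts_pos := σ.partition.parts_pos
  parts_sum := by rw [σ.partition.parts_sum, Fintype.card_fin]

lemma isConj_of_cyclePartition {σ τ : Equiv.Perm (Fin N)}
    (h : σ.partition.parts = τ.partition.parts) : IsConj σ τ :=
  Equiv.Perm.partition_eq_of_isConj.2 (Nat.Partition.ext h)

/-- A chosen permutation with given cycle lengths. -/
def cycleRep (m : N.Partition) : Equiv.Perm (Fin N) := (exists_perm_of_cycleType m).choose

lemma isConj_cycleRep (σ : Equiv.Perm (Fin N)) : IsConj (cycleRep (cyclePartition σ)) σ :=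
  isConj_of_cyclePartition (exists_perm_of_cycleType (cyclePartition σ)).choose_spec

/-- The character of a representation of `S_N`, as a linear functional on `ℂ[S_N]`. -/
def algCharacter {M : Type*} [AddCommGroup M] [Module ℂ M]
    (ρ : Representation ℂ (Equiv.Perm (Fin N)) M) : (𝓐 N) →ₗ[ℂ] ℂ :=
  LinearMap.trace ℂ M ∘ₗ ρ.asAlgebraHom.toLinearMap

lemma algCharacter_of {M : Type*} [AddCommGroup M] [Module ℂ M]
    (ρ : Representation ℂ (Equiv.Perm (Fin N)) M) (σ : Equiv.Perm (Fin N)) :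
    algCharacter ρ (MonoidAlgebra.of ℂ _ σ) = LinearMap.trace ℂ M (ρ σ) := by
  simp [algCharacter]

lemma trace_eq_of_isConj {M : Type*} [AddCommGroup M] [Module ℂ M]
    (ρ : Representation ℂ (Equiv.Perm (Fin N)) M) {σ τ : Equiv.Perm (Fin N)} (h : IsConj σ τ) :
    LinearMap.trace ℂ M (ρ σ) = LinearMap.trace ℂ M (ρ τ) := by
  obtain ⟨g, rfl⟩ := isConj_iff.1 h
  exact (ρ.char_conj σ g).symm

lemma spechtCharacter_eq (l m : N.Partition) :
    spechtCharacter l m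
      = algCharacter (spechtRep l) (MonoidAlgebra.of ℂ _ (cycleRep m)) := by
  rw [algCharacter_of]
  rfl

lemma algCharacter_youngIdempotent_of_ne {l m : N.Partition} (h : l ≠ m) :
    algCharacter (spechtRep l) (youngIdempotent m) = 0 := by
  have : (spechtRep l).asAlgebraHom (youngIdempotent m) = 0 := by
    refine LinearMap.ext fun x => Subtype.ext ?_
    rw [spechtRep_asAlgebraHom, ← mem_spechtModule.1 x.2, ← mul_assoc,
      youngIdempotent_mul_mul_eq_zero h.symm]
    rfl
  simp [algCharacter, this]

lemma trace_ne_zero_of_isIdempotentElem {M : Type*} [AddCommGroup M] [Module ℂ M]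
    [FiniteDimensional ℂ M] {f : M →ₗ[ℂ] M} (hf : IsIdempotentElem f) (h0 : f ≠ 0) :
    LinearMap.trace ℂ M f ≠ 0 := by
  rw [(LinearMap.IsIdempotentElem.isProj_range f hf).trace, Nat.cast_ne_zero]
  intro h
  rw [Submodule.finrank_eq_zero, LinearMap.range_eq_bot] at h
  exact h0 h

lemma algCharacter_youngIdempotent_self (l : N.Partition) :
    algCharacter (spechtRep l) (youngIdempotent l) ≠ 0 := by
  have hid : IsIdempotentElem ((spechtRep l).asAlgebraHom (youngIdempotent l)) := by
    rw [IsIdempotentElem, ← map_mul, youngIdempotent_mul_self]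
  refine trace_ne_zero_of_isIdempotentElem hid fun h0 => ?_
  change (spechtRep l).asAlgebraHom (youngIdempotent l) = 0 at h0
  have h1 := congrArg Subtype.val
    (LinearMap.congr_fun h0 ⟨youngIdempotent l, youngIdempotent_mem l⟩)
  rw [spechtRep_asAlgebraHom] at h1
  exact youngIdempotent_ne_zero l ((youngIdempotent_mul_self l).symm.trans h1)

/-- Class functions are determined by their values on representatives of the classes. -/
lemma algCharacter_ext {f g : (𝓐 N) →ₗ[ℂ] ℂ}
    (hf : ∀ σ τ, IsConj σ τ → f (MonoidAlgebra.of ℂ _ σ) = f (MonoidAlgebra.of ℂ _ τ))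
    (hg : ∀ σ τ, IsConj σ τ → g (MonoidAlgebra.of ℂ _ σ) = g (MonoidAlgebra.of ℂ _ τ))
    (h : ∀ m, f (MonoidAlgebra.of ℂ _ (cycleRep m)) = g (MonoidAlgebra.of ℂ _ (cycleRep m))) :
    f = g := by
  refine LinearMap.ext fun x => ?_
  induction x using MonoidAlgebra.induction_on with
  | of σ => rw [← hf _ _ (isConj_cycleRep σ), ← hg _ _ (isConj_cycleRep σ), h]
  | add x y hx hy => rw [map_add, map_add, hx, hy]
  | smul r x hx => rw [map_smul, map_smul, hx]

lemma sum_smul_algCharacter_isConj (a : N.Partition → ℂ) (σ τ : Equiv.Perm (Fin N))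
    (h : IsConj σ τ) :
    (∑ l, a l • algCharacter (spechtRep l)) (MonoidAlgebra.of ℂ _ σ)
      = (∑ l, a l • algCharacter (spechtRep l)) (MonoidAlgebra.of ℂ _ τ) := by
  simp only [LinearMap.sum_apply, LinearMap.smul_apply, algCharacter_of]
  exact Finset.sum_congr rfl fun l _ => by rw [trace_eq_of_isConj _ h]

/-- The idempotents separate the characters, since the character of one Specht module vanishes on
the idempotents of the others. -/
lemma sum_smul_algCharacter_youngIdempotent (a : N.Partition → ℂ) (m : N.Partition) :
    (∑ l, a l • algCharacter (spechtRep l)) (youngIdempotent m)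
      = a m * algCharacter (spechtRep m) (youngIdempotent m) := by
  simp only [LinearMap.sum_apply, LinearMap.smul_apply, smul_eq_mul]
  refine Finset.sum_eq_single m (fun l _ hl => ?_) (by simp)
  rw [algCharacter_youngIdempotent_of_ne hl, mul_zero]

/-- The characters of the Specht modules are linearly independent, and there are as many of them as
conjugacy classes, so that they span the class functions. -/
lemma exists_sum_smul_algCharacter {f : (𝓐 N) →ₗ[ℂ] ℂ}
    (hf : ∀ σ τ, IsConj σ τ → f (MonoidAlgebra.of ℂ _ σ) = f (MonoidAlgebra.of ℂ _ τ)) :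
    ∃ a : N.Partition → ℂ, f = ∑ l, a l • algCharacter (spechtRep l) := by
  let χ : N.Partition → N.Partition → ℂ := fun l m =>
    algCharacter (spechtRep l) (MonoidAlgebra.of ℂ _ (cycleRep m))
  have hχ : ∀ (a : N.Partition → ℂ) m, (∑ l, a l • χ l) m
      = (∑ l, a l • algCharacter (spechtRep l)) (MonoidAlgebra.of ℂ _ (cycleRep m)) := by
    intro a m
    simp only [LinearMap.sum_apply, LinearMap.smul_apply, Finset.sum_apply, Pi.smul_apply, χ]
  have hind : LinearIndependent ℂ χ := by
    rw [Fintype.linearIndependent_iff]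
    intro a ha m
    have h0 : ∑ l, a l • algCharacter (spechtRep l) = 0 :=
      algCharacter_ext (sum_smul_algCharacter_isConj a) (by simp) fun m => by
        rw [← hχ, ha]; rfl
    have h1 := sum_smul_algCharacter_youngIdempotent a m
    rw [h0, LinearMap.zero_apply] at h1
    exact (mul_eq_zero.1 h1.symm).resolve_right (algCharacter_youngIdempotent_self m)
  have hspan := hind.span_eq_top_of_card_eq_finrank' (by simp)
  have hmem : (fun m => f (MonoidAlgebra.of ℂ _ (cycleRep m)))
      ∈ Submodule.span ℂ (Set.range χ) := by
    rw [hspan]; exact Submodule.mem_top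
  obtain ⟨a, ha⟩ := (Submodule.mem_span_range_iff_exists_fun ℂ).1 hmem
  refine ⟨a, algCharacter_ext hf (sum_smul_algCharacter_isConj a) fun m => ?_⟩
  rw [← hχ, ha]

/-- Completeness of the Specht modules: a finite-dimensional representation of `S_N` that is
annihilated by all Young symmetrizers is zero, since its character vanishes. -/
lemma eq_zero_of_forall_youngIdempotent {M : Type*} [AddCommGroup M] [Module ℂ M]
    [FiniteDimensional ℂ M] (ρ : Representation ℂ (Equiv.Perm (Fin N)) M)
    (h : ∀ l, ρ.asAlgebraHom (youngIdempotent l) = 0) (v : M) : v = 0 := by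
  obtain ⟨a, ha⟩ := exists_sum_smul_algCharacter (f := algCharacter ρ) fun σ τ hστ => by
    rw [algCharacter_of, algCharacter_of, trace_eq_of_isConj ρ hστ]
  have ha0 : ∀ m, a m = 0 := fun m => by
    have h1 := sum_smul_algCharacter_youngIdempotent a m
    rw [← ha] at h1
    have h2 : algCharacter ρ (youngIdempotent m) = 0 := by simp [algCharacter, h]
    rw [h2] at h1
    exact (mul_eq_zero.1 h1.symm).resolve_right (algCharacter_youngIdempotent_self m)
  have h1 : algCharacter ρ 1 = 0 := by simp [ha, ha0]
  have h2 : (Module.finrank ℂ M : ℂ) = 0 := by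
    rw [← h1]
    simp [algCharacter]
  have := Module.finrank_zero_iff.1 (Nat.cast_eq_zero.1 h2)
  exact Subsingleton.elim v 0

/-- The average of a class function against the character of a Specht module is a sum over the
coefficients of the corresponding idempotent `e`. The trace over `ℂ[S_N] e` is the trace over
`ℂ[S_N]` of left multiplication by `σ` followed by right multiplication by `e`. -/
lemma sum_trace_spechtRep_mul (l : N.Partition) {t : Equiv.Perm (Fin N) → ℂ}
    (ht : ∀ σ τ, IsConj σ τ → t σ = t τ) :
    ∑ σ, LinearMap.trace ℂ _ (spechtRep l σ) * t σ
      = (N.factorial : ℂ) * ∑ τ, (youngIdempotent l).coeff τ * t τ⁻¹ := by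
  classical
  let π : (𝓐 N) →ₗ[ℂ] spechtModule l :=
    (LinearMap.mulRight ℂ (youngIdempotent l)).codRestrict _ (mul_youngIdempotent_mem l)
  have htr : ∀ σ, LinearMap.trace ℂ _ (spechtRep l σ)
      = ∑ g, (youngIdempotent l).coeff (g⁻¹ * σ⁻¹ * g) := by
    intro σ
    have h1 : spechtRep l σ = (π ∘ₗ regularRep N σ) ∘ₗ (spechtModule l).subtype := by
      refine LinearMap.ext fun x => Subtype.ext ?_
      change MonoidAlgebra.of ℂ _ σ * (x : 𝓐 N)
        = MonoidAlgebra.of ℂ _ σ * (x : 𝓐 N) * youngIdempotent l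
      rw [mul_assoc, mem_spechtModule.1 x.2]
    rw [h1, LinearMap.trace_comp_comm', trace_eq_sum_coeff]
    refine Finset.sum_congr rfl fun g _ => ?_
    change (MonoidAlgebra.of ℂ _ σ * MonoidAlgebra.of ℂ _ g * youngIdempotent l).coeff g = _
    rw [← map_mul, MonoidAlgebra.of_apply, MonoidAlgebra.coeff_single_mul_apply, one_mul,
      mul_inv_rev]
  simp only [htr, Finset.sum_mul]
  rw [Finset.sum_comm]
  have hinner : ∀ g : Equiv.Perm (Fin N),
      ∑ σ, (youngIdempotent l).coeff (g⁻¹ * σ⁻¹ * g) * t σ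
        = ∑ τ, (youngIdempotent l).coeff τ * t τ⁻¹ := by
    intro g
    refine Fintype.sum_equiv ((Equiv.inv _).trans ((MulAut.conj g⁻¹).toEquiv)) _ _ fun σ => ?_
    have h1 : ((Equiv.inv _).trans ((MulAut.conj g⁻¹).toEquiv)) σ = g⁻¹ * σ⁻¹ * g := by simp
    rw [h1]
    congr 1
    refine ht _ _ (isConj_iff.2 ⟨g⁻¹, by group⟩)
  rw [Finset.sum_congr rfl fun g _ => hinner g, Finset.sum_const, Finset.card_univ,
    Fintype.card_perm, Fintype.card_fin, nsmul_eq_mul]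

end Characters

/-! ### Operators on the `N`-particle space -/

section Operators

variable {V : Type*} [NormedAddCommGroup V] [InnerProductSpace ℂ V] {N : ℕ}

variable (V N) in
/-- The product state as a multilinear function of its one-particle states. -/
def productStateMultilinear : MultilinearMap ℂ (fun _ : Fin N => V) (NParticleSpace V N) :=
  (UniformSpace.Completion.toComplₗᵢ (𝕜 := ℂ)
    (E := AlgTensorPower V N)).toLinearMap.compMultilinearMap (PiTensorProduct.tprod ℂ)

lemma productState_smul (c : Fin N → ℂ) (v : Fin N → V) :
    productState (fun k => c k • v k) = (∏ k, c k) • productState v :=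
  (productStateMultilinear V N).map_smul_univ c v

lemma productState_update_add (v : Fin N → V) (k : Fin N) (x y : V) :
    productState (Function.update v k (x + y))
      = productState (Function.update v k x) + productState (Function.update v k y) :=
  (productStateMultilinear V N).map_update_add v k x y

lemma productState_update_smul (v : Fin N → V) (k : Fin N) (c : ℂ) (x : V) :
    productState (Function.update v k (c • x)) = c • productState (Function.update v k x) :=
  (productStateMultilinear V N).map_update_smul v k c x

lemma productState_add_smul (s : ℂ) (v v' : Fin N → V) :
    productState (fun k => v k + s • v' k)
      = ∑ t : Finset (Fin N), s ^ t.card • productState (t.piecewise v' v) := by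
  have h := (productStateMultilinear V N).map_add_univ (fun k => s • v' k) v
  have h2 : ((fun k => s • v' k) + v) = fun k => v k + s • v' k := by
    funext k
    exact add_comm _ _
  rw [h2] at h
  refine h.trans (Finset.sum_congr rfl fun t _ => ?_)
  have h3 := (productStateMultilinear V N).map_piecewise_smul (fun _ => s) (t.piecewise v' v) t
  rw [Finset.prod_const] at h3
  refine Eq.trans ?_ h3
  congr 1
  ext k
  by_cases hk : k ∈ t <;> simp [hk]

/-- Vectors with the same inner products with all product states are equal. -/
lemma ext_inner_productState {x y : NParticleSpace V N}
    (h : ∀ v, ⟪productState v, x⟫_ℂ = ⟪productState v, y⟫_ℂ) : x = y := by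
  refine ext_inner_left ℂ fun z => ?_
  induction z using UniformSpace.Completion.induction_on with
  | hp => exact isClosed_eq (by fun_prop) (by fun_prop)
  | ih a =>
    induction a using alg_induction with
    | h1 r v =>
      rw [UniformSpace.Completion.coe_smul, inner_smul_left, inner_smul_left]
      exact congrArg _ (h v)
    | h2 x y hx hy =>
      rw [UniformSpace.Completion.coe_add, inner_add_left, inner_add_left, hx, hy]

lemma adjoint_eq_of_productState {S S' : NParticleSpace V N →L[ℂ] NParticleSpace V N}
    (h : ∀ w v, ⟪S' (productState w), productState v⟫_ℂ
      = ⟪productState w, S (productState v)⟫_ℂ) : ContinuousLinearMap.adjoint S = S' := by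
  refine clm_ext fun w => ext_inner_productState fun v => ?_
  rw [ContinuousLinearMap.adjoint_inner_right, ← inner_conj_symm, ← h, inner_conj_symm]

lemma adjoint_unitaryPower (U : V ≃ₗᵢ[ℂ] V) :
    ContinuousLinearMap.adjoint (unitaryPower N U) = unitaryPower N U.symm :=
  adjoint_eq_of_productState fun w v => by
    rw [unitaryPower_productState, unitaryPower_productState, inner_productState,
      inner_productState]
    exact Finset.prod_congr rfl fun k _ => by
      rw [← U.inner_map_map, LinearIsometryEquiv.apply_symm_apply]

lemma adjoint_permOperator (σ : Equiv.Perm (Fin N)) :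
    ContinuousLinearMap.adjoint (permOperator σ : NParticleSpace V N →L[ℂ] NParticleSpace V N)
      = permOperator σ⁻¹ :=
  adjoint_eq_of_productState fun w v => by
    rw [permOperator_productState, permOperator_productState, inner_productState,
      inner_productState]
    exact Fintype.prod_equiv σ _ _ fun k => by simp [Equiv.Perm.inv_def]

lemma unitaryPower_symm_mul (U : V ≃ₗᵢ[ℂ] V) :
    unitaryPower N U.symm * unitaryPower N U = 1 :=
  clm_ext fun v => by
    simp [unitaryPower_productState]

lemma inner_unitaryPower (U : V ≃ₗᵢ[ℂ] V) (x y : NParticleSpace V N) :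
    ⟪unitaryPower N U x, unitaryPower N U y⟫_ℂ = ⟪x, y⟫_ℂ := by
  rw [← ContinuousLinearMap.adjoint_inner_right, adjoint_unitaryPower]
  exact congrArg (fun S : NParticleSpace V N →L[ℂ] NParticleSpace V N => ⟪x, S y⟫_ℂ)
    (unitaryPower_symm_mul U)

lemma unitaryPower_mul_permOperator (U : V ≃ₗᵢ[ℂ] V) (σ : Equiv.Perm (Fin N)) :
    unitaryPower N U * permOperator σ = permOperator σ * unitaryPower N U :=
  clm_ext fun v => by
    simp [unitaryPower_productState, permOperator_productState]

variable (V N) in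
/-- The action of `ℂ[S_N]` on the `N`-particle space by bounded operators. -/
def permAlg : MonoidAlgebra ℂ (Equiv.Perm (Fin N)) →ₐ[ℂ]
    (NParticleSpace V N →L[ℂ] NParticleSpace V N) :=
  MonoidAlgebra.lift ℂ _ (Equiv.Perm (Fin N))
    { toFun := permOperator
      map_one' := clm_ext fun v => by rw [permOperator_productState]; rfl
      map_mul' := fun σ τ => clm_ext fun v => by
        simp [permOperator_productState, Equiv.Perm.mul_def] }

lemma permAlg_of (σ : Equiv.Perm (Fin N)) :
    permAlg V N (MonoidAlgebra.of ℂ _ σ) = permOperator σ := by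
  unfold permAlg
  simp

lemma permAlg_eq_sum (x : MonoidAlgebra ℂ (Equiv.Perm (Fin N))) :
    permAlg V N x = ∑ σ, x.coeff σ • permOperator σ := by
  induction x using MonoidAlgebra.induction_on with
  | of g =>
    rw [permAlg_of, Finset.sum_eq_single g]
    · simp
    · intro σ _ hσ
      simp [hσ.symm]
    · simp
  | add x y hx hy =>
    rw [map_add, hx, hy, ← Finset.sum_add_distrib]
    exact Finset.sum_congr rfl fun σ _ => by
      rw [MonoidAlgebra.coeff_add, Finsupp.add_apply, add_smul]
  | smul r x hx =>
    rw [map_smul, hx, Finset.smul_sum]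
    exact Finset.sum_congr rfl fun σ _ => by
      rw [MonoidAlgebra.coeff_smul_apply, smul_smul, smul_eq_mul]

lemma permRep_asAlgebraHom (x : MonoidAlgebra ℂ (Equiv.Perm (Fin N))) (y : NParticleSpace V N) :
    (permRep V N).asAlgebraHom x y = permAlg V N x y := by
  induction x using MonoidAlgebra.induction_on with
  | of g => rw [Representation.asAlgebraHom_of, permAlg_of]; rfl
  | add x z hx hz => rw [map_add, map_add, LinearMap.add_apply, hx, hz]; rfl
  | smul r x hx => rw [map_smul, map_smul, LinearMap.smul_apply, hx]; rfl

lemma adjoint_permAlg (x : MonoidAlgebra ℂ (Equiv.Perm (Fin N))) :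
    ContinuousLinearMap.adjoint (permAlg V N x) = permAlg V N (groupStar x) := by
  induction x using MonoidAlgebra.induction_on with
  | of g => rw [groupStar_of, permAlg_of, permAlg_of, adjoint_permOperator]
  | add x z hx hz => simp only [map_add, hx, hz]
  | smul r x hx => rw [map_smul, map_smulₛₗ, groupStar_smul, map_smul, hx]

lemma unitaryPower_mul_permAlg (U : V ≃ₗᵢ[ℂ] V) (x : MonoidAlgebra ℂ (Equiv.Perm (Fin N))) :
    unitaryPower N U * permAlg V N x = permAlg V N x * unitaryPower N U := by
  induction x using MonoidAlgebra.induction_on with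
  | of g => rw [permAlg_of, unitaryPower_mul_permOperator]
  | add x z hx hz => rw [map_add, mul_add, add_mul, hx, hz]
  | smul r x hx => rw [map_smul, mul_smul_comm, smul_mul_assoc, hx]

end Operators

/-! ### The commutant of the operators `U ⊗ ⋯ ⊗ U` -/

section Bicommutant

variable {V : Type*} [NormedAddCommGroup V] [InnerProductSpace ℂ V] {N : ℕ}

/-- The map `x ↦ x + s ⟨u, x⟩ u`. -/
def rankOneShift (u : V) (s : ℂ) : V →ₗ[ℂ] V :=
  LinearMap.id + s • (innerₛₗ ℂ u).smulRight u

lemma rankOneShift_apply (u : V) (s : ℂ) (x : V) :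
    rankOneShift u s x = x + s • ⟪u, x⟫_ℂ • u := by
  simp [rankOneShift]

/-- With `z = 1 + s` and `z' = 1 + s'` the hypothesis is `z z' = 1`. -/
lemma rankOneShift_comp (u : V) (hu : ‖u‖ = 1) {s s' : ℂ} (h : s + s' + s * s' = 0) :
    (rankOneShift u s).comp (rankOneShift u s') = LinearMap.id := by
  refine LinearMap.ext fun x => ?_
  have huu : ⟪u, u⟫_ℂ = 1 := by rw [inner_self_eq_norm_sq_to_K, hu]; simp
  simp only [LinearMap.comp_apply, rankOneShift_apply, inner_add_right, inner_smul_right, huu,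
    LinearMap.id_apply, mul_one]
  have : x + s' • ⟪u, x⟫_ℂ • u + s • (⟪u, x⟫_ℂ + s' * ⟪u, x⟫_ℂ) • u
      = x + ((s + s' + s * s') * ⟪u, x⟫_ℂ) • u := by module
  rw [this, h, zero_mul, zero_smul, add_zero]

/-- The unitary operator that multiplies the unit vector `u` by the phase `1 + s` and is the
identity on its orthogonal complement. The hypothesis on `s` says that `|1 + s| = 1`. -/
def phaseUnitary (u : V) (hu : ‖u‖ = 1) (s : ℂ)
    (hs : s + starRingEnd ℂ s + s * starRingEnd ℂ s = 0) : V ≃ₗᵢ[ℂ] V :=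
  LinearEquiv.isometryOfInner
    (LinearEquiv.ofLinearMap (rankOneShift u s) (rankOneShift u (starRingEnd ℂ s))
      (rankOneShift_comp u hu hs) (rankOneShift_comp u hu (by rw [← hs]; ring))) fun x y => by
    have huu : ⟪u, u⟫_ℂ = 1 := by rw [inner_self_eq_norm_sq_to_K, hu]; simp
    change ⟪rankOneShift u s x, rankOneShift u s y⟫_ℂ = ⟪x, y⟫_ℂ
    simp only [rankOneShift_apply, inner_add_left, inner_add_right, inner_smul_left,
      inner_smul_right, huu, inner_conj_symm]
    linear_combination ⟪x, u⟫_ℂ * ⟪u, y⟫_ℂ * hs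

lemma phaseUnitary_apply (u : V) (hu : ‖u‖ = 1) (s : ℂ)
    (hs : s + starRingEnd ℂ s + s * starRingEnd ℂ s = 0) (x : V) :
    phaseUnitary u hu s hs x = x + s • ⟪u, x⟫_ℂ • u :=
  rankOneShift_apply u s x

/-- A polynomial that vanishes at all `s` with `|1 + s| = 1` has no linear term. -/
lemma sum_singleton_eq_zero_of_phase {d : Finset (Fin N) → ℂ}
    (h : ∀ s : ℂ, s + starRingEnd ℂ s + s * starRingEnd ℂ s = 0 → ∑ t, s ^ t.card * d t = 0) :
    ∑ k, d {k} = 0 := by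
  classical
  let P : Polynomial ℂ := ∑ t : Finset (Fin N), Polynomial.monomial t.card (d t)
  have hroot : ∀ s : ℂ, s + starRingEnd ℂ s + s * starRingEnd ℂ s = 0 → P.IsRoot s := by
    intro s hs
    rw [Polynomial.IsRoot, Polynomial.eval_finsetSum, ← h s hs]
    exact Finset.sum_congr rfl fun t _ => by rw [Polynomial.eval_monomial, mul_comm]
  have hinf : Set.Infinite {s : ℂ | P.IsRoot s} := by
    have h1 : Set.Infinite (Metric.sphere (0 : ℂ) 1) := by
      refine (isPreconnected_sphere
        (by rw [Complex.rank_real_complex]; norm_num) 0 1).infinite_of_nontrivial ?_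
      exact ⟨1, by simp, -1, by simp, by norm_num⟩
    have h2 := h1.image (f := fun z => z - 1) (sub_left_injective.injOn)
    refine h2.mono ?_
    rintro _ ⟨z, hz, rfl⟩
    refine hroot _ ?_
    have hz1 : z * starRingEnd ℂ z = 1 := by
      rw [Complex.mul_conj, Complex.normSq_eq_norm_sq, mem_sphere_zero_iff_norm.1 hz]; simp
    simp only [map_sub, map_one]
    linear_combination hz1
  have hP : P = 0 := Polynomial.eq_zero_of_infinite_isRoot P hinf
  have h1 : P.coeff 1 = 0 := by rw [hP, Polynomial.coeff_zero]
  simp only [P, Polynomial.finsetSum_coeff, Polynomial.coeff_monomial] at h1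
  rw [← Finset.sum_filter] at h1
  rw [← h1]
  refine Finset.sum_bij (fun k _ => {k}) (by simp) (by simp) ?_ (by simp)
  intro t ht
  obtain ⟨k, rfl⟩ := Finset.card_eq_one.1 (Finset.mem_filter.1 ht).2
  exact ⟨k, by simp, rfl⟩

/-- The rank one operator `x ↦ ⟨b, x⟩ a`. -/
def ketBra (a b x : V) : V := ⟪b, x⟫_ℂ • a

variable {T : NParticleSpace V N →L[ℂ] NParticleSpace V N}

lemma inner_unitaryPower_apply (hT : ∀ U : V ≃ₗᵢ[ℂ] V, T * unitaryPower N U = unitaryPower N U * T)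
    (U : V ≃ₗᵢ[ℂ] V) (w v : Fin N → V) :
    ⟪productState fun k => U (w k), T (productState fun k => U (v k))⟫_ℂ
      = ⟪productState w, T (productState v)⟫_ℂ := by
  rw [← unitaryPower_productState, ← unitaryPower_productState]
  exact (congrArg (fun S : NParticleSpace V N →L[ℂ] NParticleSpace V N =>
    ⟪unitaryPower N U (productState w), S (productState v)⟫_ℂ) (hT U)).trans
      (inner_unitaryPower U _ _)

/-- The defect of commutation of `T` with the derivation that extends the rank one operator
`x ↦ ⟨b, x⟩ a`, as a matrix element between product states. -/
def derivationDefect (T : NParticleSpace V N →L[ℂ] NParticleSpace V N) (w v : Fin N → V)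
    (a b : V) : ℂ :=
  ∑ k, (⟪productState w, T (productState (Function.update v k (ketBra a b (v k))))⟫_ℂ
    - ⟪productState (Function.update w k (ketBra b a (w k))), T (productState v)⟫_ℂ)

/-- The linear term in `s` of the commutation of `T` with the `N`-th power of the phase unitary
`1 + s |u⟩⟨u|`. -/
lemma derivationDefect_unit
    (hT : ∀ U : V ≃ₗᵢ[ℂ] V, T * unitaryPower N U = unitaryPower N U * T) (w v : Fin N → V)
    {u : V} (hu : ‖u‖ = 1) : derivationDefect T w v u u = 0 := by
  classical
  have hsingle : ∀ (v : Fin N → V) (k : Fin N),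
      Finset.piecewise {k} (fun k => ketBra u u (v k)) v
        = Function.update v k (ketBra u u (v k)) := by
    intro v k
    exact Finset.piecewise_singleton _ _ k
  have h := sum_singleton_eq_zero_of_phase (N := N) (d := fun t =>
    ⟪productState w, T (productState (t.piecewise (fun k => ketBra u u (v k)) v))⟫_ℂ
      - ⟪productState (t.piecewise (fun k => ketBra u u (w k)) w), T (productState v)⟫_ℂ) ?_
  · rw [derivationDefect, ← h]
    refine Finset.sum_congr rfl fun k _ => ?_
    rw [hsingle, hsingle]
  · intro s hs
    have hs' : starRingEnd ℂ s + starRingEnd ℂ (starRingEnd ℂ s)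
        + starRingEnd ℂ s * starRingEnd ℂ (starRingEnd ℂ s) = 0 := by
      rw [Complex.conj_conj, ← hs]; ring
    have h1 := inner_unitaryPower_apply hT (phaseUnitary u hu s hs)
      (fun k => phaseUnitary u hu _ hs' (w k)) v
    have h2 : ∀ x, phaseUnitary u hu s hs (phaseUnitary u hu _ hs' x) = x := fun x =>
      LinearMap.congr_fun (rankOneShift_comp u hu hs) x
    simp only [h2] at h1
    simp only [phaseUnitary_apply] at h1
    have h3 := productState_add_smul s v fun k => ⟪u, v k⟫_ℂ • u
    have h4 := productState_add_smul (starRingEnd ℂ s) w fun k => ⟪u, w k⟫_ℂ • u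
    rw [h3, h4, map_sum, inner_sum, sum_inner] at h1
    simp only [map_smul, inner_smul_left, inner_smul_right, map_pow, Complex.conj_conj] at h1
    simp only [mul_sub, Finset.sum_sub_distrib]
    exact sub_eq_zero.2 h1

lemma derivationDefect_add_left (w v : Fin N → V) (a a' b : V) :
    derivationDefect T w v (a + a') b
      = derivationDefect T w v a b + derivationDefect T w v a' b := by
  simp only [derivationDefect, ketBra, ← Finset.sum_add_distrib, inner_add_left, add_smul, smul_add,
    productState_update_add, map_add, inner_add_right]
  exact Finset.sum_congr rfl fun k _ => by ring

lemma derivationDefect_add_right (w v : Fin N → V) (a b b' : V) :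
    derivationDefect T w v a (b + b')
      = derivationDefect T w v a b + derivationDefect T w v a b' := by
  simp only [derivationDefect, ketBra, ← Finset.sum_add_distrib, inner_add_left, add_smul, smul_add,
    productState_update_add, map_add, inner_add_right]
  exact Finset.sum_congr rfl fun k _ => by ring

lemma derivationDefect_smul_left (w v : Fin N → V) (c : ℂ) (a b : V) :
    derivationDefect T w v (c • a) b = c * derivationDefect T w v a b := by
  simp only [derivationDefect, ketBra, Finset.mul_sum, inner_smul_left, smul_comm _ c, mul_smul,
    productState_update_smul, map_smul, inner_smul_right, Complex.conj_conj]
  exact Finset.sum_congr rfl fun k _ => by ring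

lemma derivationDefect_smul_right (w v : Fin N → V) (c : ℂ) (a b : V) :
    derivationDefect T w v a (c • b) = starRingEnd ℂ c * derivationDefect T w v a b := by
  simp only [derivationDefect, ketBra, Finset.mul_sum, inner_smul_left, smul_comm _ c, mul_smul,
    productState_update_smul, map_smul, inner_smul_right]
  exact Finset.sum_congr rfl fun k _ => by ring

/-- An operator that commutes with all `U ⊗ ⋯ ⊗ U` commutes with the derivations
`∑ k, 1 ⊗ ⋯ ⊗ |a⟩⟨b| ⊗ ⋯ ⊗ 1`: for `a = b` of norm one this is the linear term in `s` of the
commutation with the phase unitaries, and the general case follows by polarization. -/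
lemma derivationDefect_eq_zero
    (hT : ∀ U : V ≃ₗᵢ[ℂ] V, T * unitaryPower N U = unitaryPower N U * T) (w v : Fin N → V)
    (a b : V) : derivationDefect T w v a b = 0 := by
  have hdiag : ∀ a, derivationDefect T w v a a = 0 := by
    intro a
    rcases eq_or_ne a 0 with rfl | ha
    · have := derivationDefect_smul_left (T := T) w v 0 0 0
      rwa [zero_smul, zero_mul] at this
    · have hu : ‖((‖a‖ : ℂ)⁻¹ • a)‖ = 1 := by
        rw [norm_smul, norm_inv, Complex.norm_real, norm_norm,
          inv_mul_cancel₀ (norm_ne_zero_iff.2 ha)]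
      have h := derivationDefect_unit hT w v hu
      rw [derivationDefect_smul_left, derivationDefect_smul_right] at h
      have hne : (‖a‖ : ℂ)⁻¹ ≠ 0 := inv_ne_zero (by simpa using ha)
      exact ((mul_eq_zero.1 ((mul_eq_zero.1 h).resolve_left hne)).resolve_left
        (by simpa using ha))
  have h1 := hdiag (a + b)
  -- The defect is linear in `a` and conjugate-linear in `b`, so that `a + b` and `a + i b` together
  -- determine it.
  have h2 := hdiag (a + Complex.I • b)
  simp only [derivationDefect_add_left, derivationDefect_add_right, derivationDefect_smul_left,
    derivationDefect_smul_right, Complex.conj_I] at h1 h2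
  simp only [hdiag] at h1 h2
  have h3 : derivationDefect T w v b a = derivationDefect T w v a b := by
    have : Complex.I * (derivationDefect T w v b a - derivationDefect T w v a b) = 0 := by
      linear_combination h2
    exact sub_eq_zero.1 ((mul_eq_zero.1 this).resolve_left Complex.I_ne_zero)
  rw [h3] at h1
  have h4 : (2 : ℂ) * derivationDefect T w v a b = 0 := by linear_combination h1
  exact (mul_eq_zero.1 h4).resolve_left two_ne_zero

/-- Apply the rank one operator `x ↦ ⟨b j, x⟩ (a j)` to the tensor factor number `f j`, for all
`j`. -/
def applyAt {k : ℕ} (f : Fin k ↪ Fin N) (a b : Fin k → V) (v : Fin N → V) : Fin N → V :=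
  fun n => Function.extend f (fun j => ketBra (a j) (b j)) (fun _ => id) n (v n)

lemma applyAt_apply {k : ℕ} (f : Fin k ↪ Fin N) (a b : Fin k → V) (v : Fin N → V) (j : Fin k) :
    applyAt f a b v (f j) = ketBra (a j) (b j) (v (f j)) := by
  unfold applyAt
  rw [f.injective.extend_apply]

lemma applyAt_of_notMem {k : ℕ} (f : Fin k ↪ Fin N) (a b : Fin k → V) (v : Fin N → V) {n : Fin N}
    (hn : n ∉ Set.range f) : applyAt f a b v n = v n := by
  unfold applyAt
  rw [Function.extend_apply' _ _ _ hn]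
  rfl

lemma applyAt_update_of_notMem {k : ℕ} (f : Fin k ↪ Fin N) (a b : Fin k → V) (v : Fin N → V)
    {n : Fin N} (hn : n ∉ Set.range f) (x : V) :
    applyAt f a b (Function.update v n x) = Function.update (applyAt f a b v) n x := by
  funext m
  by_cases hm : m ∈ Set.range f
  · obtain ⟨j, rfl⟩ := hm
    have hne : f j ≠ n := fun h => hn ⟨j, h⟩
    rw [applyAt_apply, Function.update_of_ne hne, Function.update_of_ne hne, applyAt_apply]
  · rw [applyAt_of_notMem _ _ _ _ hm]
    rcases eq_or_ne m n with rfl | hne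
    · rw [Function.update_self, Function.update_self]
    · rw [Function.update_of_ne hne, Function.update_of_ne hne, applyAt_of_notMem _ _ _ _ hm]

lemma applyAt_update_left {k : ℕ} (f : Fin k ↪ Fin N) (a b : Fin k → V) (v : Fin N → V)
    (a₀ b₀ : V) (j : Fin k) :
    Function.update (applyAt f a b v) (f j) (ketBra a₀ b₀ (applyAt f a b v (f j)))
      = applyAt f (Function.update a j (⟪b₀, a j⟫_ℂ • a₀)) b v := by
  funext m
  by_cases hm : m ∈ Set.range f
  · obtain ⟨i, rfl⟩ := hm
    rw [applyAt_apply, applyAt_apply]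
    rcases eq_or_ne i j with rfl | hne
    · rw [Function.update_self, Function.update_self]
      simp only [ketBra, inner_smul_right, smul_smul]
    · rw [Function.update_of_ne (f.injective.ne hne), Function.update_of_ne hne, applyAt_apply]
  · have hne : m ≠ f j := fun h => hm ⟨j, h.symm⟩
    rw [Function.update_of_ne hne, applyAt_of_notMem _ _ _ _ hm, applyAt_of_notMem _ _ _ _ hm]

lemma applyAt_update_right {k : ℕ} (f : Fin k ↪ Fin N) (a b : Fin k → V) (w : Fin N → V)
    (a₀ b₀ : V) (j : Fin k) :
    applyAt f b a (Function.update w (f j) (ketBra b₀ a₀ (w (f j))))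
      = applyAt f b (Function.update a j (⟪b₀, a j⟫_ℂ • a₀)) w := by
  funext m
  by_cases hm : m ∈ Set.range f
  · obtain ⟨i, rfl⟩ := hm
    rw [applyAt_apply, applyAt_apply]
    rcases eq_or_ne i j with rfl | hne
    · rw [Function.update_self, Function.update_self]
      simp only [ketBra, inner_smul_right, inner_smul_left, inner_conj_symm, mul_comm]
    · rw [Function.update_of_ne (f.injective.ne hne), Function.update_of_ne hne]
  · have hne : m ≠ f j := fun h => hm ⟨j, h.symm⟩
    rw [applyAt_of_notMem _ _ _ _ hm, applyAt_of_notMem _ _ _ _ hm, Function.update_of_ne hne]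

lemma applyAt_succ {k : ℕ} (f : Fin (k + 1) ↪ Fin N) (a b : Fin (k + 1) → V) (v : Fin N → V) :
    applyAt f a b v = Function.update
      (applyAt (Equiv.embeddingFinSucc k _ f).1 (fun j => a j.succ) (fun j => b j.succ) v)
      (f 0) (ketBra (a 0) (b 0) (v (f 0))) := by
  have hf : ∀ j, (Equiv.embeddingFinSucc k _ f).1 j = f j.succ := fun j => rfl
  funext m
  rcases eq_or_ne m (f 0) with rfl | hne
  · rw [Function.update_self, applyAt_apply]
  · rw [Function.update_of_ne hne]
    by_cases hm : m ∈ Set.range (Equiv.embeddingFinSucc k _ f).1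
    · obtain ⟨j, rfl⟩ := hm
      rw [applyAt_apply, hf, applyAt_apply]
    · rw [applyAt_of_notMem _ _ _ _ hm, applyAt_of_notMem]
      rintro ⟨i, rfl⟩
      induction i using Fin.cases with
      | zero => exact hne rfl
      | succ j => exact hm ⟨j, rfl⟩

/-- A further position is either outside the range of an embedding of `Fin k`, which extends it to
an embedding of `Fin (k + 1)`, or it is one of the positions already used. -/
lemma sum_embedding_split {k : ℕ} (Φ : (Fin k ↪ Fin N) → Fin N → ℂ) :
    ∑ f, ∑ n, Φ f n
      = ∑ f : Fin (k + 1) ↪ Fin N, Φ (Equiv.embeddingFinSucc k _ f).1 (f 0)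
        + ∑ f : Fin k ↪ Fin N, ∑ j, Φ f (f j) := by
  classical
  have h1 : ∑ f : Fin (k + 1) ↪ Fin N, Φ (Equiv.embeddingFinSucc k _ f).1 (f 0)
      = ∑ f : Fin k ↪ Fin N, ∑ n : {n // n ∉ Set.range f}, Φ f n := by
    rw [← Fintype.sum_sigma']
    exact Fintype.sum_equiv (Equiv.embeddingFinSucc k (Fin N)) _ _ fun f => rfl
  rw [h1, ← Finset.sum_add_distrib]
  refine Finset.sum_congr rfl fun f _ => ?_
  have h2 : ∑ j, Φ f (f j) = ∑ n ∈ Finset.univ.filter (· ∈ Set.range f), Φ f n := by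
    rw [← Finset.sum_map Finset.univ f]
    congr 1
    ext n
    simp
  have h3 : ∑ n : {n // n ∉ Set.range f}, Φ f n
      = ∑ n ∈ Finset.univ.filter (· ∉ Set.range f), Φ f n :=
    (Finset.sum_subtype _ (by simp) _).symm
  rw [h2, h3, add_comm, Finset.sum_filter_add_sum_filter_not]

/-- An operator that commutes with all `U ⊗ ⋯ ⊗ U` commutes with the sums of the operators that
apply `k` rank one operators to any `k` different tensor factors. By induction on `k`: multiplying
by a derivation either hits a new factor or changes one of the rank one operators. -/
lemma sum_inner_applyAt
    (hT : ∀ U : V ≃ₗᵢ[ℂ] V, T * unitaryPower N U = unitaryPower N U * T) (k : ℕ) :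
    ∀ (a b : Fin k → V) (w v : Fin N → V),
      ∑ f : Fin k ↪ Fin N, ⟪productState w, T (productState (applyAt f a b v))⟫_ℂ
        = ∑ f : Fin k ↪ Fin N, ⟪productState (applyAt f b a w), T (productState v)⟫_ℂ := by
  induction k with
  | zero =>
    intro a b w v
    refine Finset.sum_congr rfl fun f _ => ?_
    have h : ∀ (a b : Fin 0 → V) v, applyAt f a b v = v := fun a b v =>
      funext fun n => applyAt_of_notMem _ _ _ _ (by simp)
    rw [h, h]
  | succ k ih =>
    intro a b w v
    have hder : ∀ w v : Fin N → V,
        ∑ n, ⟪productState w, T (productState (Function.update v n (ketBra (a 0) (b 0) (v n))))⟫_ℂ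
          = ∑ n, ⟪productState (Function.update w n (ketBra (b 0) (a 0) (w n))),
              T (productState v)⟫_ℂ := by
      intro w v
      have := derivationDefect_eq_zero hT w v (a 0) (b 0)
      rw [derivationDefect, Finset.sum_sub_distrib] at this
      exact sub_eq_zero.1 this
    have hR := sum_embedding_split (N := N) (k := k) fun f n =>
      ⟪productState w, T (productState (Function.update
        (applyAt f (fun j => a j.succ) (fun j => b j.succ) v) n
        (ketBra (a 0) (b 0) (applyAt f (fun j => a j.succ) (fun j => b j.succ) v n))))⟫_ℂ
    have hL := sum_embedding_split (N := N) (k := k) fun f n =>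
      ⟪productState (applyAt f (fun j => b j.succ) (fun j => a j.succ)
        (Function.update w n (ketBra (b 0) (a 0) (w n)))), T (productState v)⟫_ℂ
    simp only [applyAt_update_left] at hR
    simp only [applyAt_update_right] at hL
    have hRL : ∑ f : Fin k ↪ Fin N, ∑ n, ⟪productState w, T (productState (Function.update
        (applyAt f (fun j => a j.succ) (fun j => b j.succ) v) n
        (ketBra (a 0) (b 0) (applyAt f (fun j => a j.succ) (fun j => b j.succ) v n))))⟫_ℂ
      = ∑ f : Fin k ↪ Fin N, ∑ n, ⟪productState (applyAt f (fun j => b j.succ) (fun j => a j.succ)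
        (Function.update w n (ketBra (b 0) (a 0) (w n)))), T (productState v)⟫_ℂ := by
      rw [Finset.sum_congr rfl fun f _ => hder w _, Finset.sum_comm,
        Finset.sum_congr rfl fun n _ => ih _ _ _ _, Finset.sum_comm]
    rw [hR, hL] at hRL
    -- The terms where the derivation hits one of the `k` factors cancel by induction.
    have hrest : ∑ f : Fin k ↪ Fin N, ∑ j : Fin k, ⟪productState w, T (productState (applyAt f
        (Function.update (fun j => a j.succ) j (⟪b 0, a j.succ⟫_ℂ • a 0))
        (fun j => b j.succ) v))⟫_ℂ
      = ∑ f : Fin k ↪ Fin N, ∑ j : Fin k, ⟪productState (applyAt f (fun j => b j.succ)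
        (Function.update (fun j => a j.succ) j (⟪b 0, a j.succ⟫_ℂ • a 0)) w),
        T (productState v)⟫_ℂ := by
      rw [Finset.sum_comm, Finset.sum_congr rfl fun j _ => ih _ _ _ _, Finset.sum_comm]
    rw [hrest] at hRL
    have hmain := add_right_cancel hRL
    refine Eq.trans (Finset.sum_congr rfl fun f _ => ?_)
      (hmain.trans (Finset.sum_congr rfl fun f _ => ?_))
    · have h0 : f 0 ∉ Set.range (Equiv.embeddingFinSucc k _ f).1 :=
        (Equiv.embeddingFinSucc k _ f).2.2
      rw [applyAt_succ, applyAt_of_notMem _ _ _ _ h0]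
    · have h0 : f 0 ∉ Set.range (Equiv.embeddingFinSucc k _ f).1 :=
        (Equiv.embeddingFinSucc k _ f).2.2
      rw [applyAt_update_of_notMem _ _ _ _ h0, ← applyAt_succ f b a w]

lemma productState_applyAt (σ : Equiv.Perm (Fin N)) (a b v : Fin N → V) :
    productState (applyAt σ.toEmbedding a b v)
      = ⟪permOperator σ (productState b), productState v⟫_ℂ • permOperator σ (productState a) := by
  rw [permOperator_productState, permOperator_productState, inner_productState,
    ← productState_smul]
  congr 1
  funext n
  have h := applyAt_apply σ.toEmbedding a b v (σ.symm n)
  simpa [ketBra] using h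

/-- The element `∑ σ, ⟨σ b, x⟩ σ` of `ℂ[S_N]`, for a product state `b`. -/
def matrixElement (b : Fin N → V) (x : NParticleSpace V N) :
    MonoidAlgebra ℂ (Equiv.Perm (Fin N)) :=
  ∑ σ, ⟪permOperator σ (productState b), x⟫_ℂ • MonoidAlgebra.of ℂ _ σ

lemma permAlg_matrixElement (b : Fin N → V) (x : NParticleSpace V N) :
    permAlg V N (matrixElement b x)
      = ∑ σ, ⟪permOperator σ (productState b), x⟫_ℂ • permOperator σ := by
  simp only [matrixElement, map_sum, map_smul, permAlg_of]

/-- The case `k = N` of `sum_inner_applyAt`: the embeddings of `Fin N` in itself are the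
permutations, and all tensor factors are replaced. -/
lemma mul_permAlg_matrixElement
    (hT : ∀ U : V ≃ₗᵢ[ℂ] V, T * unitaryPower N U = unitaryPower N U * T) (b v : Fin N → V) :
    T * permAlg V N (matrixElement b (productState v))
      = permAlg V N (matrixElement b (T (productState v))) := by
  refine clm_ext fun a => ext_inner_productState fun w => ?_
  rw [permAlg_matrixElement, permAlg_matrixElement, mul_apply_eq_comp, sum_apply, sum_apply,
    map_sum, inner_sum, inner_sum]
  have h := sum_inner_applyAt hT N a b w v
  let e : (Fin N ↪ Fin N) ≃ Equiv.Perm (Fin N) :=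
    { toFun := fun f => f.equivOfFiniteSelfEmbedding
      invFun := fun σ => σ.toEmbedding
      left_inv := fun f => f.toEmbedding_equivOfFiniteSelfEmbedding
      right_inv := fun σ => Equiv.ext fun x => by
        exact DFunLike.congr_fun (σ.toEmbedding.toEmbedding_equivOfFiniteSelfEmbedding) x }
  rw [← Equiv.sum_comp e.symm, ← Equiv.sum_comp e.symm] at h
  have he : ∀ σ : Equiv.Perm (Fin N), e.symm σ = σ.toEmbedding := fun σ => rfl
  simp only [he, productState_applyAt, map_smul, inner_smul_right, inner_smul_left,
    inner_conj_symm] at h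
  simp only [smul_apply, map_smul, inner_smul_right]
  rw [h]
  exact Finset.sum_congr rfl fun σ _ => mul_comm _ _

/-- **The bicommutant theorem** for the `N`-particle space: a bounded operator that commutes with
all `U ⊗ ⋯ ⊗ U` is a linear combination of permutations of the particles. The matrix elements `∑ σ,
⟨σ b, v⟩ σ` span the orthogonal complement in `ℂ[S_N]` of the kernel of the action, so that the
identity operator is a combination of them. -/
theorem exists_permAlg_eq
    (hT : ∀ U : V ≃ₗᵢ[ℂ] V, T * unitaryPower N U = unitaryPower N U * T) :
    ∃ p, T = permAlg V N p := by
  classical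
  let act : EuclideanSpace ℂ (Equiv.Perm (Fin N)) →ₗ[ℂ]
      (NParticleSpace V N →L[ℂ] NParticleSpace V N) :=
    { toFun := fun x => ∑ σ, x σ • permOperator σ
      map_add' := fun x y => by simp [add_smul, Finset.sum_add_distrib]
      map_smul' := fun r x => by simp [Finset.smul_sum, smul_smul] }
  let m : (Fin N → V) × (Fin N → V) → EuclideanSpace ℂ (Equiv.Perm (Fin N)) := fun p =>
    WithLp.toLp 2 fun σ => ⟪permOperator σ (productState p.1), productState p.2⟫_ℂ
  let J := Submodule.span ℂ (Set.range m)
  have hJ : ∀ x ∈ J, ∃ p, T * act x = permAlg V N p := by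
    intro x hx
    induction hx using Submodule.span_induction with
    | mem x hx =>
      obtain ⟨⟨b, v⟩, rfl⟩ := hx
      refine ⟨_, Eq.trans ?_ (mul_permAlg_matrixElement hT b v)⟩
      rw [permAlg_matrixElement]
      rfl
    | zero => exact ⟨0, by simp⟩
    | add x y _ _ hx hy =>
      obtain ⟨p, hp⟩ := hx
      obtain ⟨q, hq⟩ := hy
      exact ⟨p + q, by rw [map_add, mul_add, hp, hq, map_add]⟩
    | smul r x _ hx =>
      obtain ⟨p, hp⟩ := hx
      exact ⟨r • p, by rw [map_smul, mul_smul_comm, hp, map_smul]⟩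
  have hJo : ∀ x ∈ Jᗮ, act x = 0 := by
    intro x hx
    refine clm_ext fun b => ext_inner_productState fun v => ?_
    have h1 := (Submodule.mem_orthogonal J x).1 hx (m (b, v)) (Submodule.subset_span ⟨_, rfl⟩)
    rw [PiLp.inner_apply] at h1
    simp only [m, RCLike.inner_apply, inner_conj_symm] at h1
    simp only [act, LinearMap.coe_mk, AddHom.coe_mk, sum_apply,
      smul_apply, inner_sum, inner_smul_right]
    rw [h1]
    simp
  obtain ⟨x, hx, y, hy, hxy⟩ := Submodule.exists_add_mem_mem_orthogonal (K := J)
    (EuclideanSpace.single (1 : Equiv.Perm (Fin N)) (1 : ℂ))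
  obtain ⟨p, hp⟩ := hJ x hx
  refine ⟨p, ?_⟩
  have h1 : act (EuclideanSpace.single (1 : Equiv.Perm (Fin N)) (1 : ℂ)) = 1 := by
    have h2 : (permOperator (1 : Equiv.Perm (Fin N)) : NParticleSpace V N →L[ℂ] NParticleSpace V N)
        = 1 := by
      rw [← permAlg_of, map_one, map_one]
    change ∑ σ, _ = _
    rw [Finset.sum_eq_single 1]
    · simp [h2]
    · intro σ _ hσ
      simp [hσ]
    · simp
  rw [← hp]
  have h3 : act x = 1 := by rw [← h1, hxy, map_add, hJo y hy, add_zero]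
  rw [h3, mul_one]

end Bicommutant

/-! ### Invariant words, power sums and Schur functions -/

section CycleIndex

/-- A product of finitely many absolutely convergent series is the sum over all words, which
converges absolutely. -/
lemma summable_prod_pi (n : ℕ) {ι : Type*} (f : Fin n → ι → ℂ)
    (hf : ∀ o, Summable fun i => ‖f o i‖) :
    (Summable fun w : Fin n → ι => ‖∏ o, f o (w o)‖) ∧
      ∑' w : Fin n → ι, ∏ o, f o (w o) = ∏ o, ∑' i, f o i := by
  induction n with
  | zero => exact ⟨(hasSum_unique _).summable, by simp⟩
  | succ n ih =>
    obtain ⟨h1, h2⟩ := ih (fun a => f a.succ) fun a => hf a.succ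
    let E : ι × (Fin n → ι) ≃ (Fin (n + 1) → ι) := Fin.consEquiv fun _ => ι
    have hE : ∀ p : ι × (Fin n → ι), ∏ o, f o (E p o)
        = f 0 p.1 * ∏ a, f a.succ (p.2 a) := fun p => by
      rw [Fin.prod_univ_succ]
      rfl
    constructor
    · rw [← E.summable_iff]
      refine ((hf 0).mul_of_nonneg h1 (fun _ => norm_nonneg _) fun _ => norm_nonneg _).congr
        fun p => ?_
      rw [Function.comp_apply, hE, norm_mul]
    · rw [← E.tsum_eq, tsum_congr hE, ← tsum_mul_tsum_of_summable_norm (hf 0) h1, h2,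
        Fin.prod_univ_succ]

lemma hasSum_prod_pi {O : Type*} [Fintype O] {ι : Type*} (f : O → ι → ℂ)
    (hf : ∀ o, Summable fun i => ‖f o i‖) :
    HasSum (fun w : O → ι => ∏ o, f o (w o)) (∏ o, ∑' i, f o i) := by
  obtain ⟨h1, h2⟩ := summable_prod_pi (Fintype.card O)
    (fun k => f ((Fintype.equivFin O).symm k)) fun k => hf _
  have h3 : HasSum (fun w : Fin (Fintype.card O) → ι =>
      ∏ k, f ((Fintype.equivFin O).symm k) (w k)) (∏ o, ∑' i, f o i) := by
    rw [← Equiv.prod_comp (Fintype.equivFin O).symm, ← h2]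
    exact h1.of_norm.hasSum
  rw [← (Equiv.arrowCongr (Fintype.equivFin O) (Equiv.refl ι)).symm.hasSum_iff]
  refine h3.congr_fun fun w => ?_
  exact Fintype.prod_equiv (Fintype.equivFin O) _ _ fun o => by simp

open Equiv.Perm

variable {N : ℕ}

/-- The orbits of a permutation, fixed points included. -/
abbrev Orbits (σ : Equiv.Perm (Fin N)) : Type := Quotient (SameCycle.setoid σ)

open Classical in
def orbitCard (σ : Equiv.Perm (Fin N)) (o : Orbits σ) : ℕ :=
  (Finset.univ.filter fun k => (Quotient.mk _ k : Orbits σ) = o).card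

lemma orbitCard_pos (σ : Equiv.Perm (Fin N)) (o : Orbits σ) : 0 < orbitCard σ o := by
  induction o using Quotient.inductionOn with
  | h k => exact Finset.card_pos.2 ⟨k, by simp⟩

lemma orbitCard_mk (σ : Equiv.Perm (Fin N)) (x : Fin N) :
    (x ∈ σ.support → orbitCard σ (Quotient.mk _ x) = (σ.cycleOf x).support.card) ∧
      (x ∉ σ.support → orbitCard σ (Quotient.mk _ x) = 1) := by
  classical
  have hmk : ∀ y, (Quotient.mk _ y : Orbits σ) = Quotient.mk _ x ↔ σ.SameCycle x y := fun y =>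
    ⟨fun h => SameCycle.symm (Quotient.exact h), fun h => Quotient.sound (SameCycle.symm h)⟩
  unfold orbitCard
  simp only [hmk]
  constructor
  · intro hx
    congr 1
    ext y
    simp only [Finset.mem_filter, Finset.mem_univ, true_and, mem_support_cycleOf_iff, hx, and_true]
  · intro hx
    rw [Finset.card_eq_one]
    refine ⟨x, ?_⟩
    ext y
    simp only [Finset.mem_filter, Finset.mem_univ, true_and, Finset.mem_singleton]
    constructor
    · intro h
      have hfix : Function.IsFixedPt σ x := notMem_support.1 hx
      exact (h.eq_of_left hfix).symm
    · rintro rfl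
      exact SameCycle.refl _ _

/-- The cycle type of a permutation is the multiset of the sizes of its orbits that have at least
two elements. -/
lemma filter_map_orbitCard (σ : Equiv.Perm (Fin N)) [Fintype (Orbits σ)] :
    ((Finset.univ : Finset (Orbits σ)).val.map (orbitCard σ)).filter (2 ≤ ·) = σ.cycleType := by
  classical
  rw [Multiset.filter_map, cycleType_def]
  have hout : ∀ o : Orbits σ, 2 ≤ orbitCard σ o → o.out ∈ σ.support := by
    intro o ho
    by_contra hn
    have := (orbitCard_mk σ o.out).2 hn
    rw [Quotient.out_eq] at this
    omega
  have hmem : ∀ o : Orbits σ, o ∈ Multiset.filter ((2 ≤ ·) ∘ orbitCard σ) Finset.univ.val →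
      2 ≤ orbitCard σ o := fun o ho => (Multiset.mem_filter.1 ho).2
  refine Multiset.map_eq_map_of_bij_of_nodup _ _ (Finset.univ.nodup.filter _) (Finset.nodup _)
    (fun o _ => σ.cycleOf o.out) ?_ ?_ ?_ ?_
  · exact fun o ho => cycleOf_mem_cycleFactorsFinset_iff.2 (hout o (hmem o ho))
  · intro o ho o' ho' h
    have h1 : o.out ∈ (σ.cycleOf o'.out).support := by
      rw [← h]
      exact mem_support_cycleOf_iff.2 ⟨SameCycle.refl _ _, hout o (hmem o ho)⟩
    have h2 : (Quotient.mk (SameCycle.setoid σ) o'.out) = Quotient.mk _ o.out :=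
      Quotient.sound (mem_support_cycleOf_iff.1 h1).1
    rw [Quotient.out_eq, Quotient.out_eq] at h2
    exact h2.symm
  · intro c hc
    have hc' : c ∈ σ.cycleFactorsFinset := hc
    obtain ⟨x, hx⟩ := (mem_cycleFactorsFinset_iff.1 hc').1.nonempty_support
    have hcx := cycle_is_cycleOf hx hc'
    have hxs : x ∈ σ.support := by
      rw [hcx] at hx
      exact (mem_support_cycleOf_iff.1 hx).2
    have hcard := (orbitCard_mk σ x).1 hxs
    have h2 : 2 ≤ orbitCard σ (Quotient.mk _ x) := by
      rw [hcard, ← hcx]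
      exact (mem_cycleFactorsFinset_iff.1 hc').1.two_le_card_support
    refine ⟨Quotient.mk _ x, Multiset.mem_filter.2 ⟨Finset.mem_univ _, h2⟩, ?_⟩
    have h3 : σ.SameCycle (Quotient.mk (SameCycle.setoid σ) x).out x :=
      Quotient.exact (Quotient.out_eq (Quotient.mk (SameCycle.setoid σ) x))
    rw [hcx]
    exact h3.cycleOf_eq
  · intro o ho
    have := (orbitCard_mk σ o.out).1 (hout o (hmem o ho))
    rw [Quotient.out_eq] at this
    exact this

/-- A multiset of positive numbers is determined by its elements `≥ 2` and its sum. -/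
lemma eq_filter_add_replicate {m : Multiset ℕ} (h : ∀ n ∈ m, 0 < n) :
    m = m.filter (2 ≤ ·) + Multiset.replicate (m.sum - (m.filter (2 ≤ ·)).sum) 1 := by
  have hsplit : m.filter (2 ≤ ·) + m.filter (¬ 2 ≤ ·) = m := Multiset.filter_add_not _ _
  have hone : m.filter (¬ 2 ≤ ·)
      = Multiset.replicate (Multiset.card (m.filter (¬ 2 ≤ ·))) 1 := by
    rw [Multiset.eq_replicate]
    refine ⟨rfl, fun b hb => ?_⟩
    have h1 := Multiset.mem_filter.1 hb
    have := h b h1.1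
    omega
  have hsum : m.sum = (m.filter (2 ≤ ·)).sum + Multiset.card (m.filter (¬ 2 ≤ ·)) := by
    conv_lhs => rw [← hsplit, Multiset.sum_add, hone]
    simp
  conv_lhs => rw [← hsplit, hone]
  rw [hsum, Nat.add_sub_cancel_left]

/-- The sizes of the orbits are the cycle lengths, fixed points included. -/
lemma map_orbitCard (σ : Equiv.Perm (Fin N)) [Fintype (Orbits σ)] :
    (Finset.univ : Finset (Orbits σ)).val.map (orbitCard σ) = σ.partition.parts := by
  classical
  have h1 : ∀ n ∈ (Finset.univ : Finset (Orbits σ)).val.map (orbitCard σ), 0 < n := by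
    intro n hn
    obtain ⟨o, _, rfl⟩ := Multiset.mem_map.1 hn
    exact orbitCard_pos σ o
  have hsum : ((Finset.univ : Finset (Orbits σ)).val.map (orbitCard σ)).sum
      = σ.partition.parts.sum := by
    rw [σ.partition.parts_sum]
    change ∑ o, orbitCard σ o = _
    unfold orbitCard
    rw [← Finset.card_eq_sum_card_fiberwise fun _ _ => Finset.mem_coe.2 (Finset.mem_univ _)]
    exact Finset.card_univ
  have h2 : ∀ n ∈ σ.partition.parts, 0 < n := fun n hn => σ.partition.parts_pos hn
  rw [eq_filter_add_replicate h1, eq_filter_add_replicate h2, filter_map_orbitCard, hsum,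
    filter_parts_partition_eq_cycleType]

/-- The product of the power sums `p_m(x)` over the cycle lengths `m` of a permutation. -/
def cyclePowerSum {ι : Type*} (x : ι → ℂ) (σ : Equiv.Perm (Fin N)) : ℂ :=
  ∏ k ∈ Finset.Icc 1 N, powerSum x k ^ (cyclePartition σ).parts.count k

lemma cyclePowerSum_of_isConj {ι : Type*} (x : ι → ℂ) {σ τ : Equiv.Perm (Fin N)}
    (h : IsConj σ τ) : cyclePowerSum x σ = cyclePowerSum x τ := by
  unfold cyclePowerSum cyclePartition
  simp only [partition_eq_of_isConj.1 h]

lemma cyclePowerSum_inv {ι : Type*} (x : ι → ℂ) (σ : Equiv.Perm (Fin N)) :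
    cyclePowerSum x σ⁻¹ = cyclePowerSum x σ :=
  cyclePowerSum_of_isConj x (isConj_of_cyclePartition (by simp [parts_partition]))

lemma cyclePowerSum_eq_prod {ι : Type*} (x : ι → ℂ) (σ : Equiv.Perm (Fin N))
    [Fintype (Orbits σ)] : cyclePowerSum x σ = ∏ o : Orbits σ, powerSum x (orbitCard σ o) := by
  classical
  have h1 : ∏ o : Orbits σ, powerSum x (orbitCard σ o)
      = (σ.partition.parts.map (powerSum x)).prod := by
    rw [← map_orbitCard, Multiset.map_map]
    rfl
  rw [h1, Finset.prod_multiset_map_count]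
  refine (Finset.prod_subset (fun n hn => ?_) fun n _ hn => ?_).symm
  · have hn' := Multiset.mem_toFinset.1 hn
    have h2 := σ.partition.le_of_mem_parts hn'
    rw [Fintype.card_fin] at h2
    exact Finset.mem_Icc.2 ⟨σ.partition.parts_pos hn', h2⟩
  · have : (cyclePartition σ).parts.count n = 0 :=
      Multiset.count_eq_zero.2 fun h => hn (Multiset.mem_toFinset.2 h)
    rw [this, pow_zero]

/-- All but finitely many terms have norm less than `1`, where powers are dominated by the terms. -/
lemma summable_norm_pow {ι : Type*} {x : ι → ℂ} (hx : Summable fun i => ‖x i‖) {n : ℕ}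
    (hn : 0 < n) : Summable fun i => ‖x i ^ n‖ := by
  obtain ⟨n, rfl⟩ := Nat.exists_eq_succ_of_ne_zero hn.ne'
  refine Summable.of_norm_bounded_eventually (g := fun i => ‖x i‖) hx ?_
  have h1 : ∀ᶠ i in Filter.cofinite, ‖x i‖ < 1 :=
    hx.tendsto_cofinite_zero.eventually (gt_mem_nhds one_pos)
  filter_upwards [h1] with i hi
  rw [norm_norm, norm_pow, pow_succ]
  exact mul_le_of_le_one_left (norm_nonneg _) (pow_le_one₀ (norm_nonneg _) hi.le)

open Classical in
/-- The sum of `∏ k, x (w k)` over all words `w` that are invariant under a permutation of the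
letters. Such a word is a function on the orbits of the permutation. -/
lemma hasSum_invariant_words {ι : Type*} {x : ι → ℂ} (hx : Summable fun i => ‖x i‖)
    (σ : Equiv.Perm (Fin N)) :
    HasSum (fun w : Fin N → ι => if (fun k => w (σ k)) = w then ∏ k, x (w k) else 0)
      (cyclePowerSum x σ) := by
  let g : (Orbits σ → ι) → Fin N → ι := fun q k => q (Quotient.mk _ k)
  have hg : Function.Injective g := by
    intro q q' h
    funext o
    induction o using Quotient.inductionOn with
    | h k => exact congrFun h k
  have hinv : ∀ q, (fun k => g q (σ k)) = g q := fun q => funext fun k =>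
    congrArg q (Quotient.sound (sameCycle_apply_left.2 (SameCycle.refl _ _)))
  refine (hg.hasSum_iff fun w hw => if_neg fun h => hw ?_).1 ?_
  · refine ⟨fun o => Quotient.lift w (fun a b hab => ?_) o, rfl⟩
    have hpow : ∀ (n : ℤ) a, w ((σ ^ n) a) = w a := by
      have hnat : ∀ (n : ℕ) a, w ((σ ^ n) a) = w a := by
        intro n
        induction n with
        | zero => simp
        | succ n ih =>
          intro a
          rw [pow_succ, Equiv.Perm.mul_apply, ih]
          exact congrFun h a
      intro n a
      obtain ⟨m, rfl | rfl⟩ := n.eq_nat_or_neg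
      · exact hnat m a
      · have := hnat m ((σ ^ (-(m : ℤ))) a)
        rw [← this]
        simp
    obtain ⟨n, rfl⟩ : σ.SameCycle a b := hab
    exact (hpow n a).symm
  · have h3 : HasSum (fun q : Orbits σ → ι => ∏ o, x (q o) ^ orbitCard σ o)
        (cyclePowerSum x σ) := by
      rw [cyclePowerSum_eq_prod]
      exact hasSum_prod_pi (fun o i => x i ^ orbitCard σ o)
        fun o => summable_norm_pow hx (orbitCard_pos σ o)
    refine h3.congr_fun fun q => ?_
    rw [Function.comp_apply, if_pos (hinv q)]
    rw [← Finset.prod_fiberwise_of_maps_to (s := Finset.univ) (t := Finset.univ)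
      (g := fun k => (Quotient.mk _ k : Orbits σ)) (fun _ _ => Finset.mem_univ _)]
    refine Finset.prod_congr rfl fun o _ => ?_
    rw [Finset.prod_congr rfl fun k hk => ?_, Finset.prod_const]
    · unfold orbitCard
      congr!
    · change x (q _) = x (q o)
      rw [(Finset.mem_filter.1 hk).2]

lemma cyclePartition_eq_iff (σ : Equiv.Perm (Fin N)) (m : N.Partition) :
    cyclePartition σ = m ↔ σ.cycleType = m.parts.filter (2 ≤ ·) := by
  constructor
  · rintro rfl
    exact filter_parts_partition_eq_cycleType.symm
  · intro h
    refine Nat.Partition.ext ?_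
    rw [eq_filter_add_replicate fun n hn => (cyclePartition σ).parts_pos hn,
      eq_filter_add_replicate fun n hn => m.parts_pos hn, (cyclePartition σ).parts_sum,
      m.parts_sum, ← h]
    congr 1 <;> simp only [cyclePartition, filter_parts_partition_eq_cycleType]

lemma card_cyclePartition (m : N.Partition) :
    ((Finset.univ.filter fun σ : Equiv.Perm (Fin N) => cyclePartition σ = m).card : ℂ)
      = classSize m := by
  classical
  let F := m.parts.filter (2 ≤ ·)
  have hsplit : m.parts = F + Multiset.replicate (N - F.sum) 1 := by
    have := eq_filter_add_replicate fun n hn => m.parts_pos hn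
    rwa [m.parts_sum] at this
  have hle : F.sum ≤ N := by
    have h := congrArg Multiset.sum hsplit
    rw [m.parts_sum, Multiset.sum_add] at h
    omega
  have h1F : F.count 1 = 0 := Multiset.count_eq_zero.2 fun h => by
    have := (Multiset.mem_filter.1 h).2
    omega
  have hcount1 : m.parts.count 1 = N - F.sum := by
    rw [hsplit, Multiset.count_add, h1F]
    simp
  have hcount : ∀ n ∈ F.toFinset, m.parts.count n = F.count n := by
    intro n hn
    rw [Multiset.count_filter_of_pos (Multiset.mem_filter.1 (Multiset.mem_toFinset.1 hn)).2]
  have hprod : ∏ j ∈ Finset.Icc 1 N, (j ^ m.parts.count j * (m.parts.count j).factorial)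
      = (N - F.sum).factorial * F.prod * ∏ n ∈ F.toFinset, (F.count n).factorial := by
    have hzero : ∀ j, j ∉ m.parts →
        j ^ m.parts.count j * (m.parts.count j).factorial = 1 := by
      intro j hj
      rw [Multiset.count_eq_zero.2 hj]
      simp
    have hIcc : ∀ j ∈ m.parts, j ∈ Finset.Icc 1 N := fun j hj => by
      have h2 := m.le_of_mem_parts hj
      exact Finset.mem_Icc.2 ⟨m.parts_pos hj, h2⟩
    have hT : ∏ j ∈ Finset.Icc 1 N, (j ^ m.parts.count j * (m.parts.count j).factorial)
        = ∏ j ∈ insert 1 F.toFinset, (j ^ m.parts.count j * (m.parts.count j).factorial) := by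
      rw [Finset.prod_subset (Finset.subset_union_left (s₂ := insert 1 F.toFinset)),
        ← Finset.prod_subset (Finset.subset_union_right (s₁ := Finset.Icc 1 N))]
      · intro j _ hj
        refine hzero j fun hm => hj ?_
        rw [Finset.mem_insert, Multiset.mem_toFinset]
        have h0 := m.parts_pos hm
        have h2 : j = 1 ∨ 2 ≤ j := by omega
        exact h2.imp id fun h => Multiset.mem_filter.2 ⟨hm, h⟩
      · exact fun j _ hj => hzero j fun hm => hj (hIcc j hm)
    have h1T : 1 ∉ F.toFinset := fun h => by
      have := (Multiset.mem_filter.1 (Multiset.mem_toFinset.1 h)).2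
      omega
    rw [hT, Finset.prod_insert h1T, hcount1, one_pow, one_mul, mul_assoc,
      Finset.prod_congr rfl fun n hn => by rw [hcount n hn], Finset.prod_mul_distrib,
      Finset.prod_multiset_count]
  have hcard := card_of_cycleType_mul_eq (Fin N) F
  rw [if_pos ⟨by rwa [Fintype.card_fin], fun a ha => (Multiset.mem_filter.1 ha).2⟩,
    Fintype.card_fin, ← hprod] at hcard
  simp only [cyclePartition_eq_iff]
  have hne : (∏ j ∈ Finset.Icc 1 N, ((j : ℂ) ^ m.parts.count j *
      ((m.parts.count j).factorial : ℂ))) ≠ 0 := by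
    refine Finset.prod_ne_zero_iff.2 fun j hj => mul_ne_zero (pow_ne_zero _ ?_) ?_
    · have := (Finset.mem_Icc.1 hj).1
      exact Nat.cast_ne_zero.2 (by omega)
    · exact Nat.cast_ne_zero.2 (Nat.factorial_ne_zero _)
  rw [classSize, eq_div_iff hne]
  exact_mod_cast hcard

/-- The Schur function as the average of the character against the products of power sums, and hence
as a sum over the coefficients of the Young idempotent. -/
lemma schurFunction_eq_sum {ι : Type*} (l : N.Partition) (x : ι → ℂ) :
    schurFunction l x = ∑ τ, (youngIdempotent l).coeff τ * cyclePowerSum x τ := by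
  classical
  have hfac : (N.factorial : ℂ) ≠ 0 := Nat.cast_ne_zero.2 N.factorial_ne_zero
  have h := sum_trace_spechtRep_mul l fun σ τ hστ => cyclePowerSum_of_isConj x hστ
  simp only [cyclePowerSum_inv] at h
  have h2 : ∑ σ, LinearMap.trace ℂ _ (spechtRep l σ) * cyclePowerSum x σ
      = (N.factorial : ℂ) * schurFunction l x := by
    rw [← Finset.sum_fiberwise_of_maps_to (s := Finset.univ) (t := Finset.univ)
      (g := cyclePartition) (fun _ _ => Finset.mem_univ _), schurFunction, Finset.mul_sum]
    refine Finset.sum_congr rfl fun m _ => ?_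
    have h3 : ∀ σ ∈ Finset.univ.filter fun σ => cyclePartition σ = m,
        LinearMap.trace ℂ _ (spechtRep l σ) * cyclePowerSum x σ
          = spechtCharacter l m * ∏ k ∈ Finset.Icc 1 N, powerSum x k ^ m.parts.count k := by
      intro σ hσ
      obtain rfl := (Finset.mem_filter.1 hσ).2
      rw [spechtCharacter_eq, algCharacter_of, trace_eq_of_isConj _ (isConj_cycleRep σ)]
      rfl
    rw [Finset.sum_congr rfl h3, Finset.sum_const, nsmul_eq_mul, card_cyclePartition]
    field_simp
  rw [h2] at h
  exact mul_left_cancel₀ hfac h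

end CycleIndex

/-! ### Traces of the Gibbs operator -/

section Gibbs

variable {V : Type*} [NormedAddCommGroup V] [InnerProductSpace ℂ V] {N : ℕ} {ι : Type*}

lemma inner_productState_basis (φ : HilbertBasis ι ℂ V) (w w' : Fin N → ι) [Decidable (w = w')] :
    ⟪productState fun k => φ (w k), productState fun k => φ (w' k)⟫_ℂ
      = if w = w' then (1 : ℂ) else 0 := by
  classical
  rw [inner_productState]
  simp only [orthonormal_iff_ite.1 φ.orthonormal]
  by_cases h : w = w'
  · simp [h]
  · rw [if_neg h]
    obtain ⟨k, hk⟩ := Function.ne_iff.1 h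
    exact Finset.prod_eq_zero (Finset.mem_univ k) (if_neg hk)

lemma norm_productState_basis (φ : HilbertBasis ι ℂ V) (w : Fin N → ι) :
    ‖(productState fun k => φ (w k) : NParticleSpace V N)‖ = 1 := by
  classical
  have h := inner_productState_basis φ w w
  rw [if_pos rfl, inner_self_eq_norm_sq_to_K] at h
  have h2 : ‖(productState fun k => φ (w k) : NParticleSpace V N)‖ ^ 2 = 1 := by
    exact Complex.ofReal_injective ((Complex.ofReal_pow _ _).trans h)
  exact (pow_eq_one_iff_of_nonneg (norm_nonneg _) two_ne_zero).1 h2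

variable {ε : ι → ℝ} {β : ℝ}

lemma boltzmann_eq_prod (w : Fin N → ι) :
    Real.exp (-β * ∑ k, ε (w k)) = ∏ k, Real.exp (-β * ε (w k)) := by
  rw [Finset.mul_sum, Real.exp_sum]

lemma summable_norm_boltzmann (hβ : Summable fun i => Real.exp (-β * ε i)) :
    Summable fun i => ‖(Real.exp (-β * ε i) : ℂ)‖ :=
  hβ.congr fun i => by rw [Complex.norm_real, Real.norm_of_nonneg (Real.exp_nonneg _)]

lemma summable_boltzmann (hβ : Summable fun i => Real.exp (-β * ε i)) :
    Summable fun w : Fin N → ι => Real.exp (-β * ∑ k, ε (w k)) := by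
  have h := (summable_prod_pi N (fun _ i => (Real.exp (-β * ε i) : ℂ)) fun _ =>
    summable_norm_boltzmann hβ).1
  refine h.congr fun w => ?_
  rw [boltzmann_eq_prod, norm_prod]
  exact Finset.prod_congr rfl fun k _ => by
    rw [Complex.norm_real, Real.norm_of_nonneg (Real.exp_nonneg _)]

lemma hasSum_gibbsOperator (φ : HilbertBasis ι ℂ V)
    (hβ : Summable fun i => Real.exp (-β * ε i)) :
    HasSum (fun w : Fin N → ι => (Real.exp (-β * ∑ k, ε (w k)) : ℂ) •
      InnerProductSpace.rankOne ℂ (productState fun k => φ (w k))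
        (productState fun k => φ (w k))) (gibbsOperator N φ ε β) := by
  refine (Summable.of_norm ((summable_boltzmann (N := N) hβ).congr fun w => ?_)).hasSum
  rw [norm_smul, InnerProductSpace.norm_rankOne, norm_productState_basis, Complex.norm_real,
    Real.norm_of_nonneg (Real.exp_nonneg _), mul_one, mul_one]

/-- `e^{-β H_N}` commutes with permutations of the particles, which permute the product basis and
preserve the energy. -/
lemma permOperator_mul_gibbsOperator (φ : HilbertBasis ι ℂ V)
    (hβ : Summable fun i => Real.exp (-β * ε i)) (σ : Equiv.Perm (Fin N)) :
    permOperator σ * gibbsOperator N φ ε β = gibbsOperator N φ ε β * permOperator σ := by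
  have h1 := (hasSum_gibbsOperator (N := N) φ hβ).mul_left (permOperator σ)
  have h2 := (hasSum_gibbsOperator (N := N) φ hβ).mul_right (permOperator σ)
  have h3 := (Equiv.hasSum_iff (Equiv.arrowCongr σ (Equiv.refl ι))).2 h2
  refine h1.unique (h3.congr_fun fun w => ?_)
  have hw : (Equiv.arrowCongr σ (Equiv.refl ι)) w = fun k => w (σ.symm k) := rfl
  rw [Function.comp_apply, hw, mul_smul_comm, smul_mul_assoc]
  congr 1
  · rw [Equiv.sum_comp σ.symm fun k => ε (w k)]
  · ext x
    rw [mul_apply_eq_comp, mul_apply_eq_comp, InnerProductSpace.rankOne_apply,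
      InnerProductSpace.rankOne_apply, map_smul, permOperator_productState,
      ← permOperator_productState σ fun k => φ (w k),
      ← ContinuousLinearMap.adjoint_inner_right, adjoint_permOperator]
    congr 2
    rw [← permAlg_of, ← permAlg_of, ← mul_apply_eq_comp, ← map_mul, ← map_mul, inv_mul_cancel,
      map_one, map_one]
    rfl

lemma permAlg_mul_gibbsOperator (φ : HilbertBasis ι ℂ V)
    (hβ : Summable fun i => Real.exp (-β * ε i)) (a : MonoidAlgebra ℂ (Equiv.Perm (Fin N))) :
    permAlg V N a * gibbsOperator N φ ε β = gibbsOperator N φ ε β * permAlg V N a := by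
  rw [permAlg_eq_sum, Finset.sum_mul, Finset.mul_sum]
  exact Finset.sum_congr rfl fun σ _ => by
    rw [smul_mul_assoc, mul_smul_comm, permOperator_mul_gibbsOperator φ hβ]

/-- The linear functional on `ℂ[S_N]` with value `p_μ(x)` on permutations with cycle lengths `μ`.
For `x_i = e^{-β ε_i}` it is the trace of `e^{-β H_N} a`. -/
def gibbsTrace (x : ι → ℂ) (a : MonoidAlgebra ℂ (Equiv.Perm (Fin N))) : ℂ :=
  ∑ τ, a.coeff τ * cyclePowerSum x τ

lemma gibbsTrace_add (x : ι → ℂ) (a b : MonoidAlgebra ℂ (Equiv.Perm (Fin N))) :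
    gibbsTrace x (a + b) = gibbsTrace x a + gibbsTrace x b := by
  unfold gibbsTrace
  rw [← Finset.sum_add_distrib]
  exact Finset.sum_congr rfl fun τ _ => by
    rw [MonoidAlgebra.coeff_add, Finsupp.add_apply, add_mul]

lemma gibbsTrace_sum {κ : Type*} (x : ι → ℂ) (s : Finset κ)
    (a : κ → MonoidAlgebra ℂ (Equiv.Perm (Fin N))) :
    gibbsTrace x (∑ k ∈ s, a k) = ∑ k ∈ s, gibbsTrace x (a k) :=
  map_sum (AddMonoidHom.mk' (gibbsTrace x) (gibbsTrace_add x)) a s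

/-- A functional that is constant on conjugacy classes is a trace. -/
lemma gibbsTrace_mul_comm (x : ι → ℂ) (a b : MonoidAlgebra ℂ (Equiv.Perm (Fin N))) :
    gibbsTrace x (a * b) = gibbsTrace x (b * a) := by
  have hof : ∀ g : Equiv.Perm (Fin N),
      gibbsTrace x (MonoidAlgebra.of ℂ _ g) = cyclePowerSum x g := fun g => by
    classical
    unfold gibbsTrace
    rw [Finset.sum_eq_single g]
    · simp
    · intro τ _ hτ
      simp [hτ.symm]
    · simp
  have hsmul : ∀ (r : ℂ) (a : MonoidAlgebra ℂ (Equiv.Perm (Fin N))),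
      gibbsTrace x (r • a) = r * gibbsTrace x a := fun r a => by
    unfold gibbsTrace
    rw [Finset.mul_sum]
    exact Finset.sum_congr rfl fun τ _ => by
      rw [MonoidAlgebra.coeff_smul_apply, smul_eq_mul, mul_assoc]
  induction a using MonoidAlgebra.induction_on with
  | of g =>
    induction b using MonoidAlgebra.induction_on with
    | of h =>
      rw [← map_mul, ← map_mul, hof, hof]
      exact cyclePowerSum_of_isConj x (isConj_iff.2 ⟨h, by group⟩)
    | add y z hy hz => rw [mul_add, add_mul, gibbsTrace_add, gibbsTrace_add, hy, hz]
    | smul r y hy => rw [mul_smul_comm, smul_mul_assoc, hsmul, hsmul, hy]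
  | add y z hy hz => rw [mul_add, add_mul, gibbsTrace_add, gibbsTrace_add, hy, hz]
  | smul r y hy => rw [mul_smul_comm, smul_mul_assoc, hsmul, hsmul, hy]

/-- The trace of `e^{-β H_N} a` in the product basis: `σ` maps a product basis vector to another, so
that only words invariant under `σ` contribute. -/
lemma hasSum_gibbsTrace (φ : HilbertBasis ι ℂ V) (hβ : Summable fun i => Real.exp (-β * ε i))
    (a : MonoidAlgebra ℂ (Equiv.Perm (Fin N))) :
    HasSum (fun w : Fin N → ι => (Real.exp (-β * ∑ k, ε (w k)) : ℂ) *
      ⟪productState fun k => φ (w k), permAlg V N a (productState fun k => φ (w k))⟫_ℂ)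
      (gibbsTrace (fun i => (Real.exp (-β * ε i) : ℂ)) a) := by
  classical
  have hx := summable_norm_boltzmann hβ
  have h := hasSum_sum (s := Finset.univ) fun (τ : Equiv.Perm (Fin N)) _ =>
    (hasSum_invariant_words hx τ.symm).mul_left (a.coeff τ)
  have hinv : ∀ τ : Equiv.Perm (Fin N), cyclePowerSum (fun i => (Real.exp (-β * ε i) : ℂ)) τ.symm
      = cyclePowerSum (fun i => (Real.exp (-β * ε i) : ℂ)) τ := cyclePowerSum_inv _
  simp only [hinv] at h
  refine h.congr_fun fun w => ?_
  rw [permAlg_eq_sum, sum_apply, inner_sum, Finset.mul_sum]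
  refine Finset.sum_congr rfl fun τ _ => ?_
  rw [smul_apply, inner_smul_right, permOperator_productState,
    inner_productState_basis φ w fun k => w (τ.symm k), boltzmann_eq_prod]
  simp only [eq_comm (a := w)]
  split_ifs
  · push_cast
    ring
  · ring

/-- The functional `gibbsTrace` only depends on the operator by which an element of `ℂ[S_N]`
acts. -/
lemma gibbsTrace_congr (φ : HilbertBasis ι ℂ V) (hβ : Summable fun i => Real.exp (-β * ε i))
    {a b : MonoidAlgebra ℂ (Equiv.Perm (Fin N))} (h : permAlg V N a = permAlg V N b) :
    gibbsTrace (fun i => (Real.exp (-β * ε i) : ℂ)) a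
      = gibbsTrace (fun i => (Real.exp (-β * ε i) : ℂ)) b :=
  (hasSum_gibbsTrace φ hβ a).unique (by rw [h]; exact hasSum_gibbsTrace φ hβ b)

/-- The trace of `e^{-β H_N}` over a closed subspace, in any orthonormal basis of the subspace,
when the projection onto the subspace is a combination of permutations. All terms of the double sum
over the two orthonormal bases are nonnegative, so that the order of summation does not matter. -/
lemma hasSum_inner_gibbsOperator (φ : HilbertBasis ι ℂ V)
    (hβ : Summable fun i => Real.exp (-β * ε i)) {D : Submodule ℂ (NParticleSpace V N)}
    [CompleteSpace D] {p : MonoidAlgebra ℂ (Equiv.Perm (Fin N))}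
    (hp : D.starProjection = permAlg V N p) {κ : Type*} (b : HilbertBasis κ ℂ D) :
    HasSum (fun j => ⟪(b j : NParticleSpace V N), gibbsOperator N φ ε β (b j)⟫_ℂ)
      (gibbsTrace (fun i => (Real.exp (-β * ε i) : ℂ)) p) := by
  let Φ : (Fin N → ι) → NParticleSpace V N := fun w => productState fun k => φ (w k)
  let x : (Fin N → ι) → ℝ := fun w => Real.exp (-β * ∑ k, ε (w k))
  have hx0 : ∀ w, 0 ≤ x w := fun w => Real.exp_nonneg _
  let F : (Fin N → ι) × κ → ℝ := fun q => x q.1 * ‖⟪(b q.2 : NParticleSpace V N), Φ q.1⟫_ℂ‖ ^ 2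
  have hF0 : 0 ≤ F := fun q => mul_nonneg (hx0 _) (by positivity)
  have hrow : ∀ w, HasSum (fun j => F (w, j)) (x w * ‖D.starProjection (Φ w)‖ ^ 2) := by
    intro w
    refine HasSum.mul_left (x w) ?_
    have h1 := b.hasSum_inner_mul_inner (D.orthogonalProjectionOnto (Φ w))
      (D.orthogonalProjectionOnto (Φ w))
    rw [inner_self_eq_norm_sq_to_K] at h1
    have h2 : ∀ j, ⟪b j, D.orthogonalProjectionOnto (Φ w)⟫_ℂ
        = ⟪(b j : NParticleSpace V N), Φ w⟫_ℂ := fun j => by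
      rw [Submodule.coe_inner, ← Submodule.starProjection_apply,
        ← Submodule.inner_starProjection_left_eq_right,
        Submodule.starProjection_eq_self_iff.2 (b j).2]
    have h3 : HasSum (fun j => ((‖⟪(b j : NParticleSpace V N), Φ w⟫_ℂ‖ ^ 2 : ℝ) : ℂ))
        ((‖D.starProjection (Φ w)‖ ^ 2 : ℝ) : ℂ) := by
      refine Eq.subst (motive := fun z => HasSum _ z) ?_ (h1.congr_fun fun j => ?_)
      · rw [Submodule.starProjection_apply, Submodule.coe_norm]
        push_cast
        rfl
      · rw [← inner_conj_symm (D.orthogonalProjectionOnto (Φ w)) (b j), h2,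
          ← Complex.normSq_eq_conj_mul_self, Complex.normSq_eq_norm_sq]
    exact Complex.hasSum_ofReal.1 h3
  have hsumrow : Summable fun w => x w * ‖D.starProjection (Φ w)‖ ^ 2 := by
    refine Summable.of_nonneg_of_le (fun w => mul_nonneg (hx0 _) (by positivity)) (fun w => ?_)
      (summable_boltzmann (N := N) hβ)
    refine mul_le_of_le_one_right (hx0 w) (pow_le_one₀ (norm_nonneg _) ?_)
    exact (D.norm_starProjection_apply_le _).trans (norm_productState_basis φ w).le
  have hF : Summable F := by
    refine (summable_prod_of_nonneg hF0).2 ⟨fun w => (hrow w).summable, ?_⟩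
    exact hsumrow.congr fun w => (hrow w).tsum_eq.symm
  have htot : HasSum F (∑' q, F q) := hF.hasSum
  have h1 := htot.prod_fiberwise hrow
  have h2 : ((∑' q, F q : ℝ) : ℂ) = gibbsTrace (fun i => (Real.exp (-β * ε i) : ℂ)) p := by
    have h3 := hasSum_gibbsTrace φ hβ p
    refine (Complex.hasSum_ofReal.2 h1).unique (h3.congr_fun fun w => ?_)
    rw [← hp, ← Submodule.starProjection_eq_self_iff.2 (D.starProjection_apply_mem (Φ w)),
      ← Submodule.inner_starProjection_left_eq_right, inner_self_eq_norm_sq_to_K,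
      Submodule.starProjection_eq_self_iff.2 (D.starProjection_apply_mem (Φ w))]
    rw [Complex.ofReal_mul, Complex.ofReal_pow]
    rfl
  rw [← h2]
  have hcol : ∀ j, HasSum (fun w => F (w, j))
      (∑' w, F (w, j)) := fun j => (hF.prod_symm.prod_factor j).hasSum
  have h4 : HasSum (fun j => ∑' w, F (w, j)) (∑' q, F q) := by
    have h5 : HasSum (fun q : κ × (Fin N → ι) => F q.swap) (∑' q, F q) :=
      (Equiv.prodComm κ (Fin N → ι)).hasSum_iff.2 htot
    exact h5.prod_fiberwise hcol
  refine (Complex.hasSum_ofReal.2 h4).congr_fun fun j => ?_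
  have h6 := (hasSum_gibbsOperator (N := N) φ hβ)
  have h7 := ((innerSL ℂ (b j : NParticleSpace V N)).comp
    (ContinuousLinearMap.apply ℂ (NParticleSpace V N) (b j : NParticleSpace V N))).hasSum h6
  refine h7.unique ((Complex.hasSum_ofReal.2 (hcol j)).congr_fun fun w => ?_)
  change ⟪(b j : NParticleSpace V N), (x w : ℂ) • ⟪Φ w, (b j : NParticleSpace V N)⟫_ℂ • Φ w⟫_ℂ
    = ((x w * ‖⟪(b j : NParticleSpace V N), Φ w⟫_ℂ‖ ^ 2 : ℝ) : ℂ)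
  rw [inner_smul_right, inner_smul_right, ← inner_conj_symm (Φ w),
    ← Complex.normSq_eq_conj_mul_self, Complex.normSq_eq_norm_sq,
    Complex.ofReal_mul]

end Gibbs

/-! ### Projections onto stable subspaces -/

section Projection

variable {V : Type*} [NormedAddCommGroup V] [InnerProductSpace ℂ V] {N : ℕ}

/-- The projection onto a closed subspace stable under all `U ⊗ ⋯ ⊗ U` commutes with these
operators, hence is a combination of permutations. -/
lemma exists_starProjection_eq_permAlg {D : Submodule ℂ (NParticleSpace V N)} [CompleteSpace D]
    (hD : UnitaryStable D) : ∃ p, D.starProjection = permAlg V N p := by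
  refine exists_permAlg_eq fun U => ?_
  ext x
  rw [mul_apply_eq_comp, mul_apply_eq_comp]
  refine Submodule.eq_starProjection_of_mem_of_inner_eq_zero
    (hD U _ (D.starProjection_apply_mem x)) fun w hw => ?_
  rw [← map_sub, ← ContinuousLinearMap.adjoint_inner_right, adjoint_unitaryPower]
  exact D.starProjection_inner_eq_zero x _ (hD U.symm w hw)

/-- The properties of the projection, in terms of the element of `ℂ[S_N]` by which it acts. -/
lemma exists_permAlg_projection {D : Submodule ℂ (NParticleSpace V N)} [CompleteSpace D]
    (hD : UnitaryStable D) : ∃ p, D.starProjection = permAlg V N p ∧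
      permAlg V N (p * p) = permAlg V N p ∧ permAlg V N (groupStar p) = permAlg V N p ∧
      ∀ x, x ∈ D ↔ permAlg V N p x = x := by
  obtain ⟨p, hp⟩ := exists_starProjection_eq_permAlg hD
  refine ⟨p, hp, ?_, ?_, fun x => ?_⟩
  · rw [map_mul, ← hp]
    exact D.isIdempotentElem_starProjection
  · rw [← adjoint_permAlg, ← hp]
    exact (isSelfAdjoint_starProjection D)
  · rw [← hp, Submodule.starProjection_eq_self_iff]

end Projection

/-! ### Vectors of given symmetry type -/

section SymmetryType

variable {V : Type*} [NormedAddCommGroup V] [InnerProductSpace ℂ V] {N : ℕ}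

variable (V) in
/-- The symmetry type is also the range of the self-adjoint projection, which generates the same
right ideal as the Young symmetrizer. -/
lemma mem_symmetrySubspace {l : N.Partition} {x : NParticleSpace V N} :
    x ∈ symmetrySubspace V l ↔ permAlg V N (youngProjection l) x = x := by
  have he : ∀ y, (permRep V N).asAlgebraHom (youngSymmetrizer l) y
      = permAlg V N (youngProjection l) (permAlg V N (youngSymmetrizer l) y) := fun y => by
    rw [permRep_asAlgebraHom, ← mul_apply_eq_comp, ← map_mul, youngSymmetrizer_eq_smul,
      mul_smul_comm, youngProjection_mul_youngIdempotent]
  constructor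
  · rintro ⟨y, rfl⟩
    rw [he, ← mul_apply_eq_comp, ← map_mul, youngProjection_mul_self]
  · intro h
    refine ⟨permAlg V N ((youngScalar l)⁻¹ • youngProjection l) x, ?_⟩
    rw [permRep_asAlgebraHom, ← mul_apply_eq_comp, ← map_mul, youngSymmetrizer_eq_smul,
      smul_mul_smul_comm, mul_inv_cancel₀ (youngScalar_ne_zero l), one_smul,
      youngIdempotent_mul_youngProjection, h]

lemma permAlg_groupStar_congr {a b : MonoidAlgebra ℂ (Equiv.Perm (Fin N))}
    (h : permAlg V N a = permAlg V N b) :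
    permAlg V N (groupStar a) = permAlg V N (groupStar b) := by
  rw [← adjoint_permAlg, ← adjoint_permAlg, h]

/-- The orbit map `a ↦ a y` of `ℂ[S_N]` acting on the `N`-particle space. -/
def orbitMap (y : NParticleSpace V N) :
    MonoidAlgebra ℂ (Equiv.Perm (Fin N)) →ₗ[ℂ] NParticleSpace V N :=
  (ContinuousLinearMap.apply ℂ (NParticleSpace V N) y).toLinearMap.comp (permAlg V N).toLinearMap

@[simp]
lemma orbitMap_apply (y : NParticleSpace V N) (a : MonoidAlgebra ℂ (Equiv.Perm (Fin N))) :
    orbitMap y a = permAlg V N a y := rfl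

lemma permRep_apply (σ : Equiv.Perm (Fin N)) (y : NParticleSpace V N) :
    permRep V N σ y = permAlg V N (MonoidAlgebra.of ℂ _ σ) y := by
  rw [permAlg_of]
  rfl

lemma range_orbitMap (y : NParticleSpace V N) :
    LinearMap.range (orbitMap y) = Submodule.span ℂ (Set.range fun σ => permRep V N σ y) := by
  refine le_antisymm ?_ (Submodule.span_le.2 ?_)
  · rintro _ ⟨a, rfl⟩
    rw [orbitMap_apply, permAlg_eq_sum, sum_apply]
    exact Submodule.sum_mem _ fun σ _ => Submodule.smul_mem _ _ (Submodule.subset_span ⟨σ, rfl⟩)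
  · rintro _ ⟨σ, rfl⟩
    exact ⟨MonoidAlgebra.of ℂ _ σ, (permRep_apply σ y).symm⟩

/-- A vector is zero if its orbit has no component of any symmetry type: the orbit spans a
finite-dimensional representation, to which the completeness of the Specht modules applies. -/
lemma eq_zero_of_forall_permAlg {y : NParticleSpace V N}
    (h : ∀ (l : N.Partition) x, permAlg V N (youngIdempotent l * x) y = 0) : y = 0 := by
  let ρ := (permRep V N).subrepresentation (LinearMap.range (orbitMap y)) (by
    rintro σ _ ⟨a, rfl⟩
    refine ⟨MonoidAlgebra.of ℂ _ σ * a, ?_⟩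
    rw [permRep_apply, orbitMap_apply, orbitMap_apply, map_mul, mul_apply_eq_comp])
  let T : ρ.IntertwiningMap (permRep V N) := ⟨(LinearMap.range (orbitMap y)).subtype, fun _ => rfl⟩
  have h0 := eq_zero_of_forall_youngIdempotent ρ (fun l => by
    ext ⟨_, a, rfl⟩
    have h1 := intertwining_asAlgebraHom T (youngIdempotent l) ⟨_, a, rfl⟩
    refine h1.trans ?_
    rw [permRep_asAlgebraHom]
    refine Eq.trans ?_ (h l a)
    rw [map_mul, mul_apply_eq_comp]
    rfl) ⟨_, 1, rfl⟩
  have h2 := congrArg Subtype.val h0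
  change permAlg V N 1 y = 0 at h2
  rwa [map_one] at h2

/-- Two combinations of permutations that agree on every symmetry type agree. -/
lemma permAlg_eq_of_forall_mul {a b : MonoidAlgebra ℂ (Equiv.Perm (Fin N))}
    (h : ∀ (l : N.Partition) x, permAlg V N (a * (x * youngProjection l))
      = permAlg V N (b * (x * youngProjection l))) :
    permAlg V N a = permAlg V N b := by
  have h' : ∀ (l : N.Partition) x, permAlg V N (youngIdempotent l * x * groupStar a)
      = permAlg V N (youngIdempotent l * x * groupStar b) := fun l x => by
    have h1 := permAlg_groupStar_congr (h l (groupStar (youngIdempotent l * x)))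
    rwa [groupStar_mul, groupStar_mul, groupStar_groupStar, groupStar_youngProjection,
      groupStar_mul, groupStar_mul, groupStar_groupStar, groupStar_youngProjection,
      ← mul_assoc (youngProjection l), youngProjection_mul_youngIdempotent] at h1
  have h2 : permAlg V N (groupStar a) = permAlg V N (groupStar b) := by
    ext y
    rw [← sub_eq_zero]
    refine eq_zero_of_forall_permAlg fun l x => ?_
    rw [map_sub, sub_eq_zero, ← mul_apply_eq_comp, ← mul_apply_eq_comp, ← map_mul, ← map_mul,
      h' l x]
  have h3 := permAlg_groupStar_congr h2
  rwa [groupStar_groupStar, groupStar_groupStar] at h3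

/-- The orbit map `z ↦ z y` on the Specht module, as an intertwining map. -/
def spechtOrbitMap (l : N.Partition) (y : NParticleSpace V N) :
    (spechtRep l).IntertwiningMap (permRep V N) where
  toLinearMap := (orbitMap y).comp (spechtModule l).subtype
  isIntertwining' σ := by
    ext z
    have h := spechtRep_asAlgebraHom l (MonoidAlgebra.of ℂ _ σ) z
    rw [Representation.asAlgebraHom_of] at h
    simp only [LinearMap.comp_apply, Submodule.subtype_apply, orbitMap_apply, h, permRep_apply,
      map_mul, mul_apply_eq_comp]

lemma spechtOrbitMap_apply (l : N.Partition) (y : NParticleSpace V N) (z : spechtModule l) :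
    (spechtOrbitMap l y).toLinearMap z = permAlg V N z y := rfl

lemma youngIdempotent_apply_of_mem {l : N.Partition} {y : NParticleSpace V N}
    (hy : y ∈ symmetrySubspace V l) : permAlg V N (youngIdempotent l) y = y := by
  rw [mem_symmetrySubspace] at hy
  rw [← hy, ← mul_apply_eq_comp, ← map_mul, youngIdempotent_mul_youngProjection]

lemma range_spechtOrbitMap {l : N.Partition} {y : NParticleSpace V N}
    (hy : y ∈ symmetrySubspace V l) :
    LinearMap.range (spechtOrbitMap l y).toLinearMap = LinearMap.range (orbitMap y) := by
  refine le_antisymm (LinearMap.range_comp_le_range _ _) ?_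
  rintro _ ⟨a, rfl⟩
  refine ⟨⟨_, mul_youngIdempotent_mem l a⟩, ?_⟩
  rw [spechtOrbitMap_apply, map_mul, mul_apply_eq_comp, youngIdempotent_apply_of_mem hy,
    orbitMap_apply]

lemma injective_spechtOrbitMap {l : N.Partition} {y : NParticleSpace V N}
    (hy : y ∈ symmetrySubspace V l) (hy0 : y ≠ 0) :
    Function.Injective (spechtOrbitMap l y).toLinearMap := by
  have := isIrreducible_spechtRep l
  refine (Representation.IsIrreducible.injective_or_eq_zero (spechtOrbitMap l y)).resolve_right
    fun h => hy0 ?_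
  have h1 : (spechtOrbitMap l y).toLinearMap ⟨_, youngIdempotent_mem l⟩ = 0 := by
    rw [h]
    rfl
  rwa [spechtOrbitMap_apply, youngIdempotent_apply_of_mem hy] at h1

end SymmetryType

/-! ### Ranges of partial isometries in the group algebra -/

section PartialIsometry

variable {V : Type*} [NormedAddCommGroup V] [InnerProductSpace ℂ V] {N : ℕ}
  {l : N.Partition} {z : MonoidAlgebra ℂ (Equiv.Perm (Fin N))}

/-- The hypotheses say that `z` acts as a partial isometry with initial projection `f_λ`; its range
is then the range of the projection `z z*`. -/
lemma mem_range_permAlg_iff (h1 : permAlg V N (z * youngProjection l) = permAlg V N z)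
    (h2 : permAlg V N (groupStar z * z) = permAlg V N (youngProjection l))
    {x : NParticleSpace V N} : x ∈ LinearMap.range (permAlg V N z).toLinearMap ↔
      permAlg V N (z * groupStar z) x = x := by
  constructor
  · rintro ⟨y, rfl⟩
    change permAlg V N (z * groupStar z) (permAlg V N z y) = permAlg V N z y
    rw [← mul_apply_eq_comp, ← map_mul, mul_assoc, map_mul, h2, ← map_mul, h1]
  · intro h
    exact ⟨permAlg V N (groupStar z) x, by
      rw [map_mul, mul_apply_eq_comp] at h
      exact h⟩

lemma groupStar_apply_mem (h1 : permAlg V N (z * youngProjection l) = permAlg V N z)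
    (x : NParticleSpace V N) : permAlg V N (groupStar z) x ∈ symmetrySubspace V l := by
  have h := permAlg_groupStar_congr h1
  rw [groupStar_mul, groupStar_youngProjection] at h
  rw [mem_symmetrySubspace, ← mul_apply_eq_comp, ← map_mul, h]

lemma unitaryIrreducible_range (hf : permAlg V N (youngProjection l) ≠ 0)
    (h1 : permAlg V N (z * youngProjection l) = permAlg V N z)
    (h2 : permAlg V N (groupStar z * z) = permAlg V N (youngProjection l)) :
    UnitaryIrreducible (LinearMap.range (permAlg V N z).toLinearMap) := by
  have hmem := fun x => mem_range_permAlg_iff (x := x) h1 h2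
  refine ⟨?_, ?_, ?_, fun W' hW' hc hU => ?_⟩
  · have : ((LinearMap.range (permAlg V N z).toLinearMap : Submodule ℂ (NParticleSpace V N)) :
        Set (NParticleSpace V N)) = {x | permAlg V N (z * groupStar z) x = x} := Set.ext hmem
    rw [this]
    exact isClosed_eq (permAlg V N (z * groupStar z)).continuous continuous_id
  · rintro U _ ⟨y, rfl⟩
    refine ⟨unitaryPower N U y, ?_⟩
    exact (DFunLike.congr_fun (unitaryPower_mul_permAlg U z) y).symm
  · intro h
    have hz : permAlg V N z = 0 := by
      ext x
      exact (Submodule.eq_bot_iff _).1 h _ ⟨x, rfl⟩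
    rw [map_mul, hz, mul_zero] at h2
    exact hf h2.symm
  · have : CompleteSpace W' := hc.completeSpace_coe
    obtain ⟨p, hp, hpp, hps, hpW⟩ := exists_permAlg_projection hU
    -- `W' ≤ W` means that the projection `p` onto `W'` is `q p q` with `q = z z*`, and
    -- `z* p z` is a multiple of the minimal projection `f`.
    have hqp : permAlg V N (z * groupStar z * p) = permAlg V N p := by
      ext x
      rw [map_mul, mul_apply_eq_comp]
      refine (hmem _).1 (hW' ((hpW _).2 ?_))
      rw [← mul_apply_eq_comp, ← map_mul, hpp]
    have hpq : permAlg V N (p * (z * groupStar z)) = permAlg V N p := by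
      have h := permAlg_groupStar_congr hqp
      rw [groupStar_mul, groupStar_mul, groupStar_groupStar, map_mul, hps] at h
      rw [map_mul, h]
    have hfz : permAlg V N (youngProjection l * groupStar z) = permAlg V N (groupStar z) := by
      have h := permAlg_groupStar_congr h1
      rwa [groupStar_mul, groupStar_youngProjection] at h
    obtain ⟨s, hs⟩ := exists_youngProjection_mul_mul l (groupStar z * p * z)
    have hsz : permAlg V N p = s • permAlg V N (z * groupStar z) := by
      have h : permAlg V N p = permAlg V N z * permAlg V N (youngProjection l *
          (groupStar z * p * z) * youngProjection l) * permAlg V N (groupStar z) := by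
        rw [← hqp, map_mul, ← hpq]
        simp only [map_mul] at h1 hfz hpq hqp ⊢
        simp only [mul_assoc] at h1 hfz hpq hqp ⊢
        rw [hfz, ← mul_assoc (permAlg V N (youngProjection l)), hfz]
      rw [h, hs, map_smul, mul_smul_comm, smul_mul_assoc, ← map_mul, h1, ← map_mul]
    by_cases hbot : W' = ⊥
    · exact Or.inl hbot
    obtain ⟨x, hx, hx0⟩ := W'.ne_bot_iff.1 hbot
    have hs1 : s = 1 := by
      have h := (hpW x).1 hx
      rw [hsz, smul_apply, (hmem x).1 (hW' hx)] at h
      exact smul_left_injective ℂ hx0 (h.trans (one_smul ℂ x).symm)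
    refine Or.inr (Submodule.ext fun y => ?_)
    rw [hpW, hmem, hsz, hs1, one_smul]

/-- The isomorphism is `z` itself, which commutes with all `U ⊗ ⋯ ⊗ U`. -/
lemma unitaryEquivalent_range
    (h1 : permAlg V N (z * youngProjection l) = permAlg V N z)
    (h2 : permAlg V N (groupStar z * z) = permAlg V N (youngProjection l)) :
    UnitaryEquivalent (symmetrySubspace V l) (LinearMap.range (permAlg V N z).toLinearMap) := by
  let T₀ : symmetrySubspace V l →ₗ[ℂ] LinearMap.range (permAlg V N z).toLinearMap :=
    (permAlg V N z).toLinearMap.rangeRestrict.comp (symmetrySubspace V l).subtype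
  let T : symmetrySubspace V l →ₗᵢ[ℂ] LinearMap.range (permAlg V N z).toLinearMap :=
    T₀.isometryOfInner fun x y => by
      change ⟪permAlg V N z x, permAlg V N z y⟫_ℂ = ⟪(x : NParticleSpace V N), y⟫_ℂ
      rw [← ContinuousLinearMap.adjoint_inner_right, adjoint_permAlg, ← mul_apply_eq_comp,
        ← map_mul, h2, (mem_symmetrySubspace V).1 y.2]
  have hT : Function.Surjective T := by
    rintro ⟨_, x, rfl⟩
    refine ⟨⟨permAlg V N (youngProjection l) x, (mem_symmetrySubspace V).2 ?_⟩, Subtype.ext ?_⟩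
    · rw [← mul_apply_eq_comp, ← map_mul, youngProjection_mul_self]
    · change permAlg V N z (permAlg V N (youngProjection l) x) = permAlg V N z x
      rw [← mul_apply_eq_comp, ← map_mul, h1]
  refine ⟨LinearIsometryEquiv.ofSurjective T hT, fun U x y hxy => ?_⟩
  change permAlg V N z y = unitaryPower N U (permAlg V N z x)
  rw [hxy, ← mul_apply_eq_comp, ← unitaryPower_mul_permAlg, mul_apply_eq_comp]

/-- The vectors `x` and `z* x` generate the same representation of `S_N`, and `z* x` has symmetry
type `λ`. -/
lemma carriesSpecht_of_mem_range
    (h1 : permAlg V N (z * youngProjection l) = permAlg V N z)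
    (h2 : permAlg V N (groupStar z * z) = permAlg V N (youngProjection l))
    {x : NParticleSpace V N} (hx : x ∈ LinearMap.range (permAlg V N z).toLinearMap)
    (hx0 : x ≠ 0) : CarriesSpecht l x := by
  have hy := groupStar_apply_mem h1 x
  have hzy : permAlg V N z (permAlg V N (groupStar z) x) = x := by
    rw [← mul_apply_eq_comp, ← map_mul]
    exact (mem_range_permAlg_iff h1 h2).1 hx
  refine ⟨spechtOrbitMap l (permAlg V N (groupStar z) x),
    injective_spechtOrbitMap hy fun h => hx0 (by rw [← hzy, h, map_zero]), ?_⟩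
  rw [range_spechtOrbitMap hy, ← range_orbitMap]
  apply le_antisymm
  · rintro _ ⟨a, rfl⟩
    exact ⟨a * groupStar z, by rw [orbitMap_apply, orbitMap_apply, map_mul, mul_apply_eq_comp]⟩
  · rintro _ ⟨a, rfl⟩
    exact ⟨a * z, by
      rw [orbitMap_apply, orbitMap_apply, map_mul, mul_apply_eq_comp, hzy]⟩

end PartialIsometry

/-! ### Multiplicity spaces -/

section Multiplicity

variable {V : Type*} [NormedAddCommGroup V] [InnerProductSpace ℂ V] {N : ℕ}

/-- Partial isometries `z k` with initial projection `f_λ` and mutually orthogonal ranges in the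
range of the projection `p`, which span the operators `p x f_λ`. A unit vector `y = f_λ y`
identifies these operators with their values at `y`, and the `z k` correspond to an orthonormal
basis. If `p` fixes the symmetry type `λ`, then the values at `y` form a copy of the Specht module.
-/
lemma exists_orthonormal_partialIsometries {p : MonoidAlgebra ℂ (Equiv.Perm (Fin N))}
    (hpp : permAlg V N (p * p) = permAlg V N p) (l : N.Partition) :
    ∃ (n : ℕ) (z : Fin n → MonoidAlgebra ℂ (Equiv.Perm (Fin N))),
      (n ≠ 0 → permAlg V N (youngProjection l) ≠ 0) ∧
      (∀ k, permAlg V N (z k * youngProjection l) = permAlg V N (z k)) ∧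
      (∀ k, permAlg V N (p * z k) = permAlg V N (z k)) ∧
      (∀ j k, permAlg V N (groupStar (z j) * z k)
        = if j = k then permAlg V N (youngProjection l) else 0) ∧
      (∀ x, ∃ c : Fin n → ℂ, permAlg V N (p * (x * youngProjection l))
        = ∑ k, c k • permAlg V N (z k)) ∧
      (permAlg V N (youngProjection l) ≠ 0 →
        (∀ x, permAlg V N (p * (x * youngProjection l)) = permAlg V N (x * youngProjection l)) →
          n = Module.finrank ℂ (spechtModule l)) := by
  by_cases hf : permAlg V N (youngProjection l) = 0
  -- If `V` is too small for the symmetry type, then there are no operators `p x f_λ ≠ 0`.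
  · refine ⟨0, Fin.elim0, by simp, fun k => k.elim0, fun k => k.elim0, fun k => k.elim0,
      fun x => ⟨0, ?_⟩, fun h => absurd hf h⟩
    rw [map_mul, map_mul, hf, mul_zero, mul_zero]
    rfl
  obtain ⟨y, hy, hy1⟩ : ∃ y, permAlg V N (youngProjection l) y = y ∧ ‖y‖ = 1 := by
    obtain ⟨x, hx⟩ : ∃ x, permAlg V N (youngProjection l) x ≠ 0 := by
      by_contra! h
      exact hf (ContinuousLinearMap.ext h)
    refine ⟨(‖permAlg V N (youngProjection l) x‖⁻¹ : ℂ) • permAlg V N (youngProjection l) x, ?_,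
      norm_smul_inv_norm hx⟩
    rw [map_smul, ← mul_apply_eq_comp, ← map_mul, youngProjection_mul_self]
  let X : Submodule ℂ (NParticleSpace V N) :=
    LinearMap.range ((permAlg V N p).toLinearMap.comp (orbitMap y))
  let b := stdOrthonormalBasis ℂ X
  have hb : ∀ k, ∃ w, permAlg V N (p * (w * youngProjection l)) y = b k := fun k => by
    obtain ⟨w, hw⟩ := (b k).2
    refine ⟨w, ?_⟩
    rw [map_mul, map_mul, mul_apply_eq_comp, mul_apply_eq_comp, hy]
    exact hw
  choose w hw using hb
  have hff : ∀ a, a * youngProjection l * youngProjection l = a * youngProjection l := fun a => by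
    rw [mul_assoc, youngProjection_mul_self]
  -- An operator of the form `x f` is determined by its value at `y`.
  have hinj : ∀ a : MonoidAlgebra ℂ (Equiv.Perm (Fin N)),
      permAlg V N (a * youngProjection l) y = 0 → permAlg V N (a * youngProjection l) = 0 := by
    intro a ha
    obtain ⟨s, hs⟩ := exists_youngProjection_mul_mul l (groupStar a * a)
    have hE : groupStar (a * youngProjection l) * (a * youngProjection l)
        = s • youngProjection l := by
      rw [groupStar_mul, groupStar_youngProjection, ← hs]
      simp only [mul_assoc]
    have hz : permAlg V N (groupStar (a * youngProjection l) * (a * youngProjection l)) = 0 := by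
      have h : permAlg V N (groupStar (a * youngProjection l) * (a * youngProjection l)) y = 0 := by
        rw [map_mul, mul_apply_eq_comp, ha, map_zero]
      rw [hE, map_smul, smul_apply, hy] at h
      have hs0 := (smul_eq_zero.1 h).resolve_right
        (norm_ne_zero_iff.1 (by rw [hy1]; exact one_ne_zero))
      rw [hE, hs0, zero_smul, map_zero]
    rw [map_mul, ← adjoint_permAlg] at hz
    exact ContinuousLinearMap.ext fun x => by
      rw [zero_apply, ← inner_self_eq_zero (𝕜 := ℂ), ← ContinuousLinearMap.adjoint_inner_right,
        ← mul_apply_eq_comp, hz, zero_apply, inner_zero_right]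
  refine ⟨Module.finrank ℂ X, fun k => p * (w k * youngProjection l), fun _ => hf, fun k => ?_,
    fun k => ?_, fun j k => ?_, fun x => ?_, fun _ hstable => ?_⟩
  · rw [mul_assoc, hff]
  · rw [← mul_assoc, map_mul, hpp, ← map_mul]
  · obtain ⟨s, hs⟩ := exists_youngProjection_mul_mul l
      (groupStar (p * w j) * (p * w k))
    have hE : groupStar (p * (w j * youngProjection l)) * (p * (w k * youngProjection l))
        = s • youngProjection l := by
      rw [← mul_assoc p, ← mul_assoc p, groupStar_mul (p * w j), groupStar_youngProjection, ← hs]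
      simp only [mul_assoc]
    have hI : ⟪(b j : NParticleSpace V N), b k⟫_ℂ = s := by
      rw [← hw j, ← hw k, ← ContinuousLinearMap.adjoint_inner_right, adjoint_permAlg,
        ← mul_apply_eq_comp, ← map_mul, hE, map_smul, smul_apply, hy, inner_smul_right,
        inner_self_eq_norm_sq_to_K, hy1]
      simp
    rw [hE, map_smul, ← hI, ← Submodule.coe_inner, orthonormal_iff_ite.1 b.orthonormal, ite_smul,
      one_smul, zero_smul]
  · have hxX : permAlg V N (p * (x * youngProjection l)) y ∈ X := ⟨x, by
      rw [map_mul, map_mul, mul_apply_eq_comp, mul_apply_eq_comp, hy]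
      rfl⟩
    refine ⟨fun k => b.repr ⟨_, hxX⟩ k, ?_⟩
    have h := hinj (p * x - ∑ k, b.repr ⟨_, hxX⟩ k • (p * w k)) (by
      have h1 := congrArg Subtype.val (b.sum_repr ⟨_, hxX⟩)
      rw [sub_mul, map_sub, sub_apply, sub_eq_zero, mul_assoc, Finset.sum_mul, map_sum, sum_apply]
      refine h1.symm.trans ?_
      rw [Submodule.coe_sum]
      refine Finset.sum_congr rfl fun k _ => ?_
      rw [smul_mul_assoc, map_smul, smul_apply, mul_assoc, hw]
      rfl)
    rw [sub_mul, map_sub, sub_eq_zero, mul_assoc, Finset.sum_mul, map_sum] at h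
    exact h.trans <| Finset.sum_congr rfl fun k _ => by rw [smul_mul_assoc, map_smul, mul_assoc]
  · have hyS : y ∈ symmetrySubspace V l := (mem_symmetrySubspace V).2 hy
    have hXr : X = LinearMap.range (orbitMap y) := by
      change LinearMap.range _ = _
      congr 1
      refine LinearMap.ext fun x => ?_
      have h := DFunLike.congr_fun (hstable x) y
      rw [map_mul, mul_apply_eq_comp, map_mul, mul_apply_eq_comp, hy] at h
      exact h
    rw [hXr, ← range_spechtOrbitMap hyS]
    exact LinearMap.finrank_range_of_inj (injective_spechtOrbitMap hyS
      (norm_ne_zero_iff.1 (by rw [hy1]; exact one_ne_zero)))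

end Multiplicity

/-! ### Resolution of the projection -/

section Decomposition

variable {V : Type*} [NormedAddCommGroup V] [InnerProductSpace ℂ V] {N : ℕ}
  {n : N.Partition → ℕ} {z : (l : N.Partition) → Fin (n l) → MonoidAlgebra ℂ (Equiv.Perm (Fin N))}
  {p : MonoidAlgebra ℂ (Equiv.Perm (Fin N))}

lemma permAlg_groupStar_mul_eq_zero
    (hzf : ∀ l k, permAlg V N (z l k * youngProjection l) = permAlg V N (z l k))
    {l m : N.Partition} (h : l ≠ m) (j : Fin (n l)) (k : Fin (n m)) :
    permAlg V N (groupStar (z l j) * z m k) = 0 := by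
  have h1 := permAlg_groupStar_congr (hzf l j)
  rw [groupStar_mul, groupStar_youngProjection] at h1
  rw [map_mul, ← h1, ← hzf m k, ← map_mul, mul_assoc, ← mul_assoc (groupStar _), ← mul_assoc,
    youngProjection_mul_mul_eq_zero h, map_zero]

/-- The projection `p` is the sum of the final projections of the partial isometries, since the two
agree on every symmetry type. -/
lemma permAlg_eq_sum_mul_groupStar
    (hps : permAlg V N (groupStar p) = permAlg V N p)
    (hzf : ∀ l k, permAlg V N (z l k * youngProjection l) = permAlg V N (z l k))
    (hpz : ∀ l k, permAlg V N (p * z l k) = permAlg V N (z l k))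
    (horth : ∀ l j k, permAlg V N (groupStar (z l j) * z l k)
      = if j = k then permAlg V N (youngProjection l) else 0)
    (hspan : ∀ l x, ∃ c : Fin (n l) → ℂ, permAlg V N (p * (x * youngProjection l))
      = ∑ k, c k • permAlg V N (z l k)) :
    permAlg V N p = permAlg V N (∑ l, ∑ k, z l k * groupStar (z l k)) := by
  have hsum : ∀ l k, permAlg V N (∑ m, ∑ j, z m j * groupStar (z m j)) * permAlg V N (z l k)
      = permAlg V N (z l k) := fun l k => by
    rw [← map_mul, Finset.sum_mul, map_sum, Finset.sum_eq_single l, Finset.sum_mul, map_sum,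
      Finset.sum_eq_single k, mul_assoc, map_mul, horth, if_pos rfl, ← map_mul, hzf]
    · intro j _ hj
      rw [mul_assoc, map_mul, horth, if_neg hj, mul_zero]
    · simp
    · intro m _ hm
      rw [Finset.sum_mul, map_sum]
      exact Finset.sum_eq_zero fun j _ => by
        rw [mul_assoc, map_mul, permAlg_groupStar_mul_eq_zero hzf hm, mul_zero]
    · simp
  have hp : permAlg V N (∑ m, ∑ j, z m j * groupStar (z m j)) * permAlg V N p
      = permAlg V N (∑ m, ∑ j, z m j * groupStar (z m j)) := by
    rw [← map_mul, Finset.sum_mul, map_sum, map_sum]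
    refine Finset.sum_congr rfl fun m _ => ?_
    rw [Finset.sum_mul, map_sum, map_sum]
    refine Finset.sum_congr rfl fun j _ => ?_
    have h := permAlg_groupStar_congr (hpz m j)
    rw [groupStar_mul, map_mul, hps, ← map_mul] at h
    rw [mul_assoc, map_mul, h, map_mul]
  refine permAlg_eq_of_forall_mul fun l x => ?_
  obtain ⟨c, hc⟩ := hspan l x
  rw [map_mul (permAlg V N) (∑ m, _), ← hp, mul_assoc, ← map_mul (permAlg V N) p, hc,
    Finset.mul_sum]
  exact Finset.sum_congr rfl fun k _ => by rw [mul_smul_comm, hsum]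

lemma gibbsTrace_youngProjection {ι : Type*} (x : ι → ℂ) (l : N.Partition) :
    gibbsTrace x (youngProjection l) = schurFunction l x := by
  rw [← youngIdempotent_mul_youngProjection, gibbsTrace_mul_comm,
    youngProjection_mul_youngIdempotent, schurFunction_eq_sum]
  rfl

end Decomposition

/-! ### Permutation-stable subspaces -/

section PermutationStable

variable {V : Type*} [NormedAddCommGroup V] [InnerProductSpace ℂ V] {N : ℕ}
  {D : Submodule ℂ (NParticleSpace V N)} {p : MonoidAlgebra ℂ (Equiv.Perm (Fin N))}

lemma PermutationStable.permAlg_mul_comm (hD : PermutationStable D)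
    (hpp : permAlg V N (p * p) = permAlg V N p)
    (hps : permAlg V N (groupStar p) = permAlg V N p) (hpD : ∀ x, x ∈ D ↔ permAlg V N p x = x)
    (a : MonoidAlgebra ℂ (Equiv.Perm (Fin N))) :
    permAlg V N (p * a) = permAlg V N (a * p) := by
  have h : ∀ a, permAlg V N (p * (a * p)) = permAlg V N (a * p) := fun a => by
    ext x
    rw [map_mul, mul_apply_eq_comp]
    refine (hpD _).1 ?_
    rw [map_mul, mul_apply_eq_comp, permAlg_eq_sum, sum_apply]
    refine Submodule.sum_mem _ fun σ _ => Submodule.smul_mem _ _ (hD σ _ ((hpD _).2 ?_))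
    rw [← mul_apply_eq_comp, ← map_mul, hpp]
  have h1 := permAlg_groupStar_congr (h (groupStar a))
  simp only [groupStar_mul, groupStar_groupStar, map_mul, hps] at h1
  rw [← h a, map_mul, map_mul, map_mul, ← h1, mul_assoc]

/-- A projection that commutes with permutations kills or fixes `e_λ`: by minimality `p e_λ = s
e_λ`, and `s² = s` unless `e_λ` acts as zero. -/
lemma permAlg_mul_youngIdempotent_eq (hpp : permAlg V N (p * p) = permAlg V N p)
    (hcomm : ∀ a, permAlg V N (p * a) = permAlg V N (a * p)) (l : N.Partition) :
    permAlg V N (p * youngIdempotent l) = 0 ∨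
      permAlg V N (p * youngIdempotent l) = permAlg V N (youngIdempotent l) := by
  obtain ⟨s, hs⟩ := exists_youngIdempotent_mul_mul l p
  have h1 : permAlg V N (p * youngIdempotent l) = s • permAlg V N (youngIdempotent l) := by
    rw [← map_smul, ← hs, map_mul _ (_ * p), ← hcomm, ← map_mul, mul_assoc,
      youngIdempotent_mul_self]
  have h2 : s • permAlg V N (p * youngIdempotent l) = permAlg V N (p * youngIdempotent l) := by
    conv_rhs => rw [map_mul, ← hpp, map_mul, mul_assoc, ← map_mul, h1, mul_smul_comm, ← map_mul]
  have h3 : (s - 1) • permAlg V N (p * youngIdempotent l) = 0 := by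
    rw [sub_smul, one_smul, h2, sub_self]
  rcases smul_eq_zero.1 h3 with h | h
  · right
    rw [h1, sub_eq_zero.1 h, one_smul]
  · exact Or.inl h

lemma CarriesSpecht.mem_isotypicSubspace {l : N.Partition} {x : NParticleSpace V N}
    (hx : CarriesSpecht l x) : x ∈ isotypicSubspace V l := by
  obtain ⟨T, -, hT⟩ := hx
  have h : x ∈ LinearMap.range T.toLinearMap := by
    rw [hT]
    exact Submodule.subset_span ⟨1, DFunLike.congr_fun (map_one (permRep V N)) x⟩
  exact Submodule.mem_iSup_of_mem T h

lemma permAlg_mul_mul_youngIdempotent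
    (hcomm : ∀ a, permAlg V N (p * a) = permAlg V N (a * p)) {l : N.Partition}
    (hl : permAlg V N (p * youngIdempotent l) = permAlg V N (youngIdempotent l))
    (x : MonoidAlgebra ℂ (Equiv.Perm (Fin N))) :
    permAlg V N (p * (x * youngIdempotent l)) = permAlg V N (x * youngIdempotent l) := by
  rw [← mul_assoc, map_mul, hcomm, ← map_mul, mul_assoc, map_mul, hl, ← map_mul]

lemma isotypicSubspace_le (hpD : ∀ x, x ∈ D ↔ permAlg V N p x = x)
    (hcomm : ∀ a, permAlg V N (p * a) = permAlg V N (a * p)) {l : N.Partition}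
    (hl : permAlg V N (p * youngIdempotent l) = permAlg V N (youngIdempotent l)) :
    isotypicSubspace V l ≤ D := by
  refine iSup_le fun T => ?_
  rintro _ ⟨y, rfl⟩
  have hy : (spechtRep l).asAlgebraHom (y * youngIdempotent l) ⟨_, youngIdempotent_mem l⟩ = y := by
    refine Subtype.ext ?_
    rw [spechtRep_asAlgebraHom, mul_assoc, youngIdempotent_mul_self, mem_spechtModule.1 y.2]
  have h := intertwining_asAlgebraHom T (y * youngIdempotent l) ⟨_, youngIdempotent_mem l⟩
  rw [hy, permRep_asAlgebraHom] at h
  change T y ∈ D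
  rw [h, hpD, ← mul_apply_eq_comp, ← map_mul, permAlg_mul_mul_youngIdempotent hcomm hl]

end PermutationStable

end IdealGas

end

open scoped InnerProductSpace in
theorem theorem1 {V : Type*} [NormedAddCommGroup V] [InnerProductSpace ℂ V] [CompleteSpace V]
    (N : ℕ) (D : Submodule ℂ (IdealGas.NParticleSpace V N))
    (hDclosed : IsClosed (D : Set (IdealGas.NParticleSpace V N)))
    (hD : IdealGas.UnitaryStable D) :
    -- the representations of `S_N` labelled by partitions are irreducible and inequivalent
    (∀ l : N.Partition, (IdealGas.spechtRep l).IsIrreducible) ∧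
    (∀ l m : N.Partition, l ≠ m →
      IsEmpty (Representation.Equiv (IdealGas.spechtRep l) (IdealGas.spechtRep m))) ∧
    ∃ C : N.Partition → ℕ,
      -- (1) the canonical partition function, the trace of `e^{-β H_N}` over `D`
      (∀ {ι : Type*} (φ : HilbertBasis ι ℂ V) (ε : ι → ℝ) (β : ℝ),
        Summable (fun i => Real.exp (-β * ε i)) →
          (∀ x ∈ D, IdealGas.gibbsOperator N φ ε β x ∈ D) ∧
          ∀ {κ : Type*} (b : HilbertBasis κ ℂ D),
            HasSum
              (fun j => ⟪(b j : IdealGas.NParticleSpace V N),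
                IdealGas.gibbsOperator N φ ε β (b j)⟫_ℂ)
              (∑ l : N.Partition,
                (C l : ℂ) * IdealGas.schurFunction l fun i => (Real.exp (-β * ε i) : ℂ))) ∧
      -- (2) the decomposition of `D`
      (∃ W : (l : N.Partition) → Fin (C l) → Submodule ℂ (IdealGas.NParticleSpace V N),
        OrthogonalFamily ℂ (fun p : (l : N.Partition) × Fin (C l) => W p.1 p.2)
          (fun p => (W p.1 p.2).subtypeₗᵢ) ∧
        ⨆ l, ⨆ k, W l k = D ∧
        ∀ l k, IdealGas.UnitaryIrreducible (W l k) ∧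
          IdealGas.UnitaryEquivalent (IdealGas.symmetrySubspace V l) (W l k) ∧
          ∀ x ∈ W l k, x ≠ 0 → IdealGas.CarriesSpecht l x) ∧
      -- if permutations map `D` to itself, then whole isotypic components of `S_N` occur
      (IdealGas.PermutationStable D →
        (∀ l, C l = 0 ∨ C l = Module.finrank ℂ (IdealGas.spechtModule l)) ∧
        D = ⨆ l, ⨆ _ : C l ≠ 0, IdealGas.isotypicSubspace V l) := by
  open IdealGas in
  have : CompleteSpace D := hDclosed.completeSpace_coe
  obtain ⟨p, hp, hpp, hps, hpD⟩ := exists_permAlg_projection hD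
  choose n z hf hzf hpz horth hspan hcount using exists_orthonormal_partialIsometries hpp
  have hsum := permAlg_eq_sum_mul_groupStar hps hzf hpz horth hspan
  have hzz : ∀ l k, permAlg V N (groupStar (z l k) * z l k) = permAlg V N (youngProjection l) :=
    fun l k => by rw [horth, if_pos rfl]
  have hf0 : ∀ l, Fin (n l) → permAlg V N (youngProjection l) ≠ 0 :=
    fun l k => hf l (Nat.ne_zero_of_lt k.2)
  have hcarries : ∀ l k, ∀ x ∈ LinearMap.range (permAlg V N (z l k)).toLinearMap, x ≠ 0 →
      CarriesSpecht l x :=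
    fun l k x hx hx0 => carriesSpecht_of_mem_range (hzf l k) (hzz l k) hx hx0
  have hsup : ⨆ l, ⨆ k, LinearMap.range (permAlg V N (z l k)).toLinearMap = D := by
    refine le_antisymm (iSup_le fun l => iSup_le fun k => ?_) fun x hx => ?_
    · rintro _ ⟨y, rfl⟩
      refine (hpD _).2 ?_
      change permAlg V N p (permAlg V N (z l k) y) = permAlg V N (z l k) y
      rw [← mul_apply_eq_comp, ← map_mul, hpz]
    · rw [← (hpD x).1 hx, hsum, map_sum, sum_apply]
      refine Submodule.sum_mem _ fun l _ => ?_
      rw [map_sum, sum_apply]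
      refine Submodule.sum_mem _ fun k _ => ?_
      rw [map_mul, mul_apply_eq_comp]
      exact Submodule.mem_iSup_of_mem l (Submodule.mem_iSup_of_mem k ⟨_, rfl⟩)
  refine ⟨isIrreducible_spechtRep, fun l m => isEmpty_equiv_spechtRep, n, ?_, ?_, ?_⟩
  · intro ι φ ε β hβ
    refine ⟨fun x hx => ?_, fun b => ?_⟩
    · rw [hpD, ← mul_apply_eq_comp, permAlg_mul_gibbsOperator φ hβ, mul_apply_eq_comp,
        (hpD x).1 hx]
    · refine Eq.subst (motive := fun t => HasSum _ t) ?_ (hasSum_inner_gibbsOperator φ hβ hp b)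
      rw [gibbsTrace_congr φ hβ hsum, gibbsTrace_sum]
      refine Finset.sum_congr rfl fun l _ => ?_
      rw [gibbsTrace_sum]
      have h : ∀ k, gibbsTrace (fun i => (Real.exp (-β * ε i) : ℂ)) (z l k * groupStar (z l k))
          = schurFunction l fun i => (Real.exp (-β * ε i) : ℂ) := fun k => by
        rw [gibbsTrace_mul_comm, gibbsTrace_congr φ hβ (hzz l k), gibbsTrace_youngProjection]
      rw [Finset.sum_congr rfl fun k _ => h k, Finset.sum_const, Finset.card_univ,
        Fintype.card_fin, nsmul_eq_mul]
  · refine ⟨fun l k => LinearMap.range (permAlg V N (z l k)).toLinearMap,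
      OrthogonalFamily.of_pairwise ?_, hsup, fun l k => ⟨unitaryIrreducible_range (hf0 l k)
        (hzf l k) (hzz l k), unitaryEquivalent_range (hzf l k) (hzz l k), hcarries l k⟩⟩
    rintro ⟨l, j⟩ ⟨m, k⟩ hne
    refine Submodule.isOrtho_iff_inner_eq.2 ?_
    rintro _ ⟨x, rfl⟩ _ ⟨y, rfl⟩
    change ⟪permAlg V N (z l j) x, permAlg V N (z m k) y⟫_ℂ = 0
    have h : permAlg V N (groupStar (z l j) * z m k) = 0 := by
      by_cases hlm : l = m
      · subst hlm
        rw [horth, if_neg fun h => hne (by rw [h])]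
      · exact permAlg_groupStar_mul_eq_zero hzf hlm j k
    rw [← ContinuousLinearMap.adjoint_inner_right, adjoint_permAlg, ← mul_apply_eq_comp,
      ← map_mul, h, zero_apply, inner_zero_right]
  · intro hS
    have hcomm := hS.permAlg_mul_comm hpp hps hpD
    have hcases : ∀ l, n l = 0 ∨
        permAlg V N (p * youngIdempotent l) = permAlg V N (youngIdempotent l) := fun l => by
      refine or_iff_not_imp_left.2 fun h0 =>
        (permAlg_mul_youngIdempotent_eq hpp hcomm l).resolve_left fun h => hf l h0 ?_
      -- If the projection onto `D` kills the type `λ`, then it kills the partial isometries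
      -- `z = p z e f` of type `λ`.
      have hz : permAlg V N (z l ⟨0, Nat.pos_of_ne_zero h0⟩) = 0 := by
        rw [← hpz, map_mul, ← hzf, ← map_mul, ← youngIdempotent_mul_youngProjection,
          ← mul_assoc, ← mul_assoc, map_mul, map_mul, hcomm, map_mul, mul_assoc (permAlg V N _),
          ← map_mul, h, mul_zero, zero_mul]
      rw [← hzz l ⟨0, Nat.pos_of_ne_zero h0⟩, map_mul, hz, mul_zero]
    refine ⟨fun l => or_iff_not_imp_left.2 fun h0 => hcount l (hf l h0) fun x => ?_,
      le_antisymm ?_ ?_⟩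
    · rw [← youngIdempotent_mul_youngProjection, ← mul_assoc x, ← mul_assoc p, map_mul,
        permAlg_mul_mul_youngIdempotent hcomm ((hcases l).resolve_left h0), ← map_mul]
    · rw [← hsup]
      refine iSup_le fun l => iSup_le fun k x hx => ?_
      refine Submodule.mem_iSup_of_mem l (Submodule.mem_iSup_of_mem (Nat.ne_zero_of_lt k.2) ?_)
      by_cases hx0 : x = 0
      · rw [hx0]
        exact Submodule.zero_mem _
      · exact (hcarries l k x hx hx0).mem_isotypicSubspace
    · exact iSup_le fun l => iSup_le fun h0 =>
        isotypicSubspace_le hpD hcomm ((hcases l).resolve_left h0)
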